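/- Let $\mathcal H$ be a complex Hilbert space, $\mathcal B_2(\mathcal H)$ the Hilbert–Schmidt operators with the norm $\|T\|_2=\mathrm{Tr}(T^*T)^{1/2}$, and $\mathcal B_2(\mathcal H)_h$, $\mathcal B_2(\mathcal H)_{ah}$ the real Hilbert spaces of Hermitian and anti-Hermitian elements of $\mathcal B_2(\mathcal H)$. Fix an orthogonal projection $P_+$ on $\mathcal H$ and let $$\mathcal R_2^+=\{(P,f): P=P^*=P^2,\ P-P_+\in\mathcal B_2(\mathcal H),\ \mathrm{index}(PP_+:R(P_+)\to R(P))=0,\ f\in\mathcal H,\ Pf=f,\ \|f\|=1\},$$ regarded as a subset (an embedded submanifold) of the real Hilbert space $\mathcal B_2(\mathcal H)_h\times\mathcal H$ by means of $(P,f)\mapsto(P-P_+,f)$. For $x=(P,f)\in\mathcal R_2^+$ put $\delta_x(Z)=(ZP-PZ,Zf)$ for $Z\in\mathcal B_2(\mathcal H)_{ah}$; the tangent space of $\mathcal R_2^+$ at $x$ is the range of $\delta_x$. The ambient metric is given by the norm $\|(X,g)\|_a=(\mathrm{Tr}(X^2)+\|g\|^2)^{1/2}$ on tangent vectors. The quotient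 metric is given by $\|V\|_q=\|Z\|_2$, where $Z$ is the unique element of $(\ker\delta_x)^\perp\subset\mathcal B_2(\mathcal H)_{ah}$ (orthogonal complement for the trace inner product) with $\delta_x(Z)=V$. Let $d_a$ and $d_q$ be the corresponding Riemannian distances: the infima of the lengths of the piecewise smooth paths in $\mathcal R_2^+$ joining two given points. Then $d_a$ and $d_q$ are finite, and for all $x,y\in\mathcal R_2^+$ $$\frac1{\sqrt2}\,d_q(x,y)\le d_a(x,y)\le\sqrt{\tfrac32}\,d_q(x,y).$$ Moreover $d_q$ is a metric on $\mathcal R_2^+$, and the topology it induces is the topology of $\mathcal R_2^+$ as embedded in $\mathcal B_2(\mathcal H)_h\times\mathcal H$. -/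

import Mathlib

open scoped ENNReal

noncomputable section

namespace RestrictedSphere

variable {H : Type*} [NormedAddCommGroup H] [InnerProductSpace ℂ H] [CompleteSpace H]

section HilbertSchmidtOperators

variable (H)

/-- The index set of a fixed Hilbert (orthonormal) basis of `H`. -/
def basisIndex : Set H := (exists_hilbertBasis ℂ H).choose

/-- A fixed Hilbert (orthonormal) basis of `H`. The notions below do not depend on it, see
`summable_norm_sq_iff`, `HilbertSchmidt.norm_sq_eq_tsum` and
`HilbertSchmidt.inner_eq_tsum`. -/
def hilbertBasis : HilbertBasis (basisIndex H) ℂ H := (exists_hilbertBasis ℂ H).choose_spec.choose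

/-- The Hilbert-Schmidt operators, as a subspace of the bounded operators:
`T` belongs to it iff `∑ ‖T eᵢ‖² < ∞`. -/
def hilbertSchmidtSubmodule : Submodule ℂ (H →L[ℂ] H) where
  carrier := {T | Memℓp (fun i => T (hilbertBasis H i)) 2}
  zero_mem' := by
    change Memℓp (0 : (i : basisIndex H) → H) 2
    exact zero_memℓp
  add_mem' {S T} hS hT := by
    change Memℓp ((fun i => S (hilbertBasis H i)) + fun i => T (hilbertBasis H i)) 2
    exact hS.add hT
  smul_mem' c T hT := by
    change Memℓp (c • fun i => T (hilbertBasis H i)) 2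
    exact hT.const_smul c

/-- The space `B₂(H)` of Hilbert-Schmidt operators. It is a type of its own, since it carries the
Hilbert-Schmidt norm and not the operator norm. -/
def HilbertSchmidt : Type _ := hilbertSchmidtSubmodule H

namespace HilbertSchmidt

instance : AddCommGroup (HilbertSchmidt H) :=
  inferInstanceAs (AddCommGroup (hilbertSchmidtSubmodule H))

instance : Module ℂ (HilbertSchmidt H) :=
  inferInstanceAs (Module ℂ (hilbertSchmidtSubmodule H))

/-- The inclusion of the Hilbert-Schmidt operators in the bounded operators. -/
def toCLM : HilbertSchmidt H →ₗ[ℂ] (H →L[ℂ] H) := (hilbertSchmidtSubmodule H).subtype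

/-- The square-summable family `(T eᵢ)ᵢ` of a Hilbert-Schmidt operator `T`. -/
def toLp : HilbertSchmidt H →ₗ[ℂ] lp (fun _ : basisIndex H => H) 2 where
  toFun T := ⟨fun i => toCLM H T (hilbertBasis H i), T.2⟩
  map_add' _ _ := rfl
  map_smul' _ _ := rfl

variable {H}

theorem toCLM_injective : Function.Injective (toCLM H) := Subtype.val_injective

theorem mem_range_toCLM {T : H →L[ℂ] H} :
    T ∈ LinearMap.range (toCLM H) ↔ T ∈ hilbertSchmidtSubmodule H := by
  change T ∈ LinearMap.range (hilbertSchmidtSubmodule H).subtype ↔ _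
  rw [Submodule.range_subtype]

theorem toLp_apply (T : HilbertSchmidt H) (i : basisIndex H) :
    (toLp H T : basisIndex H → H) i = toCLM H T (hilbertBasis H i) := rfl

theorem toLp_injective : Function.Injective (toLp H) := by
  intro S T h
  apply toCLM_injective
  have hS : ∀ i, toCLM H S (hilbertBasis H i) = toCLM H T (hilbertBasis H i) := fun i => by
    rw [← toLp_apply, h, toLp_apply]
  refine ContinuousLinearMap.ext_on (s := Set.range (hilbertBasis H)) ?_ ?_
  · have := (hilbertBasis H).dense_span
    rw [dense_iff_closure_eq, ← Submodule.topologicalClosure_coe, this]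
    rfl
  · rintro _ ⟨i, rfl⟩
    exact hS i

variable (H)

/-- The Hilbert-Schmidt norm `‖T‖₂ = (∑ ‖T eᵢ‖²)^(1/2)`. -/
instance : NormedAddCommGroup (HilbertSchmidt H) :=
  NormedAddCommGroup.induced _ _ (toLp H) toLp_injective

/-- The trace inner product `⟪S, T⟫ = Tr(S* T) = ∑ ⟪S eᵢ, T eᵢ⟫`. -/
instance : InnerProductSpace ℂ (HilbertSchmidt H) where
  norm_smul_le c T := by
    change ‖toLp H (c • T)‖ ≤ ‖c‖ * ‖toLp H T‖
    rw [map_smul, norm_smul]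
  inner S T := inner ℂ (toLp H S) (toLp H T)
  norm_sq_eq_re_inner T := norm_sq_eq_re_inner (𝕜 := ℂ) (toLp H T)
  conj_inner_symm S T := inner_conj_symm (𝕜 := ℂ) (toLp H S) (toLp H T)
  add_left S T R := by rw [map_add, inner_add_left]
  smul_left S T c := by rw [map_smul, inner_smul_left]

/-- The real inner product `Re Tr(S* T)`. -/
instance : InnerProductSpace ℝ (HilbertSchmidt H) := InnerProductSpace.complexToReal

end HilbertSchmidt

end HilbertSchmidtOperators

section BasisIndependence

set_option linter.unusedSectionVars false

/-- Parseval's identity. -/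
theorem enorm_sq_eq_tsum {ι : Type*} (b : HilbertBasis ι ℂ H) (x : H) :
    ‖x‖ₑ ^ 2 = ∑' i, ‖inner ℂ (b i) x‖ₑ ^ 2 := by
  have h2 : HasSum (fun i => ‖inner ℂ (b i) x‖ ^ 2) (‖x‖ ^ 2) := by
    have := lp.hasSum_norm (p := 2) (by norm_num) (b.repr x)
    simpa [b.repr_apply_apply] using this
  have h3 := ENNReal.ofReal_tsum_of_nonneg (fun i => sq_nonneg _) h2.summable
  rw [h2.tsum_eq] at h3
  simpa [ENNReal.ofReal_pow, ofReal_norm] using h3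

/-- The Hilbert-Schmidt norm of the adjoint in one basis is that of the operator in any other. -/
theorem tsum_enorm_sq_adjoint {ι κ : Type*} (b : HilbertBasis ι ℂ H) (c : HilbertBasis κ ℂ H)
    (T : H →L[ℂ] H) :
    ∑' i, ‖T (b i)‖ₑ ^ 2 = ∑' j, ‖(ContinuousLinearMap.adjoint T) (c j)‖ₑ ^ 2 := by
  calc ∑' i, ‖T (b i)‖ₑ ^ 2 = ∑' i, ∑' j, ‖inner ℂ (c j) (T (b i))‖ₑ ^ 2 :=
        tsum_congr fun i => enorm_sq_eq_tsum c _
    _ = ∑' j, ∑' i, ‖inner ℂ (c j) (T (b i))‖ₑ ^ 2 := ENNReal.tsum_comm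
    _ = ∑' j, ‖(ContinuousLinearMap.adjoint T) (c j)‖ₑ ^ 2 := by
        refine tsum_congr fun j => ?_
        rw [enorm_sq_eq_tsum b]
        refine tsum_congr fun i => ?_
        rw [ContinuousLinearMap.adjoint_inner_right, ← inner_conj_symm, RCLike.enorm_conj]

theorem tsum_enorm_sq_eq {ι κ : Type*} (b : HilbertBasis ι ℂ H) (c : HilbertBasis κ ℂ H)
    (T : H →L[ℂ] H) : ∑' i, ‖T (b i)‖ₑ ^ 2 = ∑' j, ‖T (c j)‖ₑ ^ 2 := by
  rw [tsum_enorm_sq_adjoint b b, ← tsum_enorm_sq_adjoint c b]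

theorem summable_norm_sq_iff_tsum {ι : Type*} (f : ι → H) :
    Summable (fun i => ‖f i‖ ^ 2) ↔ ∑' i, ‖f i‖ₑ ^ 2 ≠ ∞ := by
  have : (fun i => ‖f i‖ₑ ^ 2) = fun i => ((‖f i‖₊ ^ 2 : NNReal) : ℝ≥0∞) := by
    ext i; simp [enorm]
  rw [this, ENNReal.tsum_coe_ne_top_iff_summable, ← NNReal.summable_coe]
  simp

theorem mem_hilbertSchmidtSubmodule_iff_fixed {T : H →L[ℂ] H} :
    T ∈ hilbertSchmidtSubmodule H ↔ Summable fun i => ‖T (hilbertBasis H i)‖ ^ 2 := by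
  change Memℓp _ 2 ↔ _
  rw [memℓp_gen_iff (by norm_num)]
  simp

/-- An operator is Hilbert-Schmidt iff it is square summable on one, equivalently every,
orthonormal basis. -/
theorem summable_norm_sq_iff {ι : Type*} (b : HilbertBasis ι ℂ H) {T : H →L[ℂ] H} :
    T ∈ hilbertSchmidtSubmodule H ↔ Summable fun i => ‖T (b i)‖ ^ 2 := by
  rw [mem_hilbertSchmidtSubmodule_iff_fixed, summable_norm_sq_iff_tsum,
    summable_norm_sq_iff_tsum, tsum_enorm_sq_eq b (hilbertBasis H)]

/-- The Hilbert-Schmidt norm, in any orthonormal basis. -/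
theorem HilbertSchmidt.norm_sq_eq_tsum {ι : Type*} (b : HilbertBasis ι ℂ H)
    (T : HilbertSchmidt H) : ‖T‖ ^ 2 = ∑' i, ‖HilbertSchmidt.toCLM H T (b i)‖ ^ 2 := by
  have h0 : ‖T‖ ^ 2 = ∑' i, ‖HilbertSchmidt.toCLM H T (hilbertBasis H i)‖ ^ 2 := by
    have := lp.norm_rpow_eq_tsum (p := 2) (by norm_num) (HilbertSchmidt.toLp H T)
    have h1 : ‖T‖ = ‖HilbertSchmidt.toLp H T‖ := rfl
    simpa [h1, HilbertSchmidt.toLp_apply] using this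
  have key : ∑' i, ‖HilbertSchmidt.toCLM H T (hilbertBasis H i)‖ ^ 2 =
        (∑' i, ‖HilbertSchmidt.toCLM H T (hilbertBasis H i)‖ₑ ^ 2).toReal := by
    rw [ENNReal.tsum_toReal_eq (by simp)]
    simp
  have key' : ∑' i, ‖HilbertSchmidt.toCLM H T (b i)‖ ^ 2 =
        (∑' i, ‖HilbertSchmidt.toCLM H T (b i)‖ₑ ^ 2).toReal := by
    rw [ENNReal.tsum_toReal_eq (by simp)]
    simp
  rw [h0, key, key', tsum_enorm_sq_eq b (hilbertBasis H)]

/-- The inner product of `B₂(H)` is `Tr(S* T)`, in any orthonormal basis. -/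
theorem HilbertSchmidt.inner_eq_tsum {ι : Type*} (b : HilbertBasis ι ℂ H)
    (S T : HilbertSchmidt H) :
    inner ℂ S T =
      ∑' i, inner ℂ (HilbertSchmidt.toCLM H S (b i)) (HilbertSchmidt.toCLM H T (b i)) := by
  have hmem : ∀ R : HilbertSchmidt H, Memℓp (fun i => HilbertSchmidt.toCLM H R (b i)) 2 := by
    intro R
    rw [memℓp_gen_iff (by norm_num)]
    have h : Summable fun i => ‖HilbertSchmidt.toCLM H R (b i)‖ ^ 2 :=
      (summable_norm_sq_iff b).1 R.2
    simpa using h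
  let L : HilbertSchmidt H →ₗ[ℂ] lp (fun _ : ι => H) 2 :=
    { toFun := fun R => ⟨fun i => HilbertSchmidt.toCLM H R (b i), hmem R⟩
      map_add' := fun _ _ => rfl
      map_smul' := fun _ _ => rfl }
  have hL : ∀ R, ‖L R‖ = ‖R‖ := by
    intro R
    have h := lp.norm_rpow_eq_tsum (p := 2) (by norm_num) (L R)
    have h' : ‖L R‖ ^ 2 = ‖R‖ ^ 2 := by
      rw [HilbertSchmidt.norm_sq_eq_tsum b]
      have h1 : ∀ i, (L R : ι → H) i = HilbertSchmidt.toCLM H R (b i) := fun _ => rfl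
      simpa [h1] using h
    exact (sq_eq_sq₀ (norm_nonneg _) (norm_nonneg _)).1 h'
  exact ((LinearMap.norm_map_iff_inner_map_map L).1 hL S T).symm

end BasisIndependence

section AmbientSpace

variable (H)

/-- `B₂(H)_h`: the real Hilbert space of Hermitian Hilbert-Schmidt operators. -/
def hermitianHS : Submodule ℝ (HilbertSchmidt H) where
  carrier := {X | IsSelfAdjoint (HilbertSchmidt.toCLM H X)}
  zero_mem' := by simp
  add_mem' {X Y} hX hY := by
    simp only [Set.mem_ofPred_eq, map_add] at *
    exact hX.add hY
  smul_mem' c X hX := by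
    simp only [Set.mem_ofPred_eq] at *
    have : HilbertSchmidt.toCLM H (c • X) = c • HilbertSchmidt.toCLM H X := rfl
    rw [this]
    exact (IsSelfAdjoint.all c).smul hX

/-- `B₂(H)_ah`: the real Hilbert space of anti-Hermitian Hilbert-Schmidt operators, the Lie
algebra of the group of unitaries that are Hilbert-Schmidt perturbations of the identity. -/
def antiHermitianHS : Submodule ℝ (HilbertSchmidt H) where
  carrier := {Z | star (HilbertSchmidt.toCLM H Z) = -HilbertSchmidt.toCLM H Z}
  zero_mem' := by simp
  add_mem' {X Y} hX hY := by
    simp only [Set.mem_ofPred_eq, map_add, star_add] at *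
    rw [hX, hY, neg_add]
  smul_mem' c X hX := by
    simp only [Set.mem_ofPred_eq] at *
    have : HilbertSchmidt.toCLM H (c • X) = c • HilbertSchmidt.toCLM H X := rfl
    rw [this, star_smul, hX, star_trivial, smul_neg]

/-- The ambient real Hilbert space `B₂(H)_h × H`, with the norm of the inner product
`⟪(X, f), (Y, g)⟫ = Tr(XY) + Re ⟪f, g⟫`. -/
abbrev Ambient : Type _ := WithLp 2 (hermitianHS H × H)

variable {H}

/-- The operator component of an ambient vector, as a bounded operator. -/
def Ambient.op (V : Ambient H) : H →L[ℂ] H := HilbertSchmidt.toCLM H V.fst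

/-- The norm of `B₂(H)_h × H` is that of the inner product `Tr(XY) + Re ⟪f, g⟫`. -/
theorem Ambient.norm_sq_eq {ι : Type*} (b : HilbertBasis ι ℂ H) (V : Ambient H) :
    ((‖V‖ ^ 2 : ℝ) : ℂ) = ∑' i, inner ℂ (b i) ((V.op * V.op) (b i)) + inner ℂ V.snd V.snd := by
  have hV : ContinuousLinearMap.adjoint V.op = V.op := V.fst.2
  have h : ((‖V.fst‖ ^ 2 : ℝ) : ℂ) = ∑' i, inner ℂ (b i) ((V.op * V.op) (b i)) := by
    change ((‖(V.fst : HilbertSchmidt H)‖ ^ 2 : ℝ) : ℂ) = _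
    rw [Complex.ofReal_pow]
    refine (inner_self_eq_norm_sq_to_K (𝕜 := ℂ) (V.fst : HilbertSchmidt H)).symm.trans ?_
    rw [HilbertSchmidt.inner_eq_tsum b]
    refine tsum_congr fun i => ?_
    change inner ℂ (V.op (b i)) (V.op (b i)) = inner ℂ (b i) (V.op (V.op (b i)))
    conv_rhs => rw [← hV, ContinuousLinearMap.adjoint_inner_right, hV]
  have h2 := WithLp.prod_norm_sq_eq_of_L2 V
  rw [h2, Complex.ofReal_add, ← h, inner_self_eq_norm_sq_to_K]
  simp

end AmbientSpace

section RestrictedBundle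

/-- The operator `P P₊ : R(P₊) → R(P)` (on `R(P₊)` it agrees with `P`). -/
def pairOperator (Pp P : H →L[ℂ] H) :
    LinearMap.range (Pp : H →ₗ[ℂ] H) →ₗ[ℂ] LinearMap.range (P : H →ₗ[ℂ] H) :=
  (P : H →ₗ[ℂ] H).rangeRestrict ∘ₗ (Pp : H →ₗ[ℂ] H) ∘ₗ
    (LinearMap.range (Pp : H →ₗ[ℂ] H)).subtype

/-- The index `j(P₊, P) = dim ker - dim coker` of the operator `P P₊ : R(P₊) → R(P)`. It is used
only where `P - P₊` is Hilbert-Schmidt; there the operator is Fredholm, and both dimensions are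
finite. -/
def pairIndex (Pp P : H →L[ℂ] H) : ℤ :=
  (Module.finrank ℂ (LinearMap.ker (pairOperator Pp P)) : ℤ) -
    Module.finrank ℂ (LinearMap.range (P : H →ₗ[ℂ] H) ⧸ LinearMap.range (pairOperator Pp P))

/-- The restricted sphere bundle `R₂⁺`: the pairs `(P, f)` of an orthogonal projection `P` in the
restricted Grassmannian of `P₊` (the difference `P - P₊` is Hilbert-Schmidt and `j(P₊, P) = 0`)
and a unit vector `f` in the range of `P`. -/
@[ext]
structure RestrictedBundle (Pp : H →L[ℂ] H) where
  /-- the projection -/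
  P : H →L[ℂ] H
  /-- the unit vector -/
  f : H
  isStarProjection : IsStarProjection P
  sub_mem : P - Pp ∈ hilbertSchmidtSubmodule H
  index_eq_zero : pairIndex Pp P = 0
  apply_eq : P f = f
  norm_eq_one : ‖f‖ = 1

variable {Pp : H →L[ℂ] H}

/-- The embedding `(P, f) ↦ (P - P₊, f)` of `R₂⁺` in the Hilbert space `B₂(H)_h × H`. The
translation by `P₊` is needed since `P` itself need not be Hilbert-Schmidt. -/
def embed (hPp : IsStarProjection Pp) (x : RestrictedBundle Pp) : Ambient H :=
  WithLp.toLp 2 (⟨⟨x.P - Pp, x.sub_mem⟩, x.isStarProjection.isSelfAdjoint.sub hPp.isSelfAdjoint⟩,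
    x.f)

/-- The differential at the identity of the action of the unitary group on the point `(P, f)`:
`δ(Z) = (Z P - P Z, Z f)`. -/
def infinitesimalAction (x : RestrictedBundle Pp) :
    antiHermitianHS H →ₗ[ℝ] (H →L[ℂ] H) × H where
  toFun Z :=
    (HilbertSchmidt.toCLM H Z * x.P - x.P * HilbertSchmidt.toCLM H Z, HilbertSchmidt.toCLM H Z x.f)
  map_add' Y Z := by
    ext <;> (simp [add_mul, mul_add]; try abel)
  map_smul' c Z := by
    ext <;> simp [smul_sub]

/-- The horizontal space at `(P, f)`: the orthogonal complement of the kernel of `δ` in `B₂(H)_ah`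
for the trace inner product. -/
def horizontal (x : RestrictedBundle Pp) : Submodule ℝ (antiHermitianHS H) :=
  (LinearMap.ker (infinitesimalAction x))ᗮ

/-- A tangent vector has at most one horizontal lift. -/
theorem horizontal_lift_unique (x : RestrictedBundle Pp) {Y Z : antiHermitianHS H}
    (hY : Y ∈ horizontal x) (hZ : Z ∈ horizontal x)
    (h : infinitesimalAction x Y = infinitesimalAction x Z) : Y = Z := by
  have h1 : Y - Z ∈ LinearMap.ker (infinitesimalAction x) := by
    rw [LinearMap.mem_ker, map_sub, h, sub_self]
  have h2 : Y - Z ∈ horizontal x := Submodule.sub_mem _ hY hZ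
  exact sub_eq_zero.1 (inner_self_eq_zero.1 (h2 _ h1 : inner ℝ (Y - Z) (Y - Z) = 0))

/-- The quotient (reductive) norm at `(P, f)`: `‖Z‖₂` for the unique horizontal `Z` with
`δ(Z) = V`. Its value is `∞` on the vectors `V` that are not tangent to `R₂⁺` at `(P, f)`. -/
def quotientNorm (x : RestrictedBundle Pp) (V : Ambient H) : ℝ≥0∞ :=
  ⨅ (Z : antiHermitianHS H) (_ : Z ∈ horizontal x)
    (_ : infinitesimalAction x Z = (V.op, V.snd)), ‖Z‖ₑ

/-- The ambient norm at `(P, f)`: the norm of `B₂(H)_h × H`. -/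
def ambientNorm (_x : RestrictedBundle Pp) (V : Ambient H) : ℝ≥0∞ := ‖V‖ₑ

/-- `γ` restricts to a piecewise smooth path on `[0, 1]`: it is smooth on each closed interval of a
finite subdivision (in particular it is continuous on `[0, 1]`). Smoothness is that of the
embedded submanifold, so it is tested in the ambient space. -/
def IsPiecewiseSmooth (hPp : IsStarProjection Pp) (γ : ℝ → RestrictedBundle Pp) : Prop :=
  ∃ (n : ℕ) (t : ℕ → ℝ), Monotone t ∧ t 0 = 0 ∧ t n = 1 ∧
    ∀ i < n, ContDiffOn ℝ ((⊤ : ℕ∞) : WithTop ℕ∞) (fun s => embed hPp (γ s)) (Set.Icc (t i) (t (i + 1)))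

/-- The length of the path `γ` on `[0, 1]`, for a family `N` of norms on the tangent spaces. -/
def pathLength (hPp : IsStarProjection Pp) (N : RestrictedBundle Pp → Ambient H → ℝ≥0∞)
    (γ : ℝ → RestrictedBundle Pp) : ℝ≥0∞ :=
  ∫⁻ s in Set.Icc (0 : ℝ) 1, N (γ s) (deriv (fun r => embed hPp (γ r)) s)

/-- The Riemannian distance for a family `N` of norms on the tangent spaces: the infimum of the
lengths of the piecewise smooth paths joining two points (`∞` if there are none). -/
def pathDist (hPp : IsStarProjection Pp) (N : RestrictedBundle Pp → Ambient H → ℝ≥0∞)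
    (x y : RestrictedBundle Pp) : ℝ≥0∞ :=
  ⨅ (γ : ℝ → RestrictedBundle Pp) (_ : IsPiecewiseSmooth hPp γ) (_ : γ 0 = x) (_ : γ 1 = y),
    pathLength hPp N γ

/-- The Riemannian distance `d_q` of the quotient metric. -/
def quotientDist (hPp : IsStarProjection Pp) (x y : RestrictedBundle Pp) : ℝ≥0∞ :=
  pathDist hPp quotientNorm x y

/-- The Riemannian distance `d_a` of the ambient metric. -/
def ambientDist (hPp : IsStarProjection Pp) (x y : RestrictedBundle Pp) : ℝ≥0∞ :=
  pathDist hPp ambientNorm x y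

end RestrictedBundle

end RestrictedSphere

end

open scoped ENNReal

noncomputable section

set_option linter.unusedSectionVars false

namespace RestrictedSphere

variable {H : Type*} [NormedAddCommGroup H] [InnerProductSpace ℂ H] [CompleteSpace H]

/-! ### The Hilbert–Schmidt operators as a two-sided ideal, and their trace geometry. -/

section Ideal

/-! The inequality between the distances is pointwise. Write an anti-Hermitian `Z` in blocks with
respect to `P`, with diagonal blocks `A`, `D` and off-diagonal blocks `B`, `-B*`. Then `‖Z‖² = ‖A‖²
+ 2‖B‖² + ‖D‖²`, while `δ(Z)` has ambient norm squared at most `2‖B‖² + (‖A‖² + ‖B‖²)`; this is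
where `3/2` comes from (`enorm_le_quotientNorm`). Conversely a tangent vector `(X, g)` has the
explicit horizontal lift `[X, P] + A`, where `A` has rank at most two and acts on `R(P)`. There
`‖[X, P]‖ = ‖X‖` and `‖A‖² ≤ 2‖Pg‖²`, which gives the factor `2` (`IsTangent.quotientNorm_le`).
Velocities of paths satisfy the linearized equations of the bundle, so both bounds integrate along
every path.

The rest is finiteness and topology, and both come from one family of explicit paths. If `P + Q - 1`
is invertible, then `y = (Q - P)(P + Q - 1)⁻¹` is anti-Hermitian, Hilbert–Schmidt and off-diagonal,
and the projections onto `(1 + ty)R(P)` join `P` to `Q`. The unit vector is carried along by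
applying `1 + ty` to a segment in `R(P)` and normalizing. Everything is rational in `t`, and `‖(1 -
ty)⁻¹‖ ≤ 1`, so the length is bounded explicitly (`quotientDist_le_of_cayleyProj`). For nearby
points `‖y‖₂` is at most twice the ambient distance, so `d_q` is locally bounded by a multiple of
the ambient distance. In the other direction a chord is no longer than a path. Hence the topologies
agree and `d_q` separates points.

For finiteness, `P + Q - 1` fails to be invertible only because of vectors in `R(P) ∩ ker Q` or
`R(Q) ∩ ker P`, by the Fredholm alternative for `(P + Q - 1)² = 1 - (Q - P)²`. These spaces are
finite dimensional, and index zero makes the second nonzero whenever the first is. One then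
exchanges a unit vector `e` of the first for a unit vector `h` of the second, through the midpoint
direction `e + h`, and the dimension drops (`quotientDist_ne_top`). The index is handled through the
relation `Comparable`: index zero means that `QP` can be corrected to an isomorphism `R(P) → R(Q)`
by a Hilbert–Schmidt operator, and this property passes through inverses and compositions. -/

theorem mul_mem_hilbertSchmidt (M : H →L[ℂ] H) {T : H →L[ℂ] H}
    (hT : T ∈ hilbertSchmidtSubmodule H) : M * T ∈ hilbertSchmidtSubmodule H := by
  rw [mem_hilbertSchmidtSubmodule_iff_fixed] at *
  refine Summable.of_nonneg_of_le (fun i => by positivity) (fun i => ?_) (hT.mul_left (‖M‖ ^ 2))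
  rw [← mul_pow]
  gcongr
  exact M.le_opNorm _

theorem star_mem_hilbertSchmidt {T : H →L[ℂ] H} (hT : T ∈ hilbertSchmidtSubmodule H) :
    star T ∈ hilbertSchmidtSubmodule H := by
  rw [mem_hilbertSchmidtSubmodule_iff_fixed, summable_norm_sq_iff_tsum] at *
  rwa [ContinuousLinearMap.star_eq_adjoint, ← tsum_enorm_sq_adjoint (hilbertBasis H)]

theorem mem_hilbertSchmidt_mul {T : H →L[ℂ] H} (hT : T ∈ hilbertSchmidtSubmodule H)
    (M : H →L[ℂ] H) : T * M ∈ hilbertSchmidtSubmodule H := by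
  have h := star_mem_hilbertSchmidt (mul_mem_hilbertSchmidt (star M) (star_mem_hilbertSchmidt hT))
  simpa using h

theorem rankOne_mem_hilbertSchmidt (u v : H) :
    InnerProductSpace.rankOne ℂ u v ∈ hilbertSchmidtSubmodule H := by
  rw [mem_hilbertSchmidtSubmodule_iff_fixed]
  have h : Summable fun i => ‖inner ℂ (hilbertBasis H i) v‖ ^ 2 := by
    rw [summable_norm_sq_iff_tsum (H := ℂ), ← enorm_sq_eq_tsum]
    simp
  refine (h.mul_right (‖u‖ ^ 2)).congr fun i => ?_
  rw [InnerProductSpace.rankOne_apply, norm_smul, mul_pow, norm_inner_symm]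

end Ideal

namespace HilbertSchmidt

/-- A bounded operator that is Hilbert-Schmidt, as an element of `B₂(H)`. -/
def ofMem (T : H →L[ℂ] H) (hT : T ∈ hilbertSchmidtSubmodule H) : HilbertSchmidt H := ⟨T, hT⟩

@[simp]
theorem toCLM_ofMem (T : H →L[ℂ] H) (hT : T ∈ hilbertSchmidtSubmodule H) :
    toCLM H (ofMem T hT) = T := rfl

theorem toCLM_mem (T : HilbertSchmidt H) : toCLM H T ∈ hilbertSchmidtSubmodule H := T.2

theorem norm_sq_eq_toReal_tsum (T : HilbertSchmidt H) :
    ‖T‖ ^ 2 = (∑' i, ‖toCLM H T (hilbertBasis H i)‖ₑ ^ 2).toReal := by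
  rw [norm_sq_eq_tsum (hilbertBasis H), ENNReal.tsum_toReal_eq (by simp)]
  simp

theorem summable_norm_sq (T : HilbertSchmidt H) :
    Summable fun i => ‖toCLM H T (hilbertBasis H i)‖ ^ 2 :=
  mem_hilbertSchmidtSubmodule_iff_fixed.1 T.toCLM_mem

/-- The adjoint, as an isometry of `B₂(H)`. -/
def adj : HilbertSchmidt H →ₗᵢ[ℝ] HilbertSchmidt H where
  toFun T := ofMem (star (toCLM H T)) (star_mem_hilbertSchmidt T.toCLM_mem)
  map_add' S T := toCLM_injective (by simp)
  map_smul' c T := toCLM_injective (by simp)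
  norm_map' T := by
    refine (sq_eq_sq₀ (norm_nonneg _) (norm_nonneg _)).1 ?_
    rw [norm_sq_eq_toReal_tsum, norm_sq_eq_toReal_tsum,
      tsum_enorm_sq_adjoint (hilbertBasis H) (hilbertBasis H) (toCLM H T)]
    rfl

@[simp]
theorem toCLM_adj (T : HilbertSchmidt H) : toCLM H (adj T) = star (toCLM H T) := rfl

/-- Left multiplication by a bounded operator. -/
def lmul (M : H →L[ℂ] H) (T : HilbertSchmidt H) : HilbertSchmidt H :=
  ofMem (M * toCLM H T) (mul_mem_hilbertSchmidt M T.toCLM_mem)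

/-- Right multiplication by a bounded operator. -/
def rmul (T : HilbertSchmidt H) (M : H →L[ℂ] H) : HilbertSchmidt H :=
  ofMem (toCLM H T * M) (mem_hilbertSchmidt_mul T.toCLM_mem M)

@[simp]
theorem toCLM_lmul (M : H →L[ℂ] H) (T : HilbertSchmidt H) :
    toCLM H (lmul M T) = M * toCLM H T := rfl

@[simp]
theorem toCLM_rmul (T : HilbertSchmidt H) (M : H →L[ℂ] H) :
    toCLM H (rmul T M) = toCLM H T * M := rfl

theorem norm_lmul_le (M : H →L[ℂ] H) (T : HilbertSchmidt H) : ‖lmul M T‖ ≤ ‖M‖ * ‖T‖ := by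
  refine (sq_le_sq₀ (norm_nonneg _) (by positivity)).1 ?_
  rw [mul_pow, norm_sq_eq_tsum (hilbertBasis H), norm_sq_eq_tsum (hilbertBasis H) T, ← tsum_mul_left]
  refine Summable.tsum_le_tsum (fun i => ?_) (lmul M T).summable_norm_sq
    (T.summable_norm_sq.mul_left _)
  rw [← mul_pow]
  gcongr
  exact M.le_opNorm _

theorem adj_lmul (M : H →L[ℂ] H) (T : HilbertSchmidt H) :
    adj (lmul M T) = rmul (adj T) (star M) := toCLM_injective (by simp)

theorem adj_rmul (T : HilbertSchmidt H) (M : H →L[ℂ] H) :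
    adj (rmul T M) = lmul (star M) (adj T) := toCLM_injective (by simp)

theorem norm_rmul_le (T : HilbertSchmidt H) (M : H →L[ℂ] H) : ‖rmul T M‖ ≤ ‖T‖ * ‖M‖ := by
  rw [← adj.norm_map, adj_rmul, ← adj.norm_map T, mul_comm, ← norm_star M]
  exact norm_lmul_le _ _

/-- The coordinates of `T x` are `⟪T* eᵢ, x⟫`; Cauchy–Schwarz in each of them leaves the
Hilbert–Schmidt norm of `T*`, which is that of `T`. -/
theorem opNorm_le_norm (T : HilbertSchmidt H) : ‖toCLM H T‖ ≤ ‖T‖ := by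
  refine ContinuousLinearMap.opNorm_le_bound _ (norm_nonneg _) fun x => ?_
  refine (sq_le_sq₀ (norm_nonneg _) (by positivity)).1 ?_
  have h1 : HasSum (fun i => ‖inner ℂ (hilbertBasis H i) (toCLM H T x)‖ ^ 2)
      (‖toCLM H T x‖ ^ 2) := by
    have := lp.hasSum_norm (p := 2) (by norm_num) ((hilbertBasis H).repr (toCLM H T x))
    simpa [HilbertBasis.repr_apply_apply] using this
  rw [mul_pow, ← adj.norm_map T, norm_sq_eq_tsum (hilbertBasis H), ← tsum_mul_right,
    ← h1.tsum_eq]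
  refine Summable.tsum_le_tsum (fun i => ?_) h1.summable
    ((adj T).summable_norm_sq.mul_right _)
  rw [← mul_pow]
  gcongr
  rw [← ContinuousLinearMap.adjoint_inner_left]
  exact norm_inner_le_norm _ _

theorem real_inner_eq_tsum (S T : HilbertSchmidt H) :
    inner ℝ S T =
      (∑' i, inner ℂ (toCLM H S (hilbertBasis H i)) (toCLM H T (hilbertBasis H i))).re := by
  rw [← inner_eq_tsum]
  rfl

theorem inner_lmul_left (M : H →L[ℂ] H) (S T : HilbertSchmidt H) :
    inner ℝ (lmul M S) T = inner ℝ S (lmul (star M) T) := by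
  rw [real_inner_eq_tsum, real_inner_eq_tsum]
  congr 1
  refine tsum_congr fun i => ?_
  exact (ContinuousLinearMap.adjoint_inner_right M _ _).symm

theorem inner_rmul_left (M : H →L[ℂ] H) (S T : HilbertSchmidt H) :
    inner ℝ (rmul S M) T = inner ℝ S (rmul T (star M)) := by
  rw [← adj.inner_map_map, adj_rmul, inner_lmul_left, ← adj.inner_map_map S, adj_rmul, star_star]

/-- The rank one operator `x ↦ ⟪v, x⟫ u`. -/
def rankOne (u v : H) : HilbertSchmidt H :=
  ofMem (InnerProductSpace.rankOne ℂ u v) (rankOne_mem_hilbertSchmidt u v)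

@[simp]
theorem toCLM_rankOne (u v : H) :
    toCLM H (rankOne u v) = InnerProductSpace.rankOne ℂ u v := rfl

theorem inner_rankOne (S : HilbertSchmidt H) (u v : H) :
    inner ℝ S (rankOne u v) = (inner ℂ (toCLM H S v) u).re := by
  rw [real_inner_eq_tsum, ← ContinuousLinearMap.adjoint_inner_right (toCLM H S) v u,
    ← (hilbertBasis H).tsum_inner_mul_inner]
  congr 1
  refine tsum_congr fun i => ?_
  rw [ContinuousLinearMap.adjoint_inner_right, toCLM_rankOne, InnerProductSpace.rankOne_apply,
    inner_smul_right]

/-- The embedding of the Hilbert-Schmidt operators in the bounded operators, as a bounded map. -/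
def toCLML : HilbertSchmidt H →L[ℝ] (H →L[ℂ] H) :=
  LinearMap.mkContinuous ((toCLM H).restrictScalars ℝ) 1 fun T => by
    simpa using opNorm_le_norm T

end HilbertSchmidt

/-! ### Finite rank approximation and compactness. -/

section FiniteRank

open HilbertSchmidt

theorem finiteDimensional_range_sum_rankOne {ι : Type*} (s : Finset ι) (u v : ι → H) :
    FiniteDimensional ℂ
      (∑ i ∈ s, InnerProductSpace.rankOne ℂ (u i) (v i) : H →L[ℂ] H).range := by
  have h : (∑ i ∈ s, InnerProductSpace.rankOne ℂ (u i) (v i) : H →L[ℂ] H).range ≤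
      Submodule.span ℂ (u '' s) := by
    rintro _ ⟨x, rfl⟩
    simp only [ContinuousLinearMap.coe_coe, sum_apply, InnerProductSpace.rankOne_apply]
    exact Submodule.sum_mem _ fun i hi => Submodule.smul_mem _ _ (Submodule.subset_span ⟨i, hi, rfl⟩)
  have : FiniteDimensional ℂ (Submodule.span ℂ (u '' s)) :=
    FiniteDimensional.span_of_finite ℂ (s.finite_toSet.image u)
  exact Submodule.finiteDimensional_of_le h

theorem isCompactOperator_rankOne (u v : H) :
    IsCompactOperator (InnerProductSpace.rankOne ℂ u v : H →L[ℂ] H) := by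
  have h : IsCompactOperator (ContinuousLinearMap.toSpanSingleton ℂ u) :=
    isCompactOperator_of_locallyCompactSpace_rng _
  exact h.comp_clm (innerSL ℂ v)

/-- A Hilbert-Schmidt operator is a finite rank operator up to a small error. -/
theorem exists_sum_rankOne_near {T : H →L[ℂ] H} (hT : T ∈ hilbertSchmidtSubmodule H) {ε : ℝ}
    (hε : 0 < ε) : ∃ s : Finset (basisIndex H),
      ‖T - ∑ i ∈ s, InnerProductSpace.rankOne ℂ (T (hilbertBasis H i)) (hilbertBasis H i)‖ < ε := by
  have hs := mem_hilbertSchmidtSubmodule_iff_fixed.1 hT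
  obtain ⟨s, hs'⟩ := ((tendsto_order.1 (tendsto_tsum_compl_atTop_zero
    fun i => ‖T (hilbertBasis H i)‖ ^ 2)).2 (ε ^ 2) (by positivity)).exists
  refine ⟨s, ?_⟩
  set F := ∑ i ∈ s, InnerProductSpace.rankOne ℂ (T (hilbertBasis H i)) (hilbertBasis H i)
  have hF : F ∈ hilbertSchmidtSubmodule H :=
    Submodule.sum_mem _ fun i _ => rankOne_mem_hilbertSchmidt _ _
  have hTF := Submodule.sub_mem _ hT hF
  refine (opNorm_le_norm (ofMem _ hTF)).trans_lt ?_
  refine (sq_lt_sq₀ (norm_nonneg _) hε.le).1 ?_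
  rw [norm_sq_eq_tsum (hilbertBasis H)]
  refine lt_of_eq_of_lt ?_ hs'
  refine Eq.trans ?_ (tsum_subtype {i | i ∉ s} fun i => ‖T (hilbertBasis H i)‖ ^ 2).symm
  refine tsum_congr fun i => ?_
  classical
  -- `T - F` vanishes on the basis vectors indexed by `s` and equals `T` on the others, so its
  -- squared Hilbert–Schmidt norm is a tail of a convergent series.
  have h1 : F (hilbertBasis H i) = if i ∈ s then T (hilbertBasis H i) else 0 := by
    simp only [F, sum_apply, InnerProductSpace.rankOne_apply,
      orthonormal_iff_ite.1 (hilbertBasis H).orthonormal, ite_smul, one_smul, zero_smul]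
    simp
  by_cases hi : i ∈ s <;> simp [h1, hi, Set.indicator]

theorem isCompactOperator_of_mem_hilbertSchmidt {T : H →L[ℂ] H}
    (hT : T ∈ hilbertSchmidtSubmodule H) : IsCompactOperator T := by
  have hcl : IsClosed {f : H →L[ℂ] H | IsCompactOperator f} := isClosed_setOfPred_isCompactOperator
  have : T ∈ closure {f : H →L[ℂ] H | IsCompactOperator f} := by
    rw [Metric.mem_closure_iff]
    intro ε hε
    obtain ⟨s, hs⟩ := exists_sum_rankOne_near hT hε
    refine ⟨_, ?_, by rw [dist_eq_norm]; exact hs⟩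
    exact (compactOperator (RingHom.id ℂ) H H).sum_mem fun i _ => isCompactOperator_rankOne _ _
  rwa [hcl.closure_eq] at this

end FiniteRank

end RestrictedSphere

end

open scoped ENNReal

noncomputable section

set_option linter.unusedSectionVars false

namespace RestrictedSphere

variable {H : Type*} [NormedAddCommGroup H] [InnerProductSpace ℂ H] [CompleteSpace H]

namespace HilbertSchmidt

/-- Pythagoras: `⟪P T, (1 - P) T⟫ = ⟪T, P (1 - P) T⟫ = 0`. With its right-hand analogue it splits
the norm of an operator into its four blocks. -/
theorem norm_sq_eq_lmul_add {P : H →L[ℂ] H} (hP : IsStarProjection P) (T : HilbertSchmidt H) :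
    ‖T‖ ^ 2 = ‖lmul P T‖ ^ 2 + ‖lmul (1 - P) T‖ ^ 2 := by
  have hT : T = lmul P T + lmul (1 - P) T := toCLM_injective (by simp [sub_mul])
  have h0 : inner ℝ (lmul P T) (lmul (1 - P) T) = 0 := by
    have : lmul (star P) (lmul (1 - P) T) = 0 := toCLM_injective (by
      rw [hP.isSelfAdjoint.star_eq, toCLM_lmul, toCLM_lmul, ← mul_assoc, mul_sub,
        hP.isIdempotentElem.eq]
      simp)
    rw [inner_lmul_left, this, inner_zero_right]
  conv_lhs => rw [hT]
  have h := norm_add_sq_eq_norm_sq_add_norm_sq_of_inner_eq_zero _ _ h0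
  simpa only [sq] using h

theorem norm_sq_eq_rmul_add {P : H →L[ℂ] H} (hP : IsStarProjection P) (T : HilbertSchmidt H) :
    ‖T‖ ^ 2 = ‖rmul T P‖ ^ 2 + ‖rmul T (1 - P)‖ ^ 2 := by
  rw [← adj.norm_map T, norm_sq_eq_lmul_add hP, ← adj.norm_map (rmul T P),
    ← adj.norm_map (rmul T (1 - P)), adj_rmul, adj_rmul, star_sub, star_one,
    hP.isSelfAdjoint.star_eq]

theorem norm_apply_le (T : HilbertSchmidt H) {f : H} (hf : ‖f‖ = 1) : ‖toCLM H T f‖ ≤ ‖T‖ := by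
  have h := (toCLM H T).le_opNorm f
  rw [hf, mul_one] at h
  exact h.trans (opNorm_le_norm T)

end HilbertSchmidt

open HilbertSchmidt

/-! ### Comparison of the two norms on a tangent space. -/

section PointwiseNorms

variable {Pp : H →L[ℂ] H}

/-- The linearized equations `P² = P`, `P f = f`, `‖f‖ = 1` of the restricted sphere bundle. -/
structure IsTangent (x : RestrictedBundle Pp) (V : Ambient H) : Prop where
  op_eq : V.op * x.P + x.P * V.op = V.op
  snd_eq : V.op x.f + x.P V.snd = V.snd
  re_inner_eq : (inner ℂ x.f V.snd).re = 0

/-- In the block decomposition along `P`, the commutator keeps only the off-diagonal blocks `B` and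
`C`, which have equal norm because `Z` is anti-Hermitian. The vector `Z f` sees only the first
column `A`, `B`. So `‖B‖²` is counted at most three times on the left and twice on the right.
Horizontality of `Z` plays no role. -/
theorem norm_sq_le_of_infinitesimalAction_eq (x : RestrictedBundle Pp) (V : Ambient H)
    (Z : antiHermitianHS H) (h : infinitesimalAction x Z = (V.op, V.snd)) :
    ‖V‖ ^ 2 ≤ 3 / 2 * ‖Z‖ ^ 2 := by
  obtain ⟨Z, hZ⟩ := Z
  have hZs : adj Z = -Z := toCLM_injective (by rw [toCLM_adj, map_neg]; exact hZ)
  have hP := x.isStarProjection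
  have hPP := hP.isIdempotentElem.eq
  have h1 : V.op = toCLM H Z * x.P - x.P * toCLM H Z := (congrArg Prod.fst h).symm
  have h2 : V.snd = toCLM H Z x.f := (congrArg Prod.snd h).symm
  have hX : (V.fst : HilbertSchmidt H) = rmul Z x.P - lmul x.P Z :=
    toCLM_injective (by rw [map_sub]; exact h1)
  set B := rmul (lmul (1 - x.P) Z) x.P with hB
  set C := rmul (lmul x.P Z) (1 - x.P) with hC
  set A := rmul (lmul x.P Z) x.P with hA
  have hBC : ‖C‖ = ‖B‖ := by
    have : adj B = -C := by
      rw [hB, adj_rmul, adj_lmul, hZs, star_sub, star_one, hP.isSelfAdjoint.star_eq]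
      exact toCLM_injective (by simp [C, mul_assoc])
    rw [← adj.norm_map B, this, norm_neg]
  have hV := WithLp.prod_norm_sq_eq_of_L2 V
  have hX2 : ‖V.fst‖ ^ 2 = ‖C‖ ^ 2 + ‖B‖ ^ 2 := by
    change ‖(V.fst : HilbertSchmidt H)‖ ^ 2 = _
    rw [hX, norm_sq_eq_lmul_add hP]
    congr 2
    · rw [← norm_neg]
      congr 1
      refine toCLM_injective ?_
      simp only [C, map_neg, toCLM_lmul, toCLM_rmul, map_sub, mul_sub, mul_one, ← mul_assoc, hPP]
      abel
    · congr 1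
      refine toCLM_injective ?_
      simp only [B, toCLM_lmul, toCLM_rmul, map_sub, mul_sub, sub_mul, one_mul, ← mul_assoc, hPP]
      abel
  have hf : ‖V.snd‖ ^ 2 ≤ ‖A‖ ^ 2 + ‖B‖ ^ 2 := by
    -- Replacing `Z` by `Z P`, which agrees with it on `f`, keeps the blocks of the second column
    -- out of the bound.
    have e : V.snd = toCLM H (rmul Z x.P) x.f := by rw [h2, toCLM_rmul]; simp [x.apply_eq]
    have e2 := norm_sq_eq_lmul_add hP (rmul Z x.P)
    have e3 := norm_apply_le (rmul Z x.P) x.norm_eq_one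
    rw [← e] at e3
    have e4 : ‖V.snd‖ ^ 2 ≤ ‖rmul Z x.P‖ ^ 2 := by gcongr
    exact e4.trans_eq e2
  have hZ2 : ‖Z‖ ^ 2 = ‖A‖ ^ 2 + ‖C‖ ^ 2 + ‖B‖ ^ 2 + ‖rmul (lmul (1 - x.P) Z) (1 - x.P)‖ ^ 2 := by
    rw [norm_sq_eq_lmul_add hP, norm_sq_eq_rmul_add hP (lmul x.P Z),
      norm_sq_eq_rmul_add hP (lmul (1 - x.P) Z)]
    ring
  change ‖V‖ ^ 2 ≤ 3 / 2 * ‖Z‖ ^ 2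
  rw [hV, hX2, hZ2]
  rw [hBC]
  nlinarith [sq_nonneg ‖A‖, sq_nonneg ‖B‖, sq_nonneg ‖rmul (lmul (1 - x.P) Z) (1 - x.P)‖]

theorem enorm_le_quotientNorm (x : RestrictedBundle Pp) (V : Ambient H) :
    ‖V‖ₑ ≤ ENNReal.ofReal √(3 / 2) * quotientNorm x V := by
  have h0 : ENNReal.ofReal √(3 / 2) ≠ 0 := by
    rw [Ne, ENNReal.ofReal_eq_zero, not_le]; positivity
  simp only [quotientNorm, ENNReal.mul_iInf_of_ne h0 ENNReal.ofReal_ne_top]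
  refine le_iInf fun Z => le_iInf fun _ => le_iInf fun h => ?_
  rw [← ofReal_norm, ← ofReal_norm, ← ENNReal.ofReal_mul (by positivity)]
  refine ENNReal.ofReal_le_ofReal ?_
  refine (sq_le_sq₀ (norm_nonneg _) (by positivity)).1 ?_
  rw [mul_pow, Real.sq_sqrt (by norm_num)]
  exact norm_sq_le_of_infinitesimalAction_eq x V Z h

/-- The horizontal lift of a tangent vector. -/
def horizontalLift (x : RestrictedBundle Pp) (V : Ambient H) : HilbertSchmidt H :=
  rmul V.fst.1 x.P - lmul x.P V.fst.1 + (rankOne (x.P V.snd) x.f - rankOne x.f (x.P V.snd) -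
    rankOne (inner ℂ x.f (x.P V.snd) • x.f) x.f)

theorem toCLM_horizontalLift_apply (x : RestrictedBundle Pp) (V : Ambient H) (y : H) :
    toCLM H (horizontalLift x V) y = V.op (x.P y) - x.P (V.op y) +
      (inner ℂ x.f y • x.P V.snd - inner ℂ (x.P V.snd) y • x.f -
        inner ℂ x.f y • inner ℂ x.f (x.P V.snd) • x.f) := rfl

theorem inner_apply_of_isStarProjection {P : H →L[ℂ] H} (hP : IsStarProjection P) (a b : H) :
    inner ℂ (P a) b = inner ℂ a (P b) := by
  conv_lhs => rw [← hP.isSelfAdjoint.star_eq, ContinuousLinearMap.star_eq_adjoint,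
    ContinuousLinearMap.adjoint_inner_left]

theorem apply_apply_of_isStarProjection {P : H →L[ℂ] H} (hP : IsStarProjection P) (a : H) :
    P (P a) = P a := DFunLike.congr_fun hP.isIdempotentElem.eq a

namespace IsTangent

variable {x : RestrictedBundle Pp} {V : Ambient H} (hV : IsTangent x V)

include hV

theorem op_apply (y : H) : V.op (x.P y) + x.P (V.op y) = V.op y := DFunLike.congr_fun hV.op_eq y

/-- Applying `P` to `X P + P X = X` cancels `P X` on both sides. This is half of the off-diagonality
of `X`. -/
theorem proj_op_proj (y : H) : x.P (V.op (x.P y)) = 0 := by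
  have h := congrArg x.P (hV.op_apply y)
  rwa [map_add, apply_apply_of_isStarProjection x.isStarProjection, add_eq_right] at h

theorem inner_proj_re : (inner ℂ x.f (x.P V.snd)).re = 0 := by
  rw [← inner_apply_of_isStarProjection x.isStarProjection, x.apply_eq, hV.re_inner_eq]

theorem inner_proj_conj : inner ℂ (x.P V.snd) x.f = -inner ℂ x.f (x.P V.snd) := by
  have h := hV.inner_proj_re
  rw [← inner_conj_symm]
  apply Complex.ext
  · rw [Complex.conj_re, Complex.neg_re, h, neg_zero]
  · rw [Complex.conj_im, Complex.neg_im]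

theorem horizontalLift_mem : horizontalLift x V ∈ antiHermitianHS H := by
  change star (toCLM H (horizontalLift x V)) = -toCLM H (horizontalLift x V)
  have hVs : star V.op = V.op := V.fst.2
  have hP := x.isStarProjection.isSelfAdjoint.star_eq
  have hc : star (inner ℂ x.f (x.P V.snd)) = -inner ℂ x.f (x.P V.snd) := by
    rw [← hV.inner_proj_conj]; exact inner_conj_symm _ _
  change star (V.op * x.P - x.P * V.op +
    (InnerProductSpace.rankOne ℂ (x.P V.snd) x.f - InnerProductSpace.rankOne ℂ x.f (x.P V.snd) -
    InnerProductSpace.rankOne ℂ (inner ℂ x.f (x.P V.snd) • x.f) x.f)) =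
    -(V.op * x.P - x.P * V.op +
    (InnerProductSpace.rankOne ℂ (x.P V.snd) x.f - InnerProductSpace.rankOne ℂ x.f (x.P V.snd) -
    InnerProductSpace.rankOne ℂ (inner ℂ x.f (x.P V.snd) • x.f) x.f))
  simp only [star_add, star_sub, star_mul, hVs, hP, ContinuousLinearMap.star_eq_adjoint,
    InnerProductSpace.adjoint_rankOne]
  have : InnerProductSpace.rankOne ℂ x.f (inner ℂ x.f (x.P V.snd) • x.f) =
    -(inner ℂ x.f (x.P V.snd) • InnerProductSpace.rankOne ℂ x.f x.f) := by
    rw [map_smulₛₗ, ← neg_smul, ← hc]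
    rfl
  rw [this, map_smul, smul_apply]
  abel

/-- The lift is `[X, P] + A`. Since `X` is off-diagonal, `[[X, P], P] = X`, and `A` commutes with
`P` because it is built from vectors of `R(P)`. On `f` the first term gives `X f` and the second `P
g`; the term in `f ⊗ f` of `A` removes the component along `f` that the skew pair produces in
excess. -/
theorem infinitesimalAction_horizontalLift :
    infinitesimalAction x ⟨horizontalLift x V, hV.horizontalLift_mem⟩ = (V.op, V.snd) := by
  have hP := x.isStarProjection
  have hc : (inner ℂ x.f x.f : ℂ) = 1 := by rw [inner_self_eq_norm_sq_to_K, x.norm_eq_one]; simp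
  refine Prod.ext ?_ ?_
  · change toCLM H (horizontalLift x V) * x.P - x.P * toCLM H (horizontalLift x V) = V.op
    ext y
    change toCLM H (horizontalLift x V) (x.P y) - x.P (toCLM H (horizontalLift x V) y) = V.op y
    simp only [toCLM_horizontalLift_apply, map_add, map_sub, map_smul,
      apply_apply_of_isStarProjection hP, x.apply_eq,
      ← inner_apply_of_isStarProjection hP x.f y, ← inner_apply_of_isStarProjection hP _ y]
    rw [hV.proj_op_proj, ← hV.op_apply y]
    simp [apply_apply_of_isStarProjection hP, hV.proj_op_proj]
  · change toCLM H (horizontalLift x V) x.f = V.snd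
    have h1 := hV.proj_op_proj x.f
    rw [x.apply_eq] at h1
    rw [toCLM_horizontalLift_apply, x.apply_eq, hc, h1, hV.inner_proj_conj]
    rw [← hV.snd_eq]
    simp [apply_apply_of_isStarProjection hP, h1]

/-- An element `W` of the kernel commutes with `P` and kills `f`. The first property makes it
orthogonal to `[X, P]`. The second makes it orthogonal to each rank one term, as the pairing with
such a term is an inner product involving `W f` or `W* f = -W f`. -/
theorem horizontalLift_mem_horizontal :
    (⟨horizontalLift x V, hV.horizontalLift_mem⟩ : antiHermitianHS H) ∈ horizontal x := by
  refine (Submodule.mem_orthogonal _ _).2 fun W hW => ?_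
  obtain ⟨W, hWa⟩ := W
  have hW1 : rmul W x.P - lmul x.P W = 0 := toCLM_injective (by
    rw [map_sub, map_zero]; exact congrArg Prod.fst (LinearMap.mem_ker.1 hW))
  have hW2 : toCLM H W x.f = 0 := congrArg Prod.snd (LinearMap.mem_ker.1 hW)
  have hWs : ContinuousLinearMap.adjoint (toCLM H W) = -toCLM H W := hWa
  change inner ℝ W (horizontalLift x V) = 0
  have hP := x.isStarProjection.isSelfAdjoint.star_eq
  have e1 : inner ℝ W (rmul V.fst.1 x.P) = inner ℝ (rmul W x.P) (V.fst : HilbertSchmidt H) := by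
    rw [inner_rmul_left, hP]
  have e2 : inner ℝ W (lmul x.P V.fst.1) = inner ℝ (lmul x.P W) (V.fst : HilbertSchmidt H) := by
    rw [inner_lmul_left, hP]
  have e3 : inner ℂ (toCLM H W (x.P V.snd)) x.f = 0 := by
    rw [← ContinuousLinearMap.adjoint_inner_right, hWs, neg_apply, hW2]
    simp
  unfold horizontalLift
  rw [inner_add_right, inner_sub_right, inner_sub_right, inner_sub_right, e1, e2,
    ← inner_sub_left, hW1, inner_rankOne, inner_rankOne, inner_rankOne, hW2, e3]
  simp

/-- The summands `D = [X, P]`, off-diagonal, and `A`, supported on `R(P)`, are orthogonal. Taking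
the commutator with `P` only changes the sign of one off-diagonal block, so `‖D‖ = ‖X‖`. For `u = P
g` and the purely imaginary `c = ⟪f, u⟫` one finds `‖A‖² = 2‖u‖² - |c|²`. -/
theorem norm_horizontalLift_sq_le : ‖horizontalLift x V‖ ^ 2 ≤ 2 * ‖V‖ ^ 2 := by
  have hP := x.isStarProjection
  set X : HilbertSchmidt H := V.fst.1 with hXdef
  set u := x.P V.snd with hu
  set c := inner ℂ x.f u with hc
  set D := rmul X x.P - lmul x.P X with hD
  set A := rankOne u x.f - rankOne x.f u - rankOne (c • x.f) x.f with hA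
  have hff : (inner ℂ x.f x.f : ℂ) = 1 := by rw [inner_self_eq_norm_sq_to_K, x.norm_eq_one]; simp
  have hPu : x.P u = u := apply_apply_of_isStarProjection hP _
  have hDA : ∀ a b, x.P a = a → x.P b = b → inner ℝ D (rankOne a b) = 0 := by
    intro a b ha hb
    rw [inner_rankOne, ← ha, ← inner_apply_of_isStarProjection hP]
    have h1 : toCLM H D b = V.op (x.P b) - x.P (V.op b) := rfl
    have h2 := hV.proj_op_proj b
    rw [hb] at h2
    rw [h1, map_sub, apply_apply_of_isStarProjection hP, hb, h2]
    simp
  have hcross : inner ℝ D A = 0 := by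
    rw [hA, inner_sub_right, inner_sub_right, hDA _ _ hPu x.apply_eq, hDA _ _ x.apply_eq hPu,
      hDA _ _ (by rw [map_smul, x.apply_eq]) x.apply_eq]
    simp
  have hDn : ‖D‖ ^ 2 = ‖X‖ ^ 2 := by
    rw [norm_sq_eq_lmul_add hP, norm_sq_eq_lmul_add hP X]
    have hPXP : x.P * V.op * x.P = 0 := by ext y; exact hV.proj_op_proj y
    have hXo : toCLM H X = V.op := rfl
    congr 2
    · rw [← norm_neg]
      congr 1
      refine toCLM_injective ?_
      simp only [hD, map_neg, toCLM_lmul, toCLM_rmul, map_sub, mul_sub, ← mul_assoc,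
        hP.isIdempotentElem.eq, hXo, hPXP]
      abel
    · congr 1
      refine toCLM_injective ?_
      simp only [hD, toCLM_lmul, toCLM_rmul, map_sub, mul_sub, sub_mul, one_mul, ← mul_assoc,
        hP.isIdempotentElem.eq, hXo, hPXP]
      rw [sub_eq_iff_eq_add.2 hV.op_eq.symm]
      simp
  have hAapp : ∀ y, toCLM H A y = inner ℂ x.f y • u - inner ℂ u y • x.f -
      inner ℂ x.f y • c • x.f := fun y => rfl
  have hcr : c.re = 0 := hV.inner_proj_re
  have huf : inner ℂ u x.f = -c := hV.inner_proj_conj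
  have hAf : toCLM H A x.f = u := by
    rw [hAapp, hff, huf]; simp
  have hAn : ‖A‖ ^ 2 ≤ 2 * ‖u‖ ^ 2 := by
    have e0 : ‖A‖ ^ 2 = inner ℝ A A := (real_inner_self_eq_norm_sq A).symm
    have huu : (inner ℂ u u : ℂ) = (‖u‖ : ℂ) ^ 2 := inner_self_eq_norm_sq_to_K u
    rw [e0]
    conv_lhs => rw [hA, inner_sub_right, inner_sub_right, ← hA]
    rw [inner_rankOne, inner_rankOne, inner_rankOne, hAf, hAapp, inner_smul_right, huf]
    simp only [inner_sub_left, inner_smul_left, huf, hff, huu, ← hc]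
    simp [← Complex.ofReal_pow, hcr]
    nlinarith [sq_nonneg c.im]
  have hun : ‖u‖ ≤ ‖V.snd‖ := by
    refine ((x.P).le_opNorm _).trans ?_
    exact mul_le_of_le_one_left (norm_nonneg _) hP.norm_le
  have hXn : ‖X‖ = ‖V.fst‖ := rfl
  have hZ : ‖horizontalLift x V‖ ^ 2 = ‖D‖ ^ 2 + ‖A‖ ^ 2 := by
    have h := norm_add_sq_eq_norm_sq_add_norm_sq_of_inner_eq_zero D A hcross
    have hl : horizontalLift x V = D + A := rfl
    rw [hl]
    simpa only [sq] using h
  have hVn := WithLp.prod_norm_sq_eq_of_L2 V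
  rw [hZ, hDn, hVn, hXn]
  have : ‖u‖ ^ 2 ≤ ‖V.snd‖ ^ 2 := by gcongr
  nlinarith [sq_nonneg ‖V.fst‖]

theorem quotientNorm_le : quotientNorm x V ≤ ENNReal.ofReal √2 * ‖V‖ₑ := by
  refine (iInf_le_of_le (⟨horizontalLift x V, hV.horizontalLift_mem⟩ : antiHermitianHS H)
    (iInf_le_of_le hV.horizontalLift_mem_horizontal
      (iInf_le _ hV.infinitesimalAction_horizontalLift))).trans ?_
  rw [← ofReal_norm, ← ofReal_norm, ← ENNReal.ofReal_mul (by positivity)]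
  refine ENNReal.ofReal_le_ofReal ?_
  refine (sq_le_sq₀ (norm_nonneg _) (by positivity)).1 ?_
  rw [mul_pow, Real.sq_sqrt (by norm_num)]
  exact hV.norm_horizontalLift_sq_le

end IsTangent

end PointwiseNorms

end RestrictedSphere

end

open scoped ENNReal

noncomputable section

set_option linter.unusedSectionVars false

namespace RestrictedSphere

variable {H : Type*} [NormedAddCommGroup H] [InnerProductSpace ℂ H] [CompleteSpace H]

open HilbertSchmidt MeasureTheory

variable {Pp : H →L[ℂ] H}

/-! ### Velocities of paths are tangent vectors. -/

section Tangent

/-- The operator component of an ambient vector, as a bounded map. -/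
def opCLM : Ambient H →L[ℝ] (H →L[ℂ] H) :=
  toCLML ∘L (hermitianHS H).subtypeL ∘L WithLp.fstL 2 ℝ (hermitianHS H) H

theorem opCLM_apply (V : Ambient H) : opCLM V = V.op := rfl

theorem opCLM_embed (hPp : IsStarProjection Pp) (x : RestrictedBundle Pp) :
    opCLM (embed hPp x) = x.P - Pp := rfl

theorem isTangent_zero (x : RestrictedBundle Pp) : IsTangent x 0 where
  op_eq := by simp [← opCLM_apply]
  snd_eq := by simp [← opCLM_apply]
  re_inner_eq := by simp

/-- Composition of operators, as a bounded bilinear map over the reals. -/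
def mulBilin : (H →L[ℂ] H) →L[ℝ] (H →L[ℂ] H) →L[ℝ] (H →L[ℂ] H) :=
  LinearMap.mkContinuous₂ (LinearMap.mk₂ ℝ (fun S T : H →L[ℂ] H => S * T) add_mul
    (fun c S T => smul_mul_assoc c S T) mul_add (fun c S T => mul_smul_comm c S T)) 1
    fun S T => by simpa using norm_mul_le S T

/-- Evaluation of operators, as a bounded bilinear map over the reals. -/
def applyBilin : (H →L[ℂ] H) →L[ℝ] H →L[ℝ] H :=
  LinearMap.mkContinuous₂ (LinearMap.mk₂ ℝ (fun (S : H →L[ℂ] H) (y : H) => S y)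
    (fun _ _ _ => rfl) (fun _ _ _ => rfl) (fun S => map_add S) (fun c S y => S.map_smul_of_tower c y))
    1 fun S T => by simpa using S.le_opNorm T

theorem isTangent_deriv (hPp : IsStarProjection Pp) (γ : ℝ → RestrictedBundle Pp) (s : ℝ) :
    IsTangent (γ s) (deriv (fun r => embed hPp (γ r)) s) := by
  by_cases hd : DifferentiableAt ℝ (fun r => embed hPp (γ r)) s
  swap
  -- At a corner of a path `deriv` takes its default value `0`, which is tangent; so the conclusion
  -- holds at every parameter and not only almost everywhere.
  · rw [deriv_zero_of_not_differentiableAt hd]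
    exact isTangent_zero _
  set V := deriv (fun r => embed hPp (γ r)) s
  have hV : HasDerivAt (fun r => embed hPp (γ r)) V s := hd.hasDerivAt
  have hP : HasDerivAt (fun r => (γ r).P) V.op s := by
    have h := ((opCLM (H := H)).hasFDerivAt.comp_hasDerivAt s hV).add_const Pp
    refine h.congr_of_eventuallyEq (Filter.Eventually.of_forall fun r => ?_)
    exact (sub_add_cancel (γ r).P Pp).symm
  have hf : HasDerivAt (fun r => (γ r).f) V.snd s :=
    (WithLp.sndL 2 ℝ (hermitianHS H) H).hasFDerivAt.comp_hasDerivAt s hV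
  refine ⟨?_, ?_, ?_⟩
  · have h := (mulBilin (H := H)).hasDerivAt_of_bilinear (fun _ => hP) (fun _ => hP)
    have h2 : HasDerivAt (fun r => (γ r).P) ((γ s).P * V.op + V.op * (γ s).P) s := by
      refine h.congr_of_eventuallyEq (Filter.Eventually.of_forall fun r => ?_)
      exact ((γ r).isStarProjection.isIdempotentElem.eq).symm
    rw [add_comm]
    exact h2.unique hP
  · have h := (applyBilin (H := H)).hasDerivAt_of_bilinear (fun _ => hP) (fun _ => hf)
    have h2 : HasDerivAt (fun r => (γ r).f) ((γ s).P V.snd + V.op (γ s).f) s := by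
      refine h.congr_of_eventuallyEq (Filter.Eventually.of_forall fun r => ?_)
      exact ((γ r).apply_eq).symm
    rw [add_comm]
    exact h2.unique hf
  · have h := hf.inner ℂ hf
    have h2 : HasDerivAt (fun r => (inner ℂ (γ r).f (γ r).f : ℂ)) 0 s := by
      simp only [inner_self_eq_norm_sq_to_K, (γ _).norm_eq_one]
      exact hasDerivAt_const _ _
    have h3 := congrArg Complex.re (h.unique h2)
    have h4 : (inner ℂ V.snd (γ s).f).re = (inner ℂ (γ s).f V.snd).re := inner_re_symm (𝕜 := ℂ) _ _
    rw [Complex.add_re, h4, Complex.zero_re] at h3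
    linarith

end Tangent

/-! ### Comparison of lengths and distances. -/

section Comparison

variable (hPp : IsStarProjection Pp)

/-- The norms are compared only on velocities of paths, since elsewhere the quotient norm may be
infinite. Finiteness of `c` lets it leave the integral without any measurability of the integrand.
-/
theorem pathDist_le_mul {N N' : RestrictedBundle Pp → Ambient H → ℝ≥0∞} {c : ℝ≥0∞} (h0 : c ≠ 0)
    (hc : c ≠ ∞) (h : ∀ (γ : ℝ → RestrictedBundle Pp) (s : ℝ),
      N (γ s) (deriv (fun r => embed hPp (γ r)) s) ≤
        c * N' (γ s) (deriv (fun r => embed hPp (γ r)) s)) (x y : RestrictedBundle Pp) :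
    pathDist hPp N x y ≤ c * pathDist hPp N' x y := by
  simp only [pathDist, ENNReal.mul_iInf_of_ne h0 hc]
  refine iInf_mono fun γ => iInf_mono fun _ => iInf_mono fun _ => iInf_mono fun _ => ?_
  rw [pathLength, pathLength, ← lintegral_const_mul' _ _ hc]
  exact lintegral_mono fun s => h γ s

theorem quotientDist_le (x y : RestrictedBundle Pp) :
    quotientDist hPp x y ≤ ENNReal.ofReal √2 * ambientDist hPp x y :=
  pathDist_le_mul hPp (by rw [Ne, ENNReal.ofReal_eq_zero, not_le]; positivity)
    ENNReal.ofReal_ne_top (fun γ s => (isTangent_deriv hPp γ s).quotientNorm_le) x y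

theorem ambientDist_le (x y : RestrictedBundle Pp) :
    ambientDist hPp x y ≤ ENNReal.ofReal √(3 / 2) * quotientDist hPp x y :=
  pathDist_le_mul hPp (by rw [Ne, ENNReal.ofReal_eq_zero, not_le]; positivity)
    ENNReal.ofReal_ne_top (fun γ s => enorm_le_quotientNorm _ _) x y

theorem lintegral_Icc_add_lintegral_Icc (f : ℝ → ℝ≥0∞) {a b c : ℝ} (hab : a ≤ b) (hbc : b ≤ c) :
    (∫⁻ s in Set.Icc a b, f s) + ∫⁻ s in Set.Icc b c, f s = ∫⁻ s in Set.Icc a c, f s := by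
  simp only [← restrict_Ioc_eq_restrict_Icc]
  rw [← Set.Ioc_union_Ioc_eq_Ioc hab hbc, lintegral_union measurableSet_Ioc]
  rw [Set.disjoint_left]
  exact fun x hx hx' => not_lt.2 hx.2 hx'.1

theorem enorm_sub_le_lintegral_deriv_of_piecewise {E : Type*} [NormedAddCommGroup E]
    [NormedSpace ℝ E] (F : ℝ → E) {t : ℕ → ℝ} (ht : Monotone t) {n : ℕ}
    (hd : ∀ i < n, ContDiffOn ℝ 1 F (Set.Icc (t i) (t (i + 1)))) :
    ‖F (t n) - F (t 0)‖ₑ ≤ ∫⁻ s in Set.Icc (t 0) (t n), ‖deriv F s‖ₑ := by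
  induction n with
  | zero => simp
  | succ k ih =>
    rw [← lintegral_Icc_add_lintegral_Icc _ (ht (Nat.zero_le k)) (ht k.le_succ),
      ← sub_add_sub_cancel _ (F (t k)), add_comm]
    exact (enorm_add_le _ _).trans (add_le_add (ih fun i hi => hd i (by omega))
      (enorm_sub_le_lintegral_deriv_of_contDiffOn_Icc (hd k (by omega)) (ht k.le_succ)))

theorem enorm_embed_sub_le_pathLength {γ : ℝ → RestrictedBundle Pp}
    (hγ : IsPiecewiseSmooth hPp γ) :
    ‖embed hPp (γ 1) - embed hPp (γ 0)‖ₑ ≤ pathLength hPp ambientNorm γ := by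
  obtain ⟨n, t, ht, h0, h1, hd⟩ := hγ
  have key := enorm_sub_le_lintegral_deriv_of_piecewise (fun r => embed hPp (γ r)) ht
    (n := n) fun i hi => (hd i hi).of_le (by exact_mod_cast le_top)
  rw [h0, h1] at key
  exact key

theorem enorm_embed_sub_le_ambientDist (x y : RestrictedBundle Pp) :
    ‖embed hPp y - embed hPp x‖ₑ ≤ ambientDist hPp x y := by
  refine le_iInf fun γ => le_iInf fun hγ => le_iInf fun h0 => le_iInf fun h1 => ?_
  rw [← h0, ← h1]
  exact enorm_embed_sub_le_pathLength hPp hγ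

/-- Horizontal lifts scale with the vector. This is the only property of the norm that reversing and
joining paths require. -/
theorem quotientNorm_smul_le (x : RestrictedBundle Pp) {c : ℝ} (hc : c ≠ 0) (V : Ambient H) :
    quotientNorm x (c • V) ≤ ‖c‖ₑ * quotientNorm x V := by
  simp only [quotientNorm, ENNReal.mul_iInf_of_ne (enorm_ne_zero.2 hc) enorm_ne_top]
  refine le_iInf fun Z => le_iInf fun hZ => le_iInf fun h => ?_
  refine (iInf_le_of_le (c • Z) (iInf_le_of_le (Submodule.smul_mem _ c hZ) (iInf_le _ ?_))).trans
    (enorm_smul c Z).le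
  rw [map_smul, h]
  rfl

end Comparison

/-! ### Reparametrization, reversal and concatenation of paths. -/

section PathDist

variable (hPp : IsStarProjection Pp) {N : RestrictedBundle Pp → Ambient H → ℝ≥0∞}

/-- Change of variables with Jacobian `|a|`, matched by the factor `a` in the velocity. It is used
with `a = -1` for reversal and `a = 2` for concatenation. -/
theorem lintegral_affine_le (hN : ∀ x (c : ℝ) V, c ≠ 0 → N x (c • V) ≤ ‖c‖ₑ * N x V)
    (γ : ℝ → RestrictedBundle Pp) {a : ℝ} (ha : a ≠ 0) (b : ℝ) {s : Set ℝ} (hs : MeasurableSet s) :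
    ∫⁻ r in s, N (γ (a * r + b)) (deriv (fun r => embed hPp (γ (a * r + b))) r) ≤
      ∫⁻ r in (fun r => a * r + b) '' s, N (γ r) (deriv (fun r => embed hPp (γ r)) r) := by
  rw [lintegral_image_eq_lintegral_abs_deriv_mul (f' := fun _ => a) hs
    (fun r _ => by simpa using (((hasDerivAt_id r).const_mul a).add_const b).hasDerivWithinAt)
    (fun r _ r' _ h => by simpa [ha] using h)]
  refine lintegral_mono fun r => ?_
  have h1 : deriv (fun r => embed hPp (γ (a * r + b))) r =
      a • deriv (fun r => embed hPp (γ r)) (a * r + b) := by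
    rw [deriv_comp_mul_left a (fun r => embed hPp (γ (r + b))) r,
      deriv_comp_add_const (f := fun r => embed hPp (γ r))]
  rw [h1]
  refine (hN _ _ _ ha).trans_eq ?_
  rw [Real.enorm_eq_ofReal_abs]

theorem IsPiecewiseSmooth.reverse {γ : ℝ → RestrictedBundle Pp} (h : IsPiecewiseSmooth hPp γ) :
    IsPiecewiseSmooth hPp fun s => γ (-1 * s + 1) := by
  obtain ⟨n, t, ht, h0, h1, hd⟩ := h
  refine ⟨n, fun i => 1 - t (n - i), fun i j hij => ?_, by simp [h1], by simp [h0], fun i hi => ?_⟩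
  · have := ht (Nat.sub_le_sub_left hij n)
    dsimp only
    linarith
  · refine (hd (n - (i + 1)) (by omega)).comp (s := Set.Icc (1 - t (n - i)) (1 - t (n - (i + 1))))
      (f := fun s : ℝ => -1 * s + 1) (by fun_prop) fun s hs => ?_
    rw [show n - (i + 1) + 1 = n - i by omega]
    constructor <;> linarith [hs.1, hs.2]

theorem pathDist_le_pathLength {γ : ℝ → RestrictedBundle Pp} (hγ : IsPiecewiseSmooth hPp γ)
    {x y : RestrictedBundle Pp} (h0 : γ 0 = x) (h1 : γ 1 = y) :
    pathDist hPp N x y ≤ pathLength hPp N γ := by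
  unfold pathDist
  exact iInf_le_of_le γ (iInf_le_of_le hγ (iInf_le_of_le h0 (iInf_le _ h1)))

/-- The concatenation of two paths on `[0, 1]`. -/
def concat (γ γ' : ℝ → RestrictedBundle Pp) (s : ℝ) : RestrictedBundle Pp :=
  if s ≤ 1 / 2 then γ (2 * s + 0) else γ' (2 * s + -1)

theorem IsPiecewiseSmooth.concat {γ γ' : ℝ → RestrictedBundle Pp} (h : IsPiecewiseSmooth hPp γ)
    (h' : IsPiecewiseSmooth hPp γ') (hγ : γ 1 = γ' 0) :
    IsPiecewiseSmooth hPp (concat γ γ') := by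
  obtain ⟨n, t, ht, h0, h1, hd⟩ := h
  obtain ⟨n', t', ht', h0', h1', hd'⟩ := h'
  have htn : ∀ i ≤ n, t i ≤ 1 := fun i hi => h1 ▸ ht hi
  have htn' : ∀ i, 0 ≤ t' i := fun i => h0' ▸ ht' (Nat.zero_le i)
  refine ⟨n + n', fun i => if i ≤ n then t i / 2 else (1 + t' (i - n)) / 2, fun i j hij => ?_, ?_,
    ?_, fun i hi => ?_⟩
  · dsimp only
    split_ifs with hi hj hj
    · linarith [ht hij]
    · linarith [htn i hi, htn' (j - n)]
    · omega
    · linarith [ht' (Nat.sub_le_sub_right hij n)]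
  · simp [h0]
  · dsimp only
    split_ifs with h
    -- The first branch is taken at the last index only if the second subdivision is empty, which
    -- `t' 0 = 0` and `t' n' = 1` exclude.
    · obtain rfl : n' = 0 := by omega
      exact absurd (h0'.symm.trans h1') (by norm_num)
    · simp [h1']
  · by_cases hin : i < n
    · have e1 : (if i ≤ n then t i / 2 else (1 + t' (i - n)) / 2) = t i / 2 := if_pos hin.le
      have e2 : (if i + 1 ≤ n then t (i + 1) / 2 else (1 + t' (i + 1 - n)) / 2) = t (i + 1) / 2 :=
        if_pos hin
      dsimp only
      rw [e1, e2]
      have hs := (hd i hin).comp (s := Set.Icc (t i / 2) (t (i + 1) / 2))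
        (f := fun s : ℝ => 2 * s + 0) (by fun_prop)
        fun s hs => ⟨by linarith [hs.1], by linarith [hs.2]⟩
      refine hs.congr fun s hs => ?_
      have : s ≤ 1 / 2 := by linarith [hs.2, htn (i + 1) hin]
      simp only [RestrictedSphere.concat, if_pos this, Function.comp_apply]
    · have e1 : (if i ≤ n then t i / 2 else (1 + t' (i - n)) / 2) = (1 + t' (i - n)) / 2 := by
        split_ifs with h
        -- At the junction the two formulas for the subdivision point agree, both being `1 / 2`.
        · obtain rfl : i = n := by omega
          simp [h1, h0']
        · rfl
      have e2 : (if i + 1 ≤ n then t (i + 1) / 2 else (1 + t' (i + 1 - n)) / 2) =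
          (1 + t' (i - n + 1)) / 2 := by
        rw [if_neg (by omega), show i + 1 - n = i - n + 1 by omega]
      dsimp only
      rw [e1, e2]
      have hs := (hd' (i - n) (by omega)).comp
        (s := Set.Icc ((1 + t' (i - n)) / 2) ((1 + t' (i - n + 1)) / 2))
        (f := fun s : ℝ => 2 * s + -1) (by fun_prop)
        fun s hs => ⟨by linarith [hs.1], by linarith [hs.2]⟩
      refine hs.congr fun s hs => ?_
      have h2 : 1 / 2 ≤ s := by linarith [hs.1, htn' (i - n)]
      simp only [RestrictedSphere.concat, Function.comp_apply]
      split_ifs with h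
      · obtain rfl : s = 1 / 2 := le_antisymm h h2
        norm_num [hγ]
      · rfl

theorem pathLength_concat_le (hN : ∀ x (c : ℝ) V, c ≠ 0 → N x (c • V) ≤ ‖c‖ₑ * N x V)
    (γ γ' : ℝ → RestrictedBundle Pp) :
    pathLength hPp N (concat γ γ') ≤ pathLength hPp N γ + pathLength hPp N γ' := by
  rw [pathLength, ← lintegral_Icc_add_lintegral_Icc _ (by norm_num : (0 : ℝ) ≤ 1 / 2) (by norm_num)]
  -- On the open halves the concatenation coincides near each point with one rescaled path, hence so
  -- do the derivatives; at the junction this can fail.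
  simp only [← restrict_Ioo_eq_restrict_Icc]
  refine add_le_add ?_ ?_
  · have h : ∫⁻ s in Set.Ioo 0 (1 / 2 : ℝ),
        N (concat γ γ' s) (deriv (fun r => embed hPp (concat γ γ' r)) s) =
        ∫⁻ s in Set.Ioo 0 (1 / 2 : ℝ),
          N (γ (2 * s + 0)) (deriv (fun r => embed hPp (γ (2 * r + 0))) s) := by
      refine setLIntegral_congr_fun measurableSet_Ioo fun s hs => ?_
      have h1 : (fun r => embed hPp (concat γ γ' r)) =ᶠ[nhds s]
          fun r => embed hPp (γ (2 * r + 0)) := by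
        filter_upwards [Iic_mem_nhds hs.2] with r hr
        rw [concat, if_pos (Set.mem_Iic.1 hr)]
      have h2 : concat γ γ' s = γ (2 * s + 0) := if_pos hs.2.le
      rw [h1.deriv_eq, h2]
    rw [h]
    refine (lintegral_affine_le hPp hN γ two_ne_zero 0 measurableSet_Ioo).trans ?_
    refine lintegral_mono_set ?_
    rintro _ ⟨r, hr, rfl⟩
    exact ⟨by dsimp only; linarith [hr.1], by dsimp only; linarith [hr.2]⟩
  · have h : ∫⁻ s in Set.Ioo (1 / 2 : ℝ) 1,
        N (concat γ γ' s) (deriv (fun r => embed hPp (concat γ γ' r)) s) =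
        ∫⁻ s in Set.Ioo (1 / 2 : ℝ) 1,
          N (γ' (2 * s + -1)) (deriv (fun r => embed hPp (γ' (2 * r + -1))) s) := by
      refine setLIntegral_congr_fun measurableSet_Ioo fun s hs => ?_
      have h1 : (fun r => embed hPp (concat γ γ' r)) =ᶠ[nhds s]
          fun r => embed hPp (γ' (2 * r + -1)) := by
        filter_upwards [Ioi_mem_nhds hs.1] with r hr
        rw [concat, if_neg (not_le.2 hr)]
      have h2 : concat γ γ' s = γ' (2 * s + -1) := if_neg (not_le.2 hs.1)
      rw [h1.deriv_eq, h2]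
    rw [h]
    refine (lintegral_affine_le hPp hN γ' two_ne_zero (-1) measurableSet_Ioo).trans ?_
    rw [pathLength]
    refine lintegral_mono_set ?_
    rintro _ ⟨r, hr, rfl⟩
    exact ⟨by dsimp only; linarith [hr.1], by dsimp only; linarith [hr.2]⟩

theorem pathDist_self (hN : ∀ x, N x 0 = 0) (x : RestrictedBundle Pp) :
    pathDist hPp N x x = 0 := by
  refine nonpos_iff_eq_zero.1 ?_
  refine (pathDist_le_pathLength hPp (γ := fun _ => x) ?_ rfl rfl).trans ?_
  · refine ⟨1, fun i => i, Nat.mono_cast, by simp, by simp, fun i _ => contDiffOn_const⟩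
  · simp [pathLength, hN]

theorem pathDist_comm_le (hN : ∀ x (c : ℝ) V, c ≠ 0 → N x (c • V) ≤ ‖c‖ₑ * N x V)
    (x y : RestrictedBundle Pp) : pathDist hPp N x y ≤ pathDist hPp N y x := by
  refine le_iInf fun γ => le_iInf fun hγ => le_iInf fun h0 => le_iInf fun h1 => ?_
  refine (pathDist_le_pathLength hPp (hγ.reverse hPp) (by simpa using h1)
    (by simpa using h0)).trans ?_
  refine (lintegral_affine_le hPp hN γ (neg_ne_zero.2 one_ne_zero) 1 measurableSet_Icc).trans ?_
  refine lintegral_mono_set ?_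
  rintro _ ⟨r, hr, rfl⟩
  exact ⟨by dsimp only; linarith [hr.2], by dsimp only; linarith [hr.1]⟩

theorem pathDist_comm (hN : ∀ x (c : ℝ) V, c ≠ 0 → N x (c • V) ≤ ‖c‖ₑ * N x V)
    (x y : RestrictedBundle Pp) : pathDist hPp N x y = pathDist hPp N y x :=
  le_antisymm (pathDist_comm_le hPp hN x y) (pathDist_comm_le hPp hN y x)

theorem pathDist_triangle (hN : ∀ x (c : ℝ) V, c ≠ 0 → N x (c • V) ≤ ‖c‖ₑ * N x V)
    (x y z : RestrictedBundle Pp) :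
    pathDist hPp N x z ≤ pathDist hPp N x y + pathDist hPp N y z := by
  rw [pathDist.eq_1 hPp N x y, pathDist.eq_1 hPp N y z]
  simp only [ENNReal.iInf_add]
  refine le_iInf fun γ => le_iInf fun hγ => le_iInf fun h0 => le_iInf fun h1 => ?_
  simp only [ENNReal.add_iInf]
  refine le_iInf fun γ' => le_iInf fun hγ' => le_iInf fun h0' => le_iInf fun h1' => ?_
  refine (pathDist_le_pathLength hPp (hγ.concat hPp hγ' (h1.trans h0'.symm)) ?_ ?_).trans (pathLength_concat_le hPp hN γ γ')
  · simp [concat, h0]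
  · norm_num [concat, h1']

end PathDist

section QuotientDist

variable (hPp : IsStarProjection Pp)

theorem quotientDist_self (x : RestrictedBundle Pp) : quotientDist hPp x x = 0 := by
  refine pathDist_self hPp (fun x => ?_) x
  simpa using (isTangent_zero x).quotientNorm_le

theorem quotientDist_comm (x y : RestrictedBundle Pp) :
    quotientDist hPp x y = quotientDist hPp y x :=
  pathDist_comm hPp (fun x _ V hc => quotientNorm_smul_le x hc V) x y

theorem quotientDist_triangle (x y z : RestrictedBundle Pp) :
    quotientDist hPp x z ≤ quotientDist hPp x y + quotientDist hPp y z :=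
  pathDist_triangle hPp (fun x _ V hc => quotientNorm_smul_le x hc V) x y z

/-- The quotient distance is controlled by the length of a Lipschitz path in the ambient space. -/
theorem quotientDist_le_of_lipschitz {γ : ℝ → RestrictedBundle Pp} {F : ℝ → Ambient H} {C : ℝ}
    (hγ : ∀ s ∈ Set.Icc (0 : ℝ) 1, embed hPp (γ s) = F s)
    (hF : ContDiffOn ℝ ((⊤ : ℕ∞) : WithTop ℕ∞) F (Set.Icc 0 1))
    (hC : ∀ s ∈ Set.Icc (0 : ℝ) 1, ∀ r ∈ Set.Icc (0 : ℝ) 1, ‖F s - F r‖ ≤ C * |s - r|) :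
    quotientDist hPp (γ 0) (γ 1) ≤ ENNReal.ofReal (√2 * C) := by
  have hC0 : 0 ≤ C := by
    have := (norm_nonneg _).trans (hC 1 (by simp) 0 (by simp))
    simpa using this
  refine (quotientDist_le hPp _ _).trans ?_
  rw [ENNReal.ofReal_mul (by positivity)]
  gcongr
  refine (pathDist_le_pathLength hPp (γ := γ) ?_ rfl rfl).trans ?_
  · refine ⟨1, fun i => i, Nat.mono_cast, by simp, by simp, fun i hi => ?_⟩
    obtain rfl : i = 0 := by omega
    simpa using hF.congr hγ
  -- The two-sided derivative is controlled by `F` only at interior points, and the endpoints have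
  -- measure zero.
  · rw [pathLength, ← restrict_Ioo_eq_restrict_Icc]
    refine (setLIntegral_mono' (g := fun _ => ENNReal.ofReal C) measurableSet_Ioo
      fun s hs => ?_).trans ?_
    · rw [ambientNorm, ← ofReal_norm]
      refine ENNReal.ofReal_le_ofReal ?_
      refine norm_deriv_le_of_lip' hC0 ?_
      filter_upwards [Icc_mem_nhds hs.1 hs.2] with r hr
      rw [hγ r hr, hγ s ⟨hs.1.le, hs.2.le⟩]
      exact hC r hr s ⟨hs.1.le, hs.2.le⟩
    · simp

end QuotientDist

end RestrictedSphere

end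

open scoped ENNReal

noncomputable section

set_option linter.unusedSectionVars false

namespace RestrictedSphere

variable {H : Type*} [NormedAddCommGroup H] [InnerProductSpace ℂ H] [CompleteSpace H]

open HilbertSchmidt MeasureTheory

/-! ### The resolvent of an anti-Hermitian operator. -/

section Resolvent

variable {y : H →L[ℂ] H}

/-- The resolvent `(1 - t y)⁻¹`. -/
def resolv (y : H →L[ℂ] H) (t : ℝ) : H →L[ℂ] H := Ring.inverse (1 - t • y)

/-- `⟪v, y v⟫` is purely imaginary for anti-Hermitian `y`, so the cross term drops out. This gives
uniform resolvent bounds for all real `t`, with no smallness of `y`. -/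
theorem norm_sq_add_smul_apply (hy : star y = -y) (t : ℝ) (v : H) :
    ‖v + t • y v‖ ^ 2 = ‖v‖ ^ 2 + t ^ 2 * ‖y v‖ ^ 2 := by
  have h : (inner ℂ v (y v)).re = 0 := by
    have h1 : inner ℂ (y v) v = -inner ℂ v (y v) := by
      rw [← ContinuousLinearMap.adjoint_inner_right, ← ContinuousLinearMap.star_eq_adjoint, hy]
      simp
    have h2 : (inner ℂ (y v) v).re = (inner ℂ v (y v)).re := inner_re_symm (𝕜 := ℂ) _ _
    rw [h1, Complex.neg_re] at h2
    linarith
  have h2 : (t • y v) = (t : ℂ) • y v := (Complex.coe_smul t (y v)).symm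
  rw [h2, norm_add_sq (𝕜 := ℂ), inner_smul_right, norm_smul, mul_pow]
  simp [h]

theorem norm_le_norm_add_smul_apply (hy : star y = -y) (t : ℝ) (v : H) :
    ‖v‖ ≤ ‖v + t • y v‖ := by
  refine (sq_le_sq₀ (norm_nonneg _) (norm_nonneg _)).1 ?_
  rw [norm_sq_add_smul_apply hy]
  nlinarith [mul_nonneg (sq_nonneg t) (sq_nonneg ‖y v‖)]

/-- Coercivity: the real part of `⟪(1 - t y) v, v⟫` is `‖v‖²`. -/
theorem isUnit_one_sub_smul (hy : star y = -y) (t : ℝ) : IsUnit (1 - t • y) := by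
  refine ContinuousLinearMap.isUnit_of_forall_le_norm_inner_map _ (c := 1) one_pos fun v => ?_
  have h : (inner ℂ (y v) v).re = 0 := by
    have h1 : inner ℂ (y v) v = -inner ℂ v (y v) := by
      rw [← ContinuousLinearMap.adjoint_inner_right, ← ContinuousLinearMap.star_eq_adjoint, hy]
      simp
    have h2 : (inner ℂ (y v) v).re = (inner ℂ v (y v)).re := inner_re_symm (𝕜 := ℂ) _ _
    rw [h1, Complex.neg_re] at h2
    rw [h1, Complex.neg_re]
    linarith
  have h3 : (inner ℂ ((1 - t • y) v) v).re = ‖v‖ ^ 2 := by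
    have h2 : (1 - t • y) v = v - (t : ℂ) • y v := by
      rw [Complex.coe_smul]
      rfl
    have h4 : (inner ℂ v v).re = ‖v‖ ^ 2 := (norm_sq_eq_re_inner (𝕜 := ℂ) v).symm
    rw [h2, inner_sub_left, inner_smul_left]
    rw [Complex.sub_re, h4, Complex.conj_ofReal, Complex.re_ofReal_mul, h, mul_zero, sub_zero]
  rw [NNReal.coe_one, mul_one, ← h3]
  exact Complex.re_le_norm _

theorem resolv_mul (hy : star y = -y) (t : ℝ) : resolv y t * (1 - t • y) = 1 :=
  Ring.inverse_mul_cancel _ (isUnit_one_sub_smul hy t)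

theorem mul_resolv (hy : star y = -y) (t : ℝ) : (1 - t • y) * resolv y t = 1 :=
  Ring.mul_inverse_cancel _ (isUnit_one_sub_smul hy t)

theorem eq_resolv (hy : star y = -y) {t : ℝ} {M : H →L[ℂ] H} (h : (1 - t • y) * M = 1) :
    M = resolv y t := by
  calc M = resolv y t * (1 - t • y) * M := by rw [resolv_mul hy, one_mul]
    _ = resolv y t := by rw [mul_assoc, h, mul_one]

theorem norm_resolv_le (hy : star y = -y) (t : ℝ) : ‖resolv y t‖ ≤ 1 := by
  refine ContinuousLinearMap.opNorm_le_bound _ zero_le_one fun v => ?_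
  have h := norm_le_norm_add_smul_apply hy (-t) (resolv y t v)
  have h2 : resolv y t v + (-t) • y (resolv y t v) = v := by
    have := DFunLike.congr_fun (mul_resolv hy t) v
    rw [neg_smul, ← sub_eq_add_neg]
    exact this
  rw [h2] at h
  simpa using h

theorem one_sub_neg_smul (t : ℝ) : 1 - (-t) • y = 1 + t • y := by
  rw [neg_smul, sub_neg_eq_add]

theorem resolv_neg_mul (hy : star y = -y) (t : ℝ) : resolv y (-t) * (1 + t • y) = 1 := by
  rw [← one_sub_neg_smul, resolv_mul hy]

theorem mul_resolv_neg (hy : star y = -y) (t : ℝ) : (1 + t • y) * resolv y (-t) = 1 := by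
  rw [← one_sub_neg_smul, mul_resolv hy]

theorem star_resolv (hy : star y = -y) (t : ℝ) : star (resolv y t) = resolv y (-t) := by
  refine eq_resolv hy ?_
  have h : star (1 - t • y) = 1 - (-t) • y := by
    rw [star_sub, star_one, star_smul, hy, star_trivial, smul_neg, neg_smul]
  rw [← h, ← star_mul, resolv_mul hy, star_one]

theorem resolv_sub (hy : star y = -y) (t s : ℝ) :
    resolv y t - resolv y s = (t - s) • (resolv y t * y * resolv y s) := by
  have h : resolv y t * ((1 - s • y) - (1 - t • y)) * resolv y s = resolv y t - resolv y s := by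
    rw [mul_sub, sub_mul, mul_assoc, mul_resolv hy, mul_one, resolv_mul hy, one_mul]
  rw [← h, sub_sub_sub_cancel_left, ← sub_smul, mul_smul_comm, smul_mul_assoc]

theorem contDiff_resolv (hy : star y = -y) : ContDiff ℝ ((⊤ : ℕ∞) : WithTop ℕ∞) (resolv y) := by
  rw [contDiff_iff_contDiffAt]
  intro t
  obtain ⟨u, hu⟩ := isUnit_one_sub_smul hy t
  have h1 : ContDiffAt ℝ ((⊤ : ℕ∞) : WithTop ℕ∞) Ring.inverse (1 - t • y) := by
    rw [← hu]
    exact (contDiffAt_ringInverse ℂ u).restrict_scalars ℝ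
  have h2 : ContDiff ℝ ((⊤ : ℕ∞) : WithTop ℕ∞) fun s : ℝ => 1 - s • y :=
    contDiff_const.sub (contDiff_id.smul contDiff_const)
  exact h1.comp t h2.contDiffAt

end Resolvent

/-! ### Paths of projections given by the Cayley transform. -/

section CayleyProjection

/-- The projections `½ (1 + (1 + t y) (1 - t y)⁻¹ (2 P - 1))`. For an anti-Hermitian `y` that is
off-diagonal with respect to `P`, this is the projection onto the image of `R(P)` by `1 + t y`. -/
def cayleyProj (P y : H →L[ℂ] H) (t : ℝ) : H →L[ℂ] H := 1 - P + resolv y t * (2 * P - 1)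

variable {P y : H →L[ℂ] H} (hP : IsStarProjection P) (hy : star y = -y) (hPy : P * y + y * P = y)

theorem cayleyProj_zero (P y : H →L[ℂ] H) : cayleyProj P y 0 = P := by
  rw [cayleyProj, resolv, zero_smul, sub_zero, Ring.inverse_one, one_mul, two_mul]
  abel

include hP in
theorem reflection_mul_self : (2 * P - 1) * (2 * P - 1) = 1 := by
  have h := hP.isIdempotentElem.eq
  have e : (2 * P - 1) * (2 * P - 1) = 4 * (P * P) - 4 * P + 1 := by noncomm_ring
  rw [e, h]
  simp

include hP in
theorem star_reflection : star (2 * P - 1) = 2 * P - 1 := by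
  rw [star_sub, star_one, two_mul, star_add, hP.isSelfAdjoint.star_eq]

include hP in
theorem norm_reflection_le : ‖2 * P - 1‖ ≤ 1 := by
  have h := CStarRing.norm_star_mul_self (x := 2 * P - 1)
  rw [star_reflection hP, reflection_mul_self hP] at h
  have h1 : ‖(1 : H →L[ℂ] H)‖ ≤ 1 := ContinuousLinearMap.norm_id_le
  nlinarith [norm_nonneg (2 * P - 1)]

include hPy in
theorem reflection_mul_anticomm : (2 * P - 1) * y = -(y * (2 * P - 1)) := by
  have e : (2 * P - 1) * y + y * (2 * P - 1) = 2 * (P * y + y * P - y) := by noncomm_ring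
  rw [hPy, sub_self, mul_zero] at e
  exact eq_neg_of_add_eq_zero_left e

include hPy in
theorem reflection_mul_one_sub (t : ℝ) :
    (2 * P - 1) * (1 - t • y) = (1 + t • y) * (2 * P - 1) := by
  rw [mul_sub, add_mul, mul_smul_comm, smul_mul_assoc, reflection_mul_anticomm hPy, mul_one,
    one_mul, smul_neg, sub_neg_eq_add]

include hy hPy in
-- The reflection `2P - 1` anticommutes with the off-diagonal `y`, so conjugation by it reverses the
-- sign of `t`.
theorem reflection_mul_resolv (t : ℝ) :
    (2 * P - 1) * resolv y t = resolv y (-t) * (2 * P - 1) := by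
  calc (2 * P - 1) * resolv y t
      = resolv y (-t) * ((1 + t • y) * (2 * P - 1)) * resolv y t := by
        rw [← mul_assoc, resolv_neg_mul hy, one_mul]
    _ = resolv y (-t) * (2 * P - 1) := by
        rw [← reflection_mul_one_sub hPy, mul_assoc, mul_assoc, mul_resolv hy, mul_one]

include hy in
theorem resolv_add_resolv_neg (t : ℝ) :
    resolv y t + resolv y (-t) = 2 * (resolv y t * resolv y (-t)) := by
  have h : resolv y t * ((1 + t • y) + (1 - t • y)) * resolv y (-t) =
      resolv y t + resolv y (-t) := by
    rw [mul_add, add_mul, mul_assoc, mul_resolv_neg hy, mul_one, resolv_mul hy, one_mul]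
  rw [← h, add_add_sub_cancel, one_add_one_eq_two, mul_two, add_mul, two_mul]

theorem mul_self_eq_of_reflection {X : H →L[ℂ] H} (h : (2 * X - 1) * (2 * X - 1) = 1) :
    X * X = X := by
  have e : (2 * X - 1) * (2 * X - 1) = (4 : ℂ) • (X * X - X) + 1 := by
    rw [show (4 : ℂ) • (X * X - X) = (4 : ℕ) • (X * X - X) by
      rw [← Nat.cast_smul_eq_nsmul ℂ]; norm_num]
    noncomm_ring
  rw [e, add_eq_right, smul_eq_zero] at h
  exact sub_eq_zero.1 (h.resolve_left (by norm_num))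

include hP hy hPy in
-- The associated reflection is `(2R - 1)(2P - 1)` with `R` the resolvent at `t`. Moving `2P - 1`
-- across turns `R` into the resolvent `R'` at `-t`, and `2R - 1`, `2R' - 1` are mutually inverse
-- Cayley transforms because `R + R' = 2RR'`. So the reflection squares to one.
theorem isStarProjection_cayleyProj (t : ℝ) : IsStarProjection (cayleyProj P y t) where
  isSelfAdjoint := by
    rw [IsSelfAdjoint, cayleyProj, star_add, star_mul, star_reflection hP, star_resolv hy,
      reflection_mul_resolv hy hPy, neg_neg, star_sub, star_one, hP.isSelfAdjoint.star_eq]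
  isIdempotentElem := by
    refine mul_self_eq_of_reflection ?_
    have h0 : 2 * cayleyProj P y t - 1 = (2 * resolv y t - 1) * (2 * P - 1) := by
      rw [cayleyProj]; noncomm_ring
    have h1 : (2 * P - 1) * (2 * resolv y t - 1) = (2 * resolv y (-t) - 1) * (2 * P - 1) := by
      have h := reflection_mul_resolv hy hPy t
      rw [two_mul (resolv y t), two_mul (resolv y (-t)), mul_sub, mul_add, h,
      sub_mul (resolv y (-t) + resolv y (-t)), add_mul, mul_one, one_mul]
    have h2 := resolv_add_resolv_neg hy t
    rw [h0, mul_assoc, ← mul_assoc (2 * P - 1), h1, mul_assoc, reflection_mul_self hP, mul_one]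
    have h3 : (2 * resolv y t - 1) * (2 * resolv y (-t) - 1) =
        2 * (2 * (resolv y t * resolv y (-t)) - (resolv y t + resolv y (-t))) + 1 := by
      noncomm_ring
    rw [h3, h2, sub_self, mul_zero, zero_add]

include hP hPy in
theorem proj_mul_mul_proj : P * y * P = 0 := by
  have h : P * (P * y + y * P) = P * y := by rw [hPy]
  rw [mul_add, ← mul_assoc, hP.isIdempotentElem.eq, add_eq_left, ← mul_assoc] at h
  exact h

include hP hPy in
theorem one_sub_mul_mul_proj : (1 - P) * y * P = y * P := by
  rw [sub_mul, sub_mul, proj_mul_mul_proj hP hPy, one_mul, sub_zero]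

include hP hPy in
theorem one_sub_mul_mul_one_sub : (1 - P) * y * (1 - P) = 0 := by
  rw [mul_sub, one_sub_mul_mul_proj hP hPy, mul_one, sub_mul, one_mul, sub_sub, hPy, sub_self]

include hP hy hPy in
/-- `1 + t y` maps the range of `P` into that of `cayleyProj P y t`. -/
theorem cayleyProj_mul (t : ℝ) :
    cayleyProj P y t * ((1 + t • y) * P) = (1 + t • y) * P := by
  have h1 : (1 - P) * ((1 + t • y) * P) = t • (y * P) := by
    rw [add_mul, one_mul, mul_add, smul_mul_assoc, mul_smul_comm, ← mul_assoc,
      one_sub_mul_mul_proj hP hPy, hP.one_sub_mul_self, zero_add]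
  have h2 : (2 * P - 1) * P = P := by
    rw [sub_mul, two_mul, add_mul, hP.isIdempotentElem.eq, one_mul, add_sub_cancel_right]
  have h3 : (2 * P - 1) * (1 + t • y) = (1 - t • y) * (2 * P - 1) := by
    have h := reflection_mul_one_sub hPy (-t)
    rwa [one_sub_neg_smul, neg_smul, ← sub_eq_add_neg] at h
  rw [cayleyProj, add_mul, h1, mul_assoc, ← mul_assoc (2 * P - 1), h3, mul_assoc, h2, ← mul_assoc,
    resolv_mul hy, one_mul, add_mul, one_mul, smul_mul_assoc, add_comm]

include hP hy hPy in
/-- `(1 + t y)⁻¹` maps the range of `cayleyProj P y t` into that of `P`. -/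
theorem proj_mul_resolv_mul (t : ℝ) :
    P * (resolv y (-t) * cayleyProj P y t) = resolv y (-t) * cayleyProj P y t := by
  obtain ⟨N, hN⟩ : ∃ N, N = 1 - P := ⟨_, rfl⟩
  -- `M = (1 - t² y²)⁻¹` commutes with `P`, since `2P - 1` merely exchanges its two factors.
  set M := resolv y (-t) * resolv y t with hM
  have hM' : M = resolv y t * resolv y (-t) := by
    have h1 := resolv_add_resolv_neg hy t
    have h2 := resolv_add_resolv_neg hy (-t)
    rw [neg_neg, add_comm, h1, two_mul, two_mul, ← two_smul ℂ, ← two_smul ℂ] at h2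
    exact (smul_right_injective _ two_ne_zero h2).symm
  have hNe : N * (2 * P - 1) = -N := by
    have : N * (2 * P - 1) = -(1 - P) + 2 * (P - P * P) := by rw [hN]; noncomm_ring
    rw [this, hP.isIdempotentElem.eq, sub_self, mul_zero, add_zero, hN]
  have hcomm : (2 * P - 1) * M = M * (2 * P - 1) := by
    rw [hM, ← mul_assoc, reflection_mul_resolv hy hPy, neg_neg, mul_assoc,
      reflection_mul_resolv hy hPy, ← mul_assoc, ← hM', hM]
  have hNM : N * M = M * N := by
    have h : 2 * (P * M - M * P) = 0 := by
      have : (2 * P - 1) * M - M * (2 * P - 1) = 2 * (P * M - M * P) := by noncomm_ring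
      rw [← this, hcomm, sub_self]
    have h' : P * M - M * P = 0 := by
      rw [two_mul, ← two_smul ℂ] at h
      exact (smul_eq_zero.1 h).resolve_left two_ne_zero
    rw [hN, sub_mul, mul_sub, one_mul, mul_one, sub_eq_zero.1 h']
  have hR : resolv y (-t) = M * (1 - t • y) := by
    rw [hM, mul_assoc, resolv_mul hy, mul_one]
  -- Of the two summands of `cayleyProj`, `N = 1 - P` contributes `N M (1 - t y) N = M N`, because
  -- `N y N = 0`, and the resolvent term contributes `N M (2P - 1) = -M N`.
  have h0 : N * (resolv y (-t) * cayleyProj P y t) = 0 := by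
    have hNyN : N * y * N = 0 := hN ▸ one_sub_mul_mul_one_sub hP hPy
    have hNN : N * N = N := hN ▸ hP.one_sub.isIdempotentElem.eq
    rw [cayleyProj, mul_add, ← mul_assoc (resolv y (-t)), ← hM, mul_add, ← hN]
    have e1 : N * (M * (2 * P - 1)) = -(M * N) := by
      rw [← mul_assoc, hNM, mul_assoc, hNe, mul_neg]
    have e2 : N * (resolv y (-t) * N) = M * N := by
      rw [hR, ← mul_assoc, ← mul_assoc, hNM, mul_assoc, mul_assoc, sub_mul, one_mul, mul_sub, hNN,
        smul_mul_assoc, mul_smul_comm, ← mul_assoc N y N, hNyN, smul_zero, sub_zero]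
    rw [e1, e2, add_neg_cancel]
  rw [hN, sub_mul, one_mul, sub_eq_zero] at h0
  exact h0.symm

end CayleyProjection

end RestrictedSphere

end

open scoped ENNReal

noncomputable section

set_option linter.unusedSectionVars false

namespace RestrictedSphere

variable {H : Type*} [NormedAddCommGroup H] [InnerProductSpace ℂ H] [CompleteSpace H]

open HilbertSchmidt MeasureTheory

/-! ### A bounded projection onto the Hermitian Hilbert–Schmidt operators. -/

section HermitianPart

/-- The Hermitian part `½ (X + X*)` of a Hilbert-Schmidt operator, as an element of `B₂(H)`. -/
def hermitianPartAux : HilbertSchmidt H →L[ℝ] HilbertSchmidt H :=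
  (1 / 2 : ℝ) • (ContinuousLinearMap.id ℝ (HilbertSchmidt H) + adj.toContinuousLinearMap)

theorem toCLM_hermitianPartAux (X : HilbertSchmidt H) :
    toCLM H (hermitianPartAux X) = (1 / 2 : ℝ) • (toCLM H X + star (toCLM H X)) := rfl

/-- The Hermitian part `½ (X + X*)` of a Hilbert-Schmidt operator. -/
def hermitianPart : HilbertSchmidt H →L[ℝ] hermitianHS H :=
  hermitianPartAux.codRestrict (hermitianHS H) fun X => by
    change star (toCLM H (hermitianPartAux X)) = toCLM H (hermitianPartAux X)
    rw [toCLM_hermitianPartAux, star_smul, star_add, star_star, star_trivial, add_comm]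

/-- A curve of Hermitian operators that is smooth in `B₂(H)` can therefore be composed with a
bounded linear map to be smooth in the subspace. -/
theorem hermitianPart_eq (X : hermitianHS H) : hermitianPart (X : HilbertSchmidt H) = X := by
  refine Subtype.ext (toCLM_injective ?_)
  have hX : star (toCLM H X) = toCLM H X := X.2
  change toCLM H (hermitianPartAux (X : HilbertSchmidt H)) = _
  rw [toCLM_hermitianPartAux, hX, ← two_smul ℝ, smul_smul]
  norm_num

/-- Right multiplication with a fixed Hilbert-Schmidt operator, as a bounded map. -/
def rmulCLM (Y : HilbertSchmidt H) : (H →L[ℂ] H) →L[ℝ] HilbertSchmidt H :=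
  LinearMap.mkContinuous
    { toFun := rmul Y
      map_add' := fun M N => toCLM_injective (by simp [mul_add])
      map_smul' := fun c M => toCLM_injective (by
        change toCLM H Y * (c • M) = c • (toCLM H Y * M)
        rw [mul_smul_comm]) }
    ‖Y‖ fun M => norm_rmul_le Y M

theorem norm_le_add_of_ambient (V : Ambient H) : ‖V‖ ≤ ‖V.fst‖ + ‖V.snd‖ := by
  refine (sq_le_sq₀ (norm_nonneg _) (by positivity)).1 ?_
  rw [WithLp.prod_norm_sq_eq_of_L2]
  nlinarith [norm_nonneg V.fst, norm_nonneg V.snd]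

end HermitianPart

/-! ### Normalizing vectors along a segment. -/

section Normalization

theorem norm_inv_norm_smul_sub_le {v w : H} {m : ℝ} (hm : 0 < m) (hv : m ≤ ‖v‖) (hw : w ≠ 0) :
    ‖‖v‖⁻¹ • v - ‖w‖⁻¹ • w‖ ≤ 2 / m * ‖v - w‖ := by
  have hv0 : 0 < ‖v‖ := hm.trans_le hv
  have hw0 : 0 < ‖w‖ := norm_pos_iff.2 hw
  have e : ‖v‖⁻¹ • v - ‖w‖⁻¹ • w = ‖v‖⁻¹ • (v - w) + (‖v‖⁻¹ - ‖w‖⁻¹) • w := by module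
  have h1 : ‖(‖v‖⁻¹ - ‖w‖⁻¹) • w‖ ≤ ‖v‖⁻¹ * ‖v - w‖ := by
    have h2 : (‖v‖⁻¹ - ‖w‖⁻¹) = ‖v‖⁻¹ * (‖w‖ - ‖v‖) * ‖w‖⁻¹ := by field_simp
    rw [norm_smul, h2, norm_mul, norm_mul, norm_inv, norm_inv, norm_norm, norm_norm, mul_assoc,
      inv_mul_cancel₀ hw0.ne', mul_one, norm_sub_rev v w]
    gcongr
    exact abs_norm_sub_norm_le w v
  calc ‖‖v‖⁻¹ • v - ‖w‖⁻¹ • w‖ ≤ ‖v‖⁻¹ * ‖v - w‖ + ‖v‖⁻¹ * ‖v - w‖ := by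
        rw [e]
        refine (norm_add_le _ _).trans (add_le_add ?_ h1)
        rw [norm_smul, norm_inv, norm_norm]
    _ = 2 / ‖v‖ * ‖v - w‖ := by ring
    _ ≤ 2 / m * ‖v - w‖ := by gcongr

/-- The cross term is nonnegative, so the squared norm is at least `((1 - t)² + t²)‖g‖² ≥ ‖g‖² / 2`.
This keeps the segment away from the origin, where normalization is singular. -/
theorem norm_div_two_le_norm_segment {f g : H} (hf : ‖f‖ = 1) (hg : ‖g‖ ≤ 1)
    (hre : 0 ≤ (inner ℂ f g).re) {t : ℝ} (ht : t ∈ Set.Icc (0 : ℝ) 1) :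
    ‖g‖ / 2 ≤ ‖(1 - t) • f + t • g‖ := by
  have h : ‖(1 - t) • f + t • g‖ ^ 2 =
      (1 - t) ^ 2 + 2 * ((1 - t) * t * (inner ℂ f g).re) + t ^ 2 * ‖g‖ ^ 2 := by
    rw [← Complex.coe_smul (1 - t) f, ← Complex.coe_smul t g, norm_add_sq (𝕜 := ℂ), norm_smul,
      norm_smul, inner_smul_left, inner_smul_right, Complex.conj_ofReal, ← mul_assoc,
      ← Complex.ofReal_mul, RCLike.re_eq_complex_re, Complex.re_ofReal_mul, mul_pow, mul_pow, hf,
      Complex.norm_real, Complex.norm_real, Real.norm_eq_abs, Real.norm_eq_abs, sq_abs, sq_abs,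
      one_pow, mul_one]
  refine (sq_le_sq₀ (by positivity) (norm_nonneg _)).1 ?_
  rw [h]
  have h1 : 0 ≤ (1 - t) * t * (inner ℂ f g).re :=
    mul_nonneg (mul_nonneg (by linarith [ht.2]) ht.1) hre
  have h2 : ‖g‖ ^ 2 ≤ 1 := by nlinarith [norm_nonneg g]
  have h3 : (1 - t) ^ 2 * ‖g‖ ^ 2 ≤ (1 - t) ^ 2 := by nlinarith [sq_nonneg (1 - t)]
  nlinarith [mul_nonneg (sq_nonneg (2 * t - 1)) (sq_nonneg ‖g‖), sq_nonneg ‖g‖]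

end Normalization

/-! ### Explicit paths in the bundle and their length. -/

section CayleyPath

variable {Pp : H →L[ℂ] H}

theorem cayleyProj_eq_add {P y : H →L[ℂ] H} (hy : star y = -y) (t : ℝ) :
    cayleyProj P y t = P + t • (y * (resolv y t * (2 * P - 1))) := by
  have h : resolv y t = 1 + t • (y * resolv y t) := by
    have := mul_resolv hy t
    rw [sub_mul, one_mul, sub_eq_iff_eq_add, smul_mul_assoc] at this
    exact this
  rw [cayleyProj]
  conv_lhs => rw [h, add_mul, one_mul, smul_mul_assoc, mul_assoc, two_mul]
  rw [two_mul]
  abel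

theorem cayleyProj_sub {P y : H →L[ℂ] H} (hy : star y = -y) (t s : ℝ) :
    cayleyProj P y t - cayleyProj P y s =
      (t - s) • (resolv y t * (y * (resolv y s * (2 * P - 1)))) := by
  rw [cayleyProj, cayleyProj, add_sub_add_left_eq_sub, ← sub_mul, resolv_sub hy, smul_mul_assoc]
  simp only [mul_assoc]

/-- The resolvent is smooth in operator norm only; multiplication by the fixed Hilbert–Schmidt
factor `Y` upgrades this to the Hilbert–Schmidt norm. -/
theorem contDiff_rmulCLM_resolv {y : H →L[ℂ] H} (hy : star y = -y) (Y : HilbertSchmidt H)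
    (M : H →L[ℂ] H) :
    ContDiff ℝ ((⊤ : ℕ∞) : WithTop ℕ∞) fun t => rmulCLM Y (resolv y t * M) :=
  ((rmulCLM Y).comp ((mulBilin (H := H)).flip M)).contDiff.comp (contDiff_resolv hy)

theorem contDiff_cayleyVec (y : H →L[ℂ] H) (f g : H) :
    ContDiff ℝ ((⊤ : ℕ∞) : WithTop ℕ∞)
      fun t : ℝ => ((1 - t) • f + t • g) + t • y ((1 - t) • f + t • g) := by
  have hw : ContDiff ℝ ((⊤ : ℕ∞) : WithTop ℕ∞) fun t : ℝ => (1 - t) • f + t • g :=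
    ((contDiff_const.sub contDiff_id).smul contDiff_const).add (contDiff_id.smul contDiff_const)
  exact hw.add (contDiff_id.smul ((applyBilin y).contDiff.comp hw))

theorem contDiffOn_toLp {X : ℝ → HilbertSchmidt H} {v : ℝ → H} {s : Set ℝ}
    (hX : ContDiff ℝ ((⊤ : ℕ∞) : WithTop ℕ∞) X) (hv : ContDiff ℝ ((⊤ : ℕ∞) : WithTop ℕ∞) v)
    (hv0 : ∀ t ∈ s, v t ≠ 0) :
    ContDiffOn ℝ ((⊤ : ℕ∞) : WithTop ℕ∞)
      (fun t => (WithLp.toLp 2 (hermitianPart (X t), ‖v t‖⁻¹ • v t) : Ambient H)) s := by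
  have h1 : ContDiffOn ℝ ((⊤ : ℕ∞) : WithTop ℕ∞) (fun t => ‖v t‖⁻¹ • v t) s :=
    ((hv.contDiffOn.norm ℂ hv0).inv fun t ht => norm_ne_zero_iff.2 (hv0 t ht)).smul hv.contDiffOn
  have h2 : ContDiffOn ℝ ((⊤ : ℕ∞) : WithTop ℕ∞) (fun t => hermitianPart (X t)) s :=
    (hermitianPart.contDiff.comp hX).contDiffOn
  exact (WithLp.prodContinuousLinearEquiv 2 ℝ (hermitianHS H) H).symm.contDiff.comp_contDiffOn
    (h2.prodMk h1)

/-- Two points of the restricted sphere bundle whose projections are joined by a path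
`cayleyProj` are joined by an explicit path of controlled length. -/
theorem quotientDist_le_of_cayleyProj (hPp : IsStarProjection Pp) (x z : RestrictedBundle Pp)
    (Y : HilbertSchmidt H) (hY : star (toCLM H Y) = -toCLM H Y)
    (hPY : x.P * toCLM H Y + toCLM H Y * x.P = toCLM H Y)
    (h1 : cayleyProj x.P (toCLM H Y) 1 = z.P)
    (hidx : ∀ t, pairIndex Pp (cayleyProj x.P (toCLM H Y) t) = 0)
    {g : H} (hg : g + toCLM H Y g = z.f) (hre : 0 ≤ (inner ℂ x.f g).re) :
    quotientDist hPp x z ≤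
      ENNReal.ofReal (√2 * (‖Y‖ + 4 / ‖g‖ * (‖Y‖ + (1 + ‖Y‖) * ‖g - x.f‖))) := by
  obtain ⟨y, hyY⟩ : ∃ y, y = toCLM H Y := ⟨_, rfl⟩
  rw [← hyY] at hY hPY h1 hidx hg
  have hP := x.isStarProjection
  have hyn : ‖y‖ ≤ ‖Y‖ := hyY ▸ opNorm_le_norm Y
  have hynv : ∀ v, ‖y v‖ ≤ ‖Y‖ * ‖v‖ := fun v => (y.le_opNorm v).trans (by gcongr)
  -- `g = (1 + y)⁻¹ z.f`, and `(1 + y)⁻¹` carries `R(z.P)` back into `R(x.P)`.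
  have hPg : x.P g = g := by
    have e := DFunLike.congr_fun (proj_mul_resolv_mul hP hY hPY 1) z.f
    rw [h1] at e
    have e2 : resolv y (-1) (z.P z.f) = g := by
      rw [z.apply_eq, ← hg]
      have := DFunLike.congr_fun (resolv_neg_mul hY 1) g
      rwa [one_smul] at this
    change x.P (resolv y (-1) (z.P z.f)) = resolv y (-1) (z.P z.f) at e
    rwa [e2] at e
  have hgn : ‖g‖ ≤ 1 := by
    have h := norm_le_norm_add_smul_apply hY 1 g
    rwa [one_smul, hg, z.norm_eq_one] at h
  have hg0 : 0 < ‖g‖ := by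
    rw [norm_pos_iff]
    rintro rfl
    have := z.norm_eq_one
    rw [← hg] at this
    simp at this
  -- The segment stays in `R(x.P)`, so `(1 + t y) w t` lies in the range of the projection at time
  -- `t`; it starts at `x.f` and ends at `z.f`.
  set w : ℝ → H := fun t => (1 - t) • x.f + t • g with hw
  set v : ℝ → H := fun t => w t + t • y (w t) with hv
  have hPw : ∀ t, x.P (w t) = w t := fun t => by
    simp only [hw, map_add, ContinuousLinearMap.map_smul_of_tower, x.apply_eq, hPg]
  have hvn : ∀ t ∈ Set.Icc (0 : ℝ) 1, ‖g‖ / 2 ≤ ‖v t‖ := fun t ht =>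
    (norm_div_two_le_norm_segment x.norm_eq_one hgn hre ht).trans
      (norm_le_norm_add_smul_apply hY t (w t))
  have hv0 : ∀ t ∈ Set.Icc (0 : ℝ) 1, v t ≠ 0 := fun t ht =>
    norm_pos_iff.1 (lt_of_lt_of_le (by positivity) (hvn t ht))
  have hPv : ∀ t, cayleyProj x.P y t (v t) = v t := fun t => by
    have e := DFunLike.congr_fun (cayleyProj_mul hP hY hPY t) (w t)
    change cayleyProj x.P y t (x.P (w t) + t • y (x.P (w t))) =
      x.P (w t) + t • y (x.P (w t)) at e
    rwa [hPw] at e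
  set X : ℝ → HilbertSchmidt H := fun t =>
    ofMem _ x.sub_mem + t • rmulCLM Y (resolv y t * (2 * x.P - 1)) with hX
  have hXP : ∀ t, toCLM H (X t) = cayleyProj x.P y t - Pp := fun t => by
    rw [cayleyProj_eq_add hY]
    change x.P - Pp + t • (toCLM H Y * _) = _
    rw [← hyY]
    abel
  -- The points are defined on `[0, 1]` only, where `v t ≠ 0` is known; `Set.projIcc` extends them
  -- to the line.
  let pt : Set.Icc (0 : ℝ) 1 → RestrictedBundle Pp := fun t =>
    { P := cayleyProj x.P y t
      f := ‖v t‖⁻¹ • v t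
      isStarProjection := isStarProjection_cayleyProj hP hY hPY t
      sub_mem := by rw [← hXP]; exact toCLM_mem _
      index_eq_zero := hidx t
      apply_eq := by rw [ContinuousLinearMap.map_smul_of_tower, hPv]
      norm_eq_one := by
        rw [norm_smul, norm_inv, norm_norm, inv_mul_cancel₀ (norm_ne_zero_iff.2 (hv0 t t.2))] }
  let F : ℝ → Ambient H := fun t => WithLp.toLp 2 (hermitianPart (X t), ‖v t‖⁻¹ • v t)
  have hFpt : ∀ t : Set.Icc (0 : ℝ) 1, embed hPp (pt t) = F t := fun t => by
    have e : (⟨X t, by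
        change star (toCLM H _) = toCLM H _
        rw [hXP, star_sub, hPp.isSelfAdjoint.star_eq,
          (isStarProjection_cayleyProj hP hY hPY t).isSelfAdjoint.star_eq]⟩ : hermitianHS H) =
        hermitianPart (X t) := (hermitianPart_eq _).symm
    simp only [F, embed, ← e, pt]
    congr 2
    exact Subtype.ext (toCLM_injective (hXP t).symm)
  have hlen := quotientDist_le_of_lipschitz hPp (γ := fun s => pt (Set.projIcc 0 1 zero_le_one s))
    (F := F) (C := ‖Y‖ + 4 / ‖g‖ * (‖Y‖ + (1 + ‖Y‖) * ‖g - x.f‖))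
    (fun s hs => by rw [hFpt, Set.projIcc_of_mem _ hs]) ?_ ?_
  · have e0 : pt (Set.projIcc 0 1 zero_le_one 0) = x := by
      rw [Set.projIcc_left]
      refine RestrictedBundle.ext (cayleyProj_zero _ _) ?_
      simp [pt, hv, hw, x.norm_eq_one]
    have e1 : pt (Set.projIcc 0 1 zero_le_one 1) = z := by
      rw [Set.projIcc_right]
      refine RestrictedBundle.ext h1 ?_
      simp [pt, hv, hw, hg, z.norm_eq_one]
    rwa [e0, e1] at hlen
  · have hXc : ContDiff ℝ ((⊤ : ℕ∞) : WithTop ℕ∞) X := contDiff_const.add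
      (contDiff_id.smul (contDiff_rmulCLM_resolv hY Y _))
    have hvc : ContDiff ℝ ((⊤ : ℕ∞) : WithTop ℕ∞) v := contDiff_cayleyVec y x.f g
    exact contDiffOn_toLp hXc hvc hv0
  · intro s hs r hr
    refine (norm_le_add_of_ambient _).trans ?_
    rw [add_mul]
    refine add_le_add ?_ ?_
    · have e : (((F s - F r).fst : hermitianHS H) : HilbertSchmidt H) =
          (s - r) • lmul (resolv y s) (rmul Y (resolv y r * (2 * x.P - 1))) := by
        refine toCLM_injective ?_
        have e1 : toCLM H ((F s - F r).fst : HilbertSchmidt H) = (F s - F r).op := rfl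
        have e2 : toCLM H ((s - r) • lmul (resolv y s) (rmul Y (resolv y r * (2 * x.P - 1)))) =
            (s - r) • (resolv y s * (toCLM H Y * (resolv y r * (2 * x.P - 1)))) := rfl
        rw [e1, e2, ← hyY, ← cayleyProj_sub hY, ← hFpt ⟨s, hs⟩, ← hFpt ⟨r, hr⟩, ← opCLM_apply,
          map_sub, opCLM_embed, opCLM_embed, sub_sub_sub_cancel_right]
      have e3 : ‖(F s - F r).fst‖ = ‖(((F s - F r).fst : hermitianHS H) : HilbertSchmidt H)‖ := rfl
      rw [e3, e, norm_smul, mul_comm, Real.norm_eq_abs]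
      gcongr
      refine (norm_lmul_le _ _).trans ?_
      refine (mul_le_of_le_one_left (norm_nonneg _) (norm_resolv_le hY s)).trans ?_
      refine (norm_rmul_le _ _).trans (mul_le_of_le_one_right (norm_nonneg _) ?_)
      refine (norm_mul_le _ _).trans ?_
      exact mul_le_one₀ (norm_resolv_le hY r) (norm_nonneg _) (norm_reflection_le hP)
    · have hws : ‖w s‖ ≤ 1 := by
        refine (norm_add_le _ _).trans ?_
        rw [norm_smul, norm_smul, x.norm_eq_one, Real.norm_of_nonneg hs.1,
          Real.norm_of_nonneg (sub_nonneg.2 hs.2)]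
        nlinarith [hs.1]
      -- Write `v s - v r` as `(s - r) y (w s) + (1 + r y)(w s - w r)`.
      have e : v s - v r = (s - r) • (y (w s) + ((g - x.f) + r • y (g - x.f))) := by
        simp only [hv, hw, map_add, map_sub, ContinuousLinearMap.map_smul_of_tower]
        module
      have hvs : ‖v s - v r‖ ≤ (‖Y‖ + (1 + ‖Y‖) * ‖g - x.f‖) * |s - r| := by
        rw [e, norm_smul, mul_comm, Real.norm_eq_abs]
        gcongr
        refine (norm_add_le _ _).trans (add_le_add ?_ ?_)
        · exact (hynv _).trans (mul_le_of_le_one_right (norm_nonneg _) hws)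
        · refine (norm_add_le _ _).trans ?_
          rw [add_mul, one_mul, norm_smul, Real.norm_of_nonneg hr.1]
          exact add_le_add le_rfl ((mul_le_of_le_one_left (norm_nonneg _) hr.2).trans (hynv _))
      change ‖‖v s‖⁻¹ • v s - ‖v r‖⁻¹ • v r‖ ≤ _
      refine (norm_inv_norm_smul_sub_le (by positivity) (hvn s hs) (hv0 r hr)).trans ?_
      have e4 : 2 / (‖g‖ / 2) = 4 / ‖g‖ := by field_simp; norm_num
      rw [e4, mul_assoc]
      gcongr

end CayleyPath

end RestrictedSphere

end

open scoped ENNReal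

noncomputable section

set_option linter.unusedSectionVars false

namespace RestrictedSphere

variable {H : Type*} [NormedAddCommGroup H] [InnerProductSpace ℂ H] [CompleteSpace H]

open HilbertSchmidt

/-! ### Hilbert–Schmidt perturbations of the identity have index zero. -/

section IndexOfPerturbation

/-- `1 - F` preserves the range of `F`, and its kernel and cokernel are those of its restriction
there, an endomorphism of a finite dimensional space. -/
theorem index_id_sub_of_finiteDimensional_range {k V : Type*} [Field k] [AddCommGroup V] [Module k V]
    (F : V →ₗ[k] V) [FiniteDimensional k F.range] :
    FiniteDimensional k (LinearMap.id - F).ker ∧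
      FiniteDimensional k (V ⧸ (LinearMap.id - F).range) ∧ (LinearMap.id - F).index = 0 := by
  set T := LinearMap.id - F with hT
  have hTv : ∀ v, T v = v - F v := fun v => rfl
  have hmaps : ∀ v ∈ F.range, T v ∈ F.range := fun v hv =>
    Submodule.sub_mem _ hv (LinearMap.mem_range_self F v)
  set T₀ : F.range →ₗ[k] F.range := T.restrict hmaps with hT₀
  have hker : T₀.ker.map F.range.subtype = T.ker := by
    ext v
    constructor
    · rintro ⟨w, hw, rfl⟩
      exact congrArg Subtype.val (LinearMap.mem_ker.1 hw)
    · intro hv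
      have hv' : v = F v := sub_eq_zero.1 (LinearMap.mem_ker.1 hv)
      exact ⟨⟨v, hv' ▸ LinearMap.mem_range_self F v⟩, Subtype.ext (LinearMap.mem_ker.1 hv), rfl⟩
  set φ : F.range →ₗ[k] V ⧸ T.range := T.range.mkQ ∘ₗ F.range.subtype with hφ
  have hφs : Function.Surjective φ := fun q => by
    obtain ⟨v, rfl⟩ := Submodule.mkQ_surjective _ q
    refine ⟨⟨F v, LinearMap.mem_range_self F v⟩, ?_⟩
    change T.range.mkQ (F v) = T.range.mkQ v
    rw [← sub_eq_zero, ← map_sub, Submodule.mkQ_apply, Submodule.Quotient.mk_eq_zero]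
    exact ⟨-v, by rw [map_neg, hTv]; abel⟩
  have hφk : φ.ker = T₀.range := by
    ext r
    rw [LinearMap.mem_ker]
    change T.range.mkQ (r : V) = 0 ↔ _
    rw [Submodule.mkQ_apply, Submodule.Quotient.mk_eq_zero]
    constructor
    · rintro ⟨v, hv⟩
      have hvr : v ∈ F.range := by
        have : v = (r : V) + F v := by rw [← hv, hTv]; abel
        rw [this]
        exact Submodule.add_mem _ r.2 (LinearMap.mem_range_self F v)
      exact ⟨⟨v, hvr⟩, Subtype.ext hv⟩
    · rintro ⟨w, rfl⟩
      exact ⟨w, rfl⟩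
  have e : (F.range ⧸ T₀.range) ≃ₗ[k] V ⧸ T.range :=
    (Submodule.quotEquivOfEq _ _ hφk.symm).trans (φ.quotKerEquivOfSurjective hφs)
  have h0 : T₀.index = 0 := by rw [LinearMap.index_eq_of_finiteDimensional, sub_self]
  refine ⟨?_, e.finiteDimensional, ?_⟩
  · rw [← hker]
    infer_instance
  · rw [LinearMap.index_eq_finrank_sub] at h0 ⊢
    rw [← e.finrank_eq, ← hker, Submodule.finrank_map_subtype_eq]
    exact h0

theorem index_comp_of_bijective {k V W : Type*} [Field k] [AddCommGroup V] [Module k V]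
    [AddCommGroup W] [Module k W] {T : V →ₗ[k] V} {e : V ≃ₗ[k] W}
    (h : FiniteDimensional k T.ker ∧ FiniteDimensional k (V ⧸ T.range) ∧ T.index = 0) :
    FiniteDimensional k (e.toLinearMap ∘ₗ T).ker ∧
      FiniteDimensional k (W ⧸ (e.toLinearMap ∘ₗ T).range) ∧ (e.toLinearMap ∘ₗ T).index = 0 := by
  obtain ⟨h1, h2, h3⟩ := h
  have hk : (e.toLinearMap ∘ₗ T).ker = T.ker := LinearEquiv.ker_comp _ _
  have hr : T.range.map e.toLinearMap = (e.toLinearMap ∘ₗ T).range := (LinearMap.range_comp _ _).symm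
  have q : (V ⧸ T.range) ≃ₗ[k] W ⧸ (e.toLinearMap ∘ₗ T).range := Submodule.Quotient.equiv _ _ e hr
  refine ⟨by rw [hk]; exact h1, q.finiteDimensional, ?_⟩
  rw [LinearMap.index_eq_finrank_sub] at h3 ⊢
  rw [← q.finrank_eq, hk, h3]

/-- A Hilbert-Schmidt perturbation of the identity is a Fredholm operator of index zero. -/
theorem index_id_sub_of_mem_hilbertSchmidt {L : H →L[ℂ] H} (hL : L ∈ hilbertSchmidtSubmodule H) :
    FiniteDimensional ℂ (LinearMap.id - (L : H →ₗ[ℂ] H)).ker ∧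
      FiniteDimensional ℂ (H ⧸ (LinearMap.id - (L : H →ₗ[ℂ] H)).range) ∧
        (LinearMap.id - (L : H →ₗ[ℂ] H)).index = 0 := by
  obtain ⟨s, hs⟩ := exists_sum_rankOne_near hL one_pos
  set F := ∑ i ∈ s, InnerProductSpace.rankOne ℂ (L (hilbertBasis H i)) (hilbertBasis H i)
  have hF : FiniteDimensional ℂ F.range := finiteDimensional_range_sum_rankOne _ _ _
  -- With `F` a finite rank approximation and `G = 1 - (L - F)` invertible, `1 - L = G (1 - G⁻¹ F)`,
  -- which reduces to the finite rank case.
  obtain ⟨G, hG⟩ := isUnit_one_sub_of_norm_lt_one hs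
  have hGb : Function.Bijective (G : H →L[ℂ] H) :=
    ContinuousLinearMap.isUnit_iff_bijective.1 G.isUnit
  set e : H ≃ₗ[ℂ] H := LinearEquiv.ofBijective ((G : H →L[ℂ] H) : H →ₗ[ℂ] H) hGb
  have hF' : FiniteDimensional ℂ (e.symm.toLinearMap ∘ₗ (F : H →ₗ[ℂ] H)).range := by
    rw [LinearMap.range_comp]
    infer_instance
  have h := index_comp_of_bijective (e := e)
    (index_id_sub_of_finiteDimensional_range (e.symm.toLinearMap ∘ₗ (F : H →ₗ[ℂ] H)))
  have he : e.toLinearMap ∘ₗ (LinearMap.id - e.symm.toLinearMap ∘ₗ (F : H →ₗ[ℂ] H)) =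
      LinearMap.id - (L : H →ₗ[ℂ] H) := by
    ext v
    have h1 : e v = v - (L v - F v) := DFunLike.congr_fun hG v
    change e (v - e.symm (F v)) = v - L v
    rw [map_sub, e.apply_symm_apply, h1]
    abel
  rwa [he] at h

theorem mem_hilbertSchmidt_of_finiteDimensional_range {T : H →L[ℂ] H} {W : Submodule ℂ H}
    [FiniteDimensional ℂ W] (h : ∀ v, T v ∈ W) : T ∈ hilbertSchmidtSubmodule H := by
  set b := stdOrthonormalBasis ℂ W
  have e : T = ∑ i, InnerProductSpace.rankOne ℂ (b i : H)
      (ContinuousLinearMap.adjoint T (b i : H)) := by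
    ext v
    have h1 := congrArg (Subtype.val) (b.sum_repr' ⟨T v, h v⟩)
    rw [AddSubmonoidClass.coe_finsetSum] at h1
    refine h1.symm.trans ?_
    rw [sum_apply]
    refine Finset.sum_congr rfl fun i _ => ?_
    rw [InnerProductSpace.rankOne_apply, ContinuousLinearMap.adjoint_inner_left]
    rfl
  rw [e]
  exact Submodule.sum_mem _ fun i _ => rankOne_mem_hilbertSchmidt _ _

end IndexOfPerturbation

/-! ### Index zero as an equivalence of projections. -/

section Comparable

/-- The projections `P` and `Q` are comparable if there is an isomorphism `R(P) → R(Q)` that is a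
Hilbert-Schmidt perturbation of the operator `Q P`. -/
def Comparable (P Q : H →L[ℂ] H) : Prop :=
  ∃ S S' : H →L[ℂ] H, Q * S = S ∧ S * P = S ∧ P * S' = S' ∧ S' * Q = S' ∧ S' * S = P ∧ S * S' = Q ∧
    S - Q * P ∈ hilbertSchmidtSubmodule H

variable {P Q R : H →L[ℂ] H}

theorem Comparable.symm (hPP : P * P = P) (hPQ : P - Q ∈ hilbertSchmidtSubmodule H)
    (h : Comparable P Q) : Comparable Q P := by
  obtain ⟨S, S', h1, h2, h3, h4, h5, h6, hS⟩ := h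
  refine ⟨S', S, h3, h4, h1, h2, h6, h5, ?_⟩
  have e : S' - P * Q = -(S' * (P - Q)) - S' * (S - Q * P) + P * (P - Q) := by
    rw [mul_sub, mul_sub, mul_sub, h4, h5, ← mul_assoc, h4, hPP]
    abel
  rw [e]
  exact Submodule.add_mem _ (Submodule.sub_mem _ (Submodule.neg_mem _
    (mul_mem_hilbertSchmidt _ hPQ)) (mul_mem_hilbertSchmidt _ hS)) (mul_mem_hilbertSchmidt _ hPQ)

theorem Comparable.trans (hPP : P * P = P)
    (hPQ : P - Q ∈ hilbertSchmidtSubmodule H) (h : Comparable P Q)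
    (h' : Comparable Q R) : Comparable P R := by
  obtain ⟨S, S', h1, h2, h3, h4, h5, h6, hS⟩ := h
  obtain ⟨T, T', k1, k2, k3, k4, k5, k6, hT⟩ := h'
  refine ⟨T * S, S' * T', ?_, ?_, ?_, ?_, ?_, ?_, ?_⟩
  · rw [← mul_assoc, k1]
  · rw [mul_assoc, h2]
  · rw [← mul_assoc, h3]
  · rw [mul_assoc, k4]
  · rw [mul_assoc, ← mul_assoc T', k5, h1, h5]
  · rw [mul_assoc, ← mul_assoc S, h6, k3, k6]
  · have e : T * S - R * P = (T - R * Q) * S + R * (S - Q * P) - R * (P - Q) * P := by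
      have e1 : R * Q * S = R * S := by rw [mul_assoc, h1]
      rw [sub_mul, e1, mul_sub, mul_sub, sub_mul, mul_assoc R P P, hPP, mul_assoc R Q P]
      abel
    rw [e]
    exact Submodule.sub_mem _ (Submodule.add_mem _ (mem_hilbertSchmidt_mul hT _)
      (mul_mem_hilbertSchmidt _ hS)) (mem_hilbertSchmidt_mul (mul_mem_hilbertSchmidt _ hPQ) _)

/-- The operator `T = 1 - S'(S - QP)` has index zero. It equals `(1 - P) + S'QP`: the identity on
`ker P`, and on `R(P)` the operator `QP` followed by the isomorphism `S'`. So `T` has the kernel of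
`pairOperator` and, through `S'`, its cokernel. -/
theorem pairIndex_eq_zero_of_comparable (hP : IsStarProjection P) (h : Comparable P Q) :
    pairIndex P Q = 0 := by
  obtain ⟨S, S', h1, h2, h3, h4, h5, h6, hS⟩ := h
  have hPP : P * P = P := hP.isIdempotentElem.eq
  set L := S' * (S - Q * P) with hL
  obtain ⟨-, -, hi⟩ := index_id_sub_of_mem_hilbertSchmidt (mul_mem_hilbertSchmidt S' hS)
  rw [← hL] at hi
  set T : H →ₗ[ℂ] H := LinearMap.id - (L : H →ₗ[ℂ] H) with hT
  have hTv : ∀ v, T v = (v - P v) + S' (P v) := fun v => by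
    have e : L = P - S' * P := by rw [hL, mul_sub, h5, ← mul_assoc, h4]
    change v - L v = _
    rw [e]
    change v - (P v - S' (P v)) = _
    abel
  have hPPv : ∀ v, P (P v) = P v := fun v => DFunLike.congr_fun hPP v
  have h3v : ∀ v, P (S' v) = S' v := fun v => DFunLike.congr_fun h3 v
  have h4v : ∀ v, S' (Q v) = S' v := fun v => DFunLike.congr_fun h4 v
  have h6v : ∀ v, S (S' v) = Q v := fun v => DFunLike.congr_fun h6 v
  have h5v : ∀ v, S' (S v) = P v := fun v => DFunLike.congr_fun h5 v
  have h1v : ∀ v, Q (S v) = S v := fun v => DFunLike.congr_fun h1 v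
  have hQQv : ∀ v, Q (Q v) = Q v := fun v => by
    rw [← h6v v, h1v]
  set X := LinearMap.range (P : H →ₗ[ℂ] H)
  set Z := LinearMap.range (Q : H →ₗ[ℂ] H)
  have hX : ∀ v : X, P v = v := by
    rintro ⟨_, v, rfl⟩
    exact hPPv v
  have hZ : ∀ v : Z, Q v = v := by
    rintro ⟨_, v, rfl⟩
    exact hQQv v
  have hop : ∀ v : X, (pairOperator P Q v : H) = Q v := fun v => by
    change Q (P v) = Q v
    rw [hX]
  have hker : (pairOperator P Q).ker.map X.subtype = T.ker := by
    ext v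
    constructor
    · rintro ⟨w, hw, rfl⟩
      have hw' : Q w = 0 := by rw [← hop, LinearMap.mem_ker.1 hw]; rfl
      rw [LinearMap.mem_ker, hTv]
      change (w : H) - P w + S' (P w) = 0
      rw [hX, sub_self, zero_add, ← h4v, hw', map_zero]
    · intro hv
      rw [LinearMap.mem_ker, hTv] at hv
      have h7 := congrArg P hv
      rw [map_add, map_sub, hPPv, sub_self, zero_add, h3v, map_zero] at h7
      rw [h7, add_zero, sub_eq_zero] at hv
      refine ⟨⟨v, v, hv.symm⟩, ?_, rfl⟩
      refine LinearMap.mem_ker.2 (Subtype.ext ?_)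
      rw [hop]
      change Q v = 0
      rw [← h6v, hv, h7, map_zero]
  set φ : Z →ₗ[ℂ] H ⧸ T.range := T.range.mkQ ∘ₗ (S' : H →ₗ[ℂ] H) ∘ₗ Z.subtype
  have hφv : ∀ z : Z, φ z = T.range.mkQ (S' z) := fun z => rfl
  have hφs : Function.Surjective φ := fun q => by
    obtain ⟨v, rfl⟩ := Submodule.mkQ_surjective _ q
    refine ⟨⟨S v, S v, h1v v⟩, ?_⟩
    rw [hφv, h5v, ← sub_eq_zero, ← map_sub, Submodule.mkQ_apply, Submodule.Quotient.mk_eq_zero]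
    refine ⟨-(v - P v), ?_⟩
    rw [map_neg, hTv, map_sub, hPPv, sub_self, map_zero]
    abel
  have hφk : φ.ker = (pairOperator P Q).range := by
    ext z
    rw [LinearMap.mem_ker, hφv, Submodule.mkQ_apply, Submodule.Quotient.mk_eq_zero]
    constructor
    · rintro ⟨v, hv⟩
      refine ⟨⟨P v, v, rfl⟩, Subtype.ext ?_⟩
      have h7 := congrArg P hv
      rw [hTv, map_add, map_sub, hPPv, sub_self, zero_add, h3v, h3v] at h7
      rw [hop, ← hZ z, ← h6v, ← h6v, ← h7]
    · rintro ⟨w, rfl⟩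
      refine ⟨w, ?_⟩
      rw [hop, hTv, hX, sub_self, zero_add, h4v]
  have e : (Z ⧸ (pairOperator P Q).range) ≃ₗ[ℂ] H ⧸ T.range :=
    (Submodule.quotEquivOfEq _ _ hφk.symm).trans (φ.quotKerEquivOfSurjective hφs)
  rw [LinearMap.index_eq_finrank_sub, ← e.finrank_eq, ← hker,
    Submodule.finrank_map_subtype_eq] at hi
  exact hi

/-- Kernel and cokernel of `QP : R(P) → R(Q)` are finite dimensional of equal dimension. Adding a
finite rank map from the kernel onto a complement of the range makes the operator bijective, with
bounded inverse by the open mapping theorem. -/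
theorem comparable_of_pairIndex_eq_zero (hP : IsStarProjection P) (hQ : IsStarProjection Q)
    (hPQ : P - Q ∈ hilbertSchmidtSubmodule H) (h : pairIndex P Q = 0) : Comparable P Q := by
  have hPP : ∀ v, P (P v) = P v := fun v => apply_apply_of_isStarProjection hP v
  have hQQ : ∀ v, Q (Q v) = Q v := fun v => apply_apply_of_isStarProjection hQ v
  set X := LinearMap.range (P : H →ₗ[ℂ] H) with hXdef
  set Z := LinearMap.range (Q : H →ₗ[ℂ] H) with hZdef
  have hX : ∀ v : X, P v = v := by
    rintro ⟨_, v, rfl⟩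
    exact hPP v
  have hZ : ∀ v : Z, Q v = v := by
    rintro ⟨_, v, rfl⟩
    exact hQQ v
  set T := pairOperator P Q with hT
  have hop : ∀ v : X, (T v : H) = Q v := fun v => by
    change Q (P v) = Q v
    rw [hX]
  have hXc : IsClosed (X : Set H) := by
    have : (X : Set H) = {v | P v = v} := by
      ext v
      exact ⟨fun hv => hX ⟨v, hv⟩, fun hv => ⟨v, hv⟩⟩
    rw [this]
    exact isClosed_eq P.continuous continuous_id
  have hZc : IsClosed (Z : Set H) := by
    have : (Z : Set H) = {v | Q v = v} := by
      ext v
      exact ⟨fun hv => hZ ⟨v, hv⟩, fun hv => ⟨v, hv⟩⟩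
    rw [this]
    exact isClosed_eq Q.continuous continuous_id
  have : CompleteSpace X := hXc.completeSpace_coe
  have : CompleteSpace Z := hZc.completeSpace_coe
  have hkerfin : FiniteDimensional ℂ T.ker := by
    obtain ⟨h1, -, -⟩ := index_id_sub_of_mem_hilbertSchmidt
      (mul_mem_hilbertSchmidt P (mem_hilbertSchmidt_mul hPQ P))
    -- On a vector of `R(P)` killed by `Q`, the Hilbert–Schmidt operator `P (P - Q) P` acts as the
    -- identity.
    have hle : T.ker.map X.subtype ≤
        (LinearMap.id - ((P * ((P - Q) * P) : H →L[ℂ] H) : H →ₗ[ℂ] H)).ker := by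
      rintro _ ⟨w, hw, rfl⟩
      have hw' : Q w = 0 := by rw [← hop, LinearMap.mem_ker.1 hw]; rfl
      rw [LinearMap.mem_ker]
      change (w : H) - P (P (P w) - Q (P w)) = 0
      rw [hX, hX, hw', sub_zero, hX, sub_self]
    have h2 : FiniteDimensional ℂ (T.ker.map X.subtype) := Submodule.finiteDimensional_of_le hle
    exact (Submodule.equivMapOfInjective X.subtype X.injective_subtype T.ker).symm.finiteDimensional
  have hcokerfin : FiniteDimensional ℂ (Z ⧸ T.range) := by
    have hQP : Q - P ∈ hilbertSchmidtSubmodule H := by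
      rw [← neg_sub]; exact Submodule.neg_mem _ hPQ
    obtain ⟨-, h1, -⟩ := index_id_sub_of_mem_hilbertSchmidt
      (mul_mem_hilbertSchmidt Q (mem_hilbertSchmidt_mul hQP Q))
    set T' : H →ₗ[ℂ] H := LinearMap.id - ((Q * ((Q - P) * Q) : H →L[ℂ] H) : H →ₗ[ℂ] H)
    set φ : H →ₗ[ℂ] Z ⧸ T.range := T.range.mkQ ∘ₗ (Q : H →ₗ[ℂ] H).rangeRestrict
    -- `Q (1 - Q (Q - P) Q) = Q P Q`, whose values lie in the range of `T`.
    have hφ : T'.range ≤ φ.ker := by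
      rintro _ ⟨v, rfl⟩
      rw [LinearMap.mem_ker]
      change T.range.mkQ _ = 0
      rw [Submodule.mkQ_apply, Submodule.Quotient.mk_eq_zero]
      refine ⟨⟨P (Q v), Q v, rfl⟩, Subtype.ext ?_⟩
      rw [hop]
      change Q (P (Q v)) = Q (v - Q (Q (Q v) - P (Q v)))
      simp only [map_sub, hQQ]
      abel
    refine Module.Finite.of_surjective (T'.range.liftQ φ hφ) ?_
    refine Function.Surjective.of_comp (g := T'.range.mkQ) ?_
    rw [← LinearMap.coe_comp, Submodule.liftQ_mkQ]
    exact (Submodule.mkQ_surjective _).comp (LinearMap.surjective_rangeRestrict _)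
  obtain ⟨C, hC⟩ := Submodule.exists_isCompl T.range
  have eC : (Z ⧸ T.range) ≃ₗ[ℂ] C := Submodule.quotientEquivOfIsCompl _ _ hC
  have hCfin : FiniteDimensional ℂ C := eC.finiteDimensional
  have hfr : Module.finrank ℂ T.ker = Module.finrank ℂ C := by
    rw [← eC.finrank_eq]
    have h' : (Module.finrank ℂ T.ker : ℤ) - Module.finrank ℂ (Z ⧸ T.range) = 0 := h
    omega
  set e : T.ker ≃ₗ[ℂ] C := LinearEquiv.ofFinrankEq _ _ hfr
  set π : X →L[ℂ] T.ker := T.ker.orthogonalProjectionOnto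
  set E : T.ker →L[ℂ] Z := LinearMap.toContinuousLinearMap (C.subtype ∘ₗ e.toLinearMap)
  have hEv : ∀ n, E n = (e n : Z) := fun n => rfl
  set Tc : X →L[ℂ] Z := (Q ∘L X.subtypeL).codRestrict Z fun v => ⟨v, rfl⟩
  have hTc : ∀ v, Tc v = T v := fun v => Subtype.ext (hop v).symm
  set S₀ : X →L[ℂ] Z := Tc + E ∘L π
  have hS₀ : ∀ v, S₀ v = T v + e (π v) := fun v => by
    rw [← hTc]; rfl
  have hinj : S₀.ker = ⊥ := by
    rw [LinearMap.ker_eq_bot']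
    intro v hv
    have hv' : T v + (e (π v) : Z) = 0 := (hS₀ v).symm.trans hv
    have h1 : T v = -(e (π v) : Z) := eq_neg_of_add_eq_zero_left hv'
    have h2 : T v = 0 := (Submodule.disjoint_def.1 hC.disjoint) _ (LinearMap.mem_range_self T v)
      (h1 ▸ Submodule.neg_mem _ (e (π v)).2)
    rw [h2, zero_add] at hv'
    have h3 : π v = 0 := e.map_eq_zero_iff.1 (Subtype.ext hv')
    have h4 := T.ker.starProjection_eq_self_iff.2 (LinearMap.mem_ker.2 h2)
    rw [← h4]
    exact congrArg Subtype.val h3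
  have hsurj : S₀.range = ⊤ := by
    rw [LinearMap.range_eq_top]
    intro z
    obtain ⟨_, ⟨a, rfl⟩, c, hc, rfl⟩ := Submodule.mem_sup.1
      (hC.sup_eq_top ▸ Submodule.mem_top : z ∈ T.range ⊔ C)
    obtain ⟨n, hn⟩ := e.surjective ⟨c, hc⟩
    refine ⟨a - (π a : X) + n, ?_⟩
    have h1 : π (a - (π a : X) + n) = n := by
      rw [map_add, map_sub, Submodule.orthogonalProjectionOnto_mem_subspace_eq_self,
        Submodule.orthogonalProjectionOnto_mem_subspace_eq_self, sub_self, zero_add]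
    have h2 : T (a - (π a : X) + n) = T a := by
      rw [map_add, map_sub, LinearMap.mem_ker.1 (π a).2, LinearMap.mem_ker.1 n.2, sub_zero, add_zero]
    change S₀ _ = _
    rw [hS₀, h1, h2, hn]
  set U : X ≃L[ℂ] Z := ContinuousLinearEquiv.ofBijective S₀ hinj hsurj
  have hU : ∀ v, U v = S₀ v := fun v => rfl
  set pX : H →L[ℂ] X := P.codRestrict X fun v => ⟨v, rfl⟩
  set pZ : H →L[ℂ] Z := Q.codRestrict Z fun v => ⟨v, rfl⟩
  have hpX : ∀ v : X, pX v = v := fun v => Subtype.ext (hX v)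
  have hpZ : ∀ v : Z, pZ v = v := fun v => Subtype.ext (hZ v)
  have hpXc : ∀ v : H, (pX v : H) = P v := fun v => rfl
  have hpZc : ∀ v : H, (pZ v : H) = Q v := fun v => rfl
  have hpXP : ∀ v : H, pX (P v) = pX v := fun v => Subtype.ext (hPP v)
  have hpZQ : ∀ v : H, pZ (Q v) = pZ v := fun v => Subtype.ext (hQQ v)
  refine ⟨Z.subtypeL ∘L (U : X →L[ℂ] Z) ∘L pX, X.subtypeL ∘L (U.symm : Z →L[ℂ] X) ∘L pZ,
    ?_, ?_, ?_, ?_, ?_, ?_, ?_⟩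
  · ext v; exact hZ _
  · ext v
    change ((U (pX (P v)) : Z) : H) = U (pX v)
    rw [hpXP]
  · ext v; exact hX _
  · ext v
    change ((U.symm (pZ (Q v)) : X) : H) = U.symm (pZ v)
    rw [hpZQ]
  · ext v
    change ((U.symm (pZ (U (pX v) : Z)) : X) : H) = P v
    rw [hpZ, U.symm_apply_apply, hpXc]
  · ext v
    change ((U (pX (U.symm (pZ v) : X)) : Z) : H) = Q v
    rw [hpX, U.apply_symm_apply, hpZc]
  · have : FiniteDimensional ℂ (C.map Z.subtype) := inferInstance
    refine mem_hilbertSchmidt_of_finiteDimensional_range (W := C.map Z.subtype) fun v => ?_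
    refine ⟨e (π (pX v)), (e (π (pX v))).2, ?_⟩
    change ((e (π (pX v)) : Z) : H) = ((S₀ (pX v) : Z) : H) - Q (P v)
    rw [hS₀, Submodule.coe_add, hop, hpXc]
    abel

end Comparable

end RestrictedSphere

end

open scoped ENNReal

noncomputable section

set_option linter.unusedSectionVars false

namespace RestrictedSphere

variable {H : Type*} [NormedAddCommGroup H] [InnerProductSpace ℂ H] [CompleteSpace H]

open HilbertSchmidt

/-! ### The generator joining two projections in general position. -/

section CayleyGenerator

variable {P Q : H →L[ℂ] H}

/-- Two projections whose difference is Hilbert-Schmidt and whose sum minus one is invertible are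
joined by a path `cayleyProj`. -/
theorem exists_cayleyProj_eq (hP : IsStarProjection P) (hQ : IsStarProjection Q)
    (D : HilbertSchmidt H) (hD : toCLM H D = Q - P) (hu : IsUnit (P + Q - 1)) :
    ∃ Y : HilbertSchmidt H, star (toCLM H Y) = -toCLM H Y ∧
      P * toCLM H Y + toCLM H Y * P = toCLM H Y ∧ cayleyProj P (toCLM H Y) 1 = Q ∧
      ‖Y‖ ≤ ‖D‖ * ‖Ring.inverse (P + Q - 1)‖ := by
  have hPP := hP.isIdempotentElem.eq
  have hQQ := hQ.isIdempotentElem.eq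
  set S := P + Q - 1 with hS
  set Si := Ring.inverse S with hSi
  have h1 : S * Si = 1 := Ring.mul_inverse_cancel _ hu
  have h2 : Si * S = 1 := Ring.inverse_mul_cancel _ hu
  have hSs : star S = S := by
    rw [hS, star_sub, star_add, star_one, hP.isSelfAdjoint.star_eq, hQ.isSelfAdjoint.star_eq]
  have hSis : star Si = Si := by
    calc star Si = star Si * (S * Si) := by rw [h1, mul_one]
      _ = star (S * Si) * Si := by rw [star_mul, hSs, mul_assoc]
      _ = Si := by rw [h1, star_one, one_mul]
  set d := Q - P with hd
  have hds : star d = d := by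
    rw [hd, star_sub, hP.isSelfAdjoint.star_eq, hQ.isSelfAdjoint.star_eq]
  have hSd : S * d = -(d * S) := by
    have : S * d + d * S = 2 * (Q * Q - Q) - 2 * (P * P - P) := by rw [hS, hd]; noncomm_ring
    rw [hPP, hQQ, sub_self, sub_self, mul_zero, sub_self] at this
    exact eq_neg_of_add_eq_zero_left this
  have hSid : Si * d = -(d * Si) := by
    calc Si * d = Si * (d * S) * Si := by rw [mul_assoc, mul_assoc, h1, mul_one]
      _ = -(Si * S * d * Si) := by rw [← neg_neg (d * S), ← hSd, mul_neg, neg_mul, mul_assoc Si S d]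
      _ = -(d * Si) := by rw [h2, one_mul]
  have hds2 : 2 * P - 1 = S - d := by rw [hS, hd, two_mul]; abel
  -- The choice solves `2P - 1 = S - d = (1 - y) S`, so the resolvent at `1` turns `2P - 1` into `S
  -- = P + Q - 1`. Anti-Hermiticity and off-diagonality both follow from `S d = -d S`.
  set y := d * Si with hy
  have hyY : toCLM H (rmul D Si) = y := by rw [toCLM_rmul, hD]
  have hys : star y = -y := by rw [hy, star_mul, hds, hSis, hSid]
  refine ⟨rmul D Si, ?_⟩
  rw [hyY]
  refine ⟨hys, ?_, ?_, norm_rmul_le _ _⟩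
  · have e1 : (2 * P - 1) * y + y * (2 * P - 1) = 0 := by
      have a1 : (2 * P - 1) * y = -d - d * y := by
        rw [hds2, sub_mul, hy, ← mul_assoc, hSd, neg_mul, mul_assoc, h1, mul_one]
      have a2 : y * (2 * P - 1) = d + d * y := by
        rw [hds2, mul_sub, hy, mul_assoc, h2, mul_one, mul_assoc, hSid, mul_neg, sub_neg_eq_add]
      rw [a1, a2]
      abel
    have e2 : (2 * P - 1) * y + y * (2 * P - 1) = (2 : ℂ) • (P * y + y * P - y) := by
      rw [two_smul]; noncomm_ring
    rw [e2, smul_eq_zero, sub_eq_zero] at e1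
    exact e1.resolve_left two_ne_zero
  · have e : 2 * P - 1 = (1 - (1 : ℝ) • y) * S := by
      rw [one_smul, sub_mul, one_mul, hy, mul_assoc, h2, mul_one, hds2]
    rw [cayleyProj, e, ← mul_assoc, resolv_mul hys, one_mul, hS]
    abel

/-- The isomorphism is the restriction of `1 + t y`, a Hilbert–Schmidt perturbation of the identity.
This keeps the index zero along the path. -/
theorem comparable_cayleyProj {y : H →L[ℂ] H} (hP : IsStarProjection P) (hy : star y = -y)
    (hPy : P * y + y * P = y) (hyHS : y ∈ hilbertSchmidtSubmodule H) (t : ℝ) :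
    Comparable P (cayleyProj P y t) := by
  have hPP := hP.isIdempotentElem.eq
  set Q := cayleyProj P y t
  have hQQ : Q * Q = Q := (isStarProjection_cayleyProj hP hy hPy t).isIdempotentElem.eq
  have h1 : Q * ((1 + t • y) * P) = (1 + t • y) * P := cayleyProj_mul hP hy hPy t
  have h2 : P * (resolv y (-t) * Q) = resolv y (-t) * Q := proj_mul_resolv_mul hP hy hPy t
  refine ⟨(1 + t • y) * P, resolv y (-t) * Q, h1, ?_, h2, ?_, ?_, ?_, ?_⟩
  · rw [mul_assoc, hPP]
  · rw [mul_assoc, hQQ]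
  · rw [mul_assoc, h1, ← mul_assoc, resolv_neg_mul hy, one_mul]
  · rw [mul_assoc, h2, ← mul_assoc, mul_resolv_neg hy, one_mul]
  · have e : (1 + t • y) * P - Q * P = Q * ((t • y) * P) := by
      conv_lhs => rw [← h1]
      rw [← mul_sub, add_mul, one_mul, add_sub_cancel_left]
    rw [e]
    exact mul_mem_hilbertSchmidt _ (mem_hilbertSchmidt_mul
      (Submodule.smul_of_tower_mem _ t hyHS) _)

theorem comparable_of_isUnit (hP : IsStarProjection P) (hQ : IsStarProjection Q)
    (hPQ : Q - P ∈ hilbertSchmidtSubmodule H) (hu : IsUnit (P + Q - 1)) : Comparable P Q := by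
  obtain ⟨Y, h1, h2, h3, -⟩ := exists_cayleyProj_eq hP hQ (ofMem _ hPQ) rfl hu
  rw [← h3]
  exact comparable_cayleyProj hP h1 h2 Y.toCLM_mem 1

end CayleyGenerator

/-! ### Obstructions to general position. -/

section GeneralPosition

variable {P Q : H →L[ℂ] H}

theorem isUnit_or_exists_of_mem_hilbertSchmidt {L : H →L[ℂ] H}
    (hL : L ∈ hilbertSchmidtSubmodule H) : IsUnit (1 - L) ∨ ∃ v, v ≠ 0 ∧ L v = v := by
  rcases (isCompactOperator_of_mem_hilbertSchmidt hL).hasEigenvalue_or_mem_resolventSet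
    (one_ne_zero (α := ℂ)) with h | h
  · obtain ⟨v, hv⟩ := h.exists_hasEigenvector
    exact Or.inr ⟨v, hv.2, by simpa using hv.apply_eq_smul⟩
  · rw [spectrum.mem_resolventSet_iff, map_one] at h
    exact Or.inl h

/-- `(P + Q - 1)² = 1 - (Q - P)²` is a compact perturbation of the identity. If it is not invertible
it kills some `v ≠ 0`, and by self-adjointness so does `P + Q - 1`. Then `v = P v + Q v` with `P v`
in `R(P) ∩ ker Q` and `Q v` in `R(Q) ∩ ker P`. -/
theorem isUnit_of_disjoint (hP : IsStarProjection P) (hQ : IsStarProjection Q)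
    (hPQ : Q - P ∈ hilbertSchmidtSubmodule H) (h1 : ∀ v, P v = v → Q v = 0 → v = 0)
    (h2 : ∀ v, Q v = v → P v = 0 → v = 0) : IsUnit (P + Q - 1) := by
  have hPP := hP.isIdempotentElem.eq
  have hQQ := hQ.isIdempotentElem.eq
  have e : (P + Q - 1) * (P + Q - 1) = 1 - (Q - P) * (Q - P) := by
    have : (P + Q - 1) * (P + Q - 1) = 1 - (Q - P) * (Q - P) +
      (2 * (P * P - P) + 2 * (Q * Q - Q)) := by noncomm_ring
    rw [this, hPP, hQQ, sub_self, sub_self, mul_zero, add_zero, add_zero]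
  rcases isUnit_or_exists_of_mem_hilbertSchmidt (mul_mem_hilbertSchmidt (Q - P) hPQ) with h | h
  · rw [← e, ← sq] at h
    exact (isUnit_pow_iff two_ne_zero).1 h
  · obtain ⟨v, hv0, hv⟩ := h
    have hSS : (P + Q - 1) ((P + Q - 1) v) = 0 := by
      have := DFunLike.congr_fun e v
      change (P + Q - 1) ((P + Q - 1) v) = v - ((Q - P) * (Q - P)) v at this
      rw [this, hv, sub_self]
    have hSs : star (P + Q - 1) = P + Q - 1 := by
      rw [star_sub, star_add, star_one, hP.isSelfAdjoint.star_eq, hQ.isSelfAdjoint.star_eq]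
    have hSv : (P + Q - 1) v = 0 := by
      rw [← inner_self_eq_zero (𝕜 := ℂ), ← ContinuousLinearMap.adjoint_inner_right,
        ← ContinuousLinearMap.star_eq_adjoint, hSs, hSS, inner_zero_right]
    have hv1 : P v + Q v = v := sub_eq_zero.1 hSv
    have hQP : Q (P v) = 0 := by
      have := congrArg Q hv1
      rwa [map_add, apply_apply_of_isStarProjection hQ, add_eq_right] at this
    have hPQv : P (Q v) = 0 := by
      have := congrArg P hv1
      rwa [map_add, apply_apply_of_isStarProjection hP, add_eq_left] at this
    have a1 := h1 (P v) (apply_apply_of_isStarProjection hP v) hQP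
    have a2 := h2 (Q v) (apply_apply_of_isStarProjection hQ v) hPQv
    rw [a1, a2, add_zero] at hv1
    exact absurd hv1.symm hv0

/-- With `L = P - S'P`, the vector `e` is killed by `1 - L`. So `1 - L*` is not invertible and, `L*`
being compact, fixes some `y ≠ 0` under `L*`. The vector sought is `S'* y`, nonzero because `S* S'*
= P` and `P y = y`. -/
theorem Comparable.exists_ne_zero (hP : IsStarProjection P) (hQ : IsStarProjection Q) (h : Comparable P Q) {e : H}
    (he0 : e ≠ 0) (heP : P e = e) (heQ : Q e = 0) : ∃ w, w ≠ 0 ∧ Q w = w ∧ P w = 0 := by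
  obtain ⟨S, S', h1, h2, h3, h4, h5, h6, hS⟩ := h
  set L := S' * (S - Q * P) with hL
  have hLHS : L ∈ hilbertSchmidtSubmodule H := mul_mem_hilbertSchmidt S' hS
  have hLe : L = P - S' * P := by rw [hL, mul_sub, h5, ← mul_assoc, h4]
  have hnu : ¬ IsUnit (1 - star L) := by
    intro hu
    have hu' : IsUnit (1 - L) := by simpa using hu.star
    refine he0 ((ContinuousLinearMap.isUnit_iff_bijective.1 hu').1 ?_)
    change e - L e = (1 - L) 0
    have : S' (P e) = 0 := by
      rw [heP, ← h4]
      change S' (Q e) = 0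
      rw [heQ, map_zero]
    rw [map_zero, hLe]
    change e - (P e - S' (P e)) = 0
    rw [this, heP, sub_zero, sub_self]
  obtain ⟨y, hy0, hy⟩ :=
    (isUnit_or_exists_of_mem_hilbertSchmidt (star_mem_hilbertSchmidt hLHS)).resolve_left hnu
  have hLs : star L = P - P * star S' := by
    rw [hLe, star_sub, star_mul, hP.isSelfAdjoint.star_eq]
  rw [hLs] at hy
  have hy' : P y - P (star S' y) = y := hy
  have hPy : P y = y := by
    conv_lhs => rw [← hy']
    rw [map_sub, apply_apply_of_isStarProjection hP, apply_apply_of_isStarProjection hP, hy']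
  have hPw : P (star S' y) = 0 := by
    rwa [hPy, sub_eq_self] at hy'
  refine ⟨star S' y, fun hw => hy0 ?_, ?_, hPw⟩
  · have h7 := DFunLike.congr_fun (congrArg star h5) y
    rw [star_mul, hP.isSelfAdjoint.star_eq, hPy] at h7
    rw [← h7]
    change star S (star S' y) = 0
    rw [hw, map_zero]
  · have h7 := congrArg star h4
    rw [star_mul, hQ.isSelfAdjoint.star_eq] at h7
    exact DFunLike.congr_fun h7 y

theorem isStarProjection_add_rankOne (hP : IsStarProjection P) {a : H} (ha : ‖a‖ = 1)
    (hPa : P a = 0) : IsStarProjection (P + InnerProductSpace.rankOne ℂ a a) := by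
  refine hP.add (InnerProductSpace.isStarProjection_rankOne_self ha) ?_
  ext v
  change P (inner ℂ a v • a) = 0
  rw [map_smul, hPa, smul_zero]

theorem isStarProjection_sub_rankOne (hP : IsStarProjection P) {a : H} (ha : ‖a‖ = 1)
    (hPa : P a = a) : IsStarProjection (P - InnerProductSpace.rankOne ℂ a a) := by
  refine (InnerProductSpace.isStarProjection_rankOne_self ha).sub_of_mul_eq_right hP ?_
  ext v
  change P (inner ℂ a v • a) = inner ℂ a v • a
  rw [map_smul, hPa]

/-- Two projections `P + a ⊗ a*` and `P + b ⊗ b*` with `⟪b, a⟫ ≠ 0` are in general position. -/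
theorem isUnit_add_rankOne_add_rankOne (hP : IsStarProjection P) {a b : H} (ha : ‖a‖ = 1)
    (hb : ‖b‖ = 1) (hPa : P a = 0) (hPb : P b = 0) (hab : inner ℂ b a ≠ (0 : ℂ)) :
    IsUnit ((P + InnerProductSpace.rankOne ℂ a a) + (P + InnerProductSpace.rankOne ℂ b b) - 1) := by
  have key : ∀ {a b : H}, P a = 0 → P b = 0 → ‖b‖ = 1 → inner ℂ b a ≠ (0 : ℂ) → ∀ v,
      (P + InnerProductSpace.rankOne ℂ a a) v = v → (P + InnerProductSpace.rankOne ℂ b b) v = 0 →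
      v = 0 := by
    intro a b hPa hPb hb hab v h1 h2
    replace h1 : P v + inner ℂ a v • a = v := h1
    replace h2 : P v + inner ℂ b v • b = 0 := h2
    have hPv : P v = 0 := by
      have := congrArg P h2
      rwa [map_add, map_smul, hPb, smul_zero, add_zero, apply_apply_of_isStarProjection hP,
        map_zero] at this
    rw [hPv, zero_add] at h1 h2
    have hb0 : b ≠ 0 := fun h => by simp [h] at hb
    have h3 : inner ℂ b v = (0 : ℂ) := (smul_eq_zero.1 h2).resolve_right hb0
    rw [← h1, inner_smul_right] at h3
    rw [← h1, (mul_eq_zero.1 h3).resolve_right hab, zero_smul]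
  have hba : inner ℂ a b ≠ (0 : ℂ) := fun h => hab (inner_eq_zero_symm.1 h)
  refine isUnit_of_disjoint (isStarProjection_add_rankOne hP ha hPa)
    (isStarProjection_add_rankOne hP hb hPb) ?_ (key hPa hPb hb hab) (key hPb hPa ha hba)
  rw [add_sub_add_left_eq_sub]
  exact Submodule.sub_mem _ (rankOne_mem_hilbertSchmidt _ _) (rankOne_mem_hilbertSchmidt _ _)

theorem finiteDimensional_range_inf_ker (hP : IsStarProjection P)
    (hPQ : Q - P ∈ hilbertSchmidtSubmodule H) :
    FiniteDimensional ℂ ((P : H →ₗ[ℂ] H).range ⊓ (Q : H →ₗ[ℂ] H).ker : Submodule ℂ H) := by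
  obtain ⟨h1, -, -⟩ := index_id_sub_of_mem_hilbertSchmidt (Submodule.neg_mem _ hPQ)
  have hle : (P : H →ₗ[ℂ] H).range ⊓ (Q : H →ₗ[ℂ] H).ker ≤
      (LinearMap.id - ((-(Q - P) : H →L[ℂ] H) : H →ₗ[ℂ] H)).ker := by
    rintro _ ⟨⟨v, rfl⟩, h2⟩
    rw [LinearMap.mem_ker]
    change P v - -(Q (P v) - P (P v)) = 0
    rw [show Q (P v) = 0 from h2, apply_apply_of_isStarProjection hP, zero_sub, neg_neg, sub_self]
  exact Submodule.finiteDimensional_of_le hle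

end GeneralPosition

/-! ### Any two points are at finite distance. -/

section Connectedness

variable {Pp : H →L[ℂ] H} (hPp : IsStarProjection Pp)

include hPp

theorem RestrictedBundle.sub_mem' (x z : RestrictedBundle Pp) :
    z.P - x.P ∈ hilbertSchmidtSubmodule H := by
  rw [← sub_sub_sub_cancel_right z.P x.P Pp]
  exact Submodule.sub_mem _ z.sub_mem x.sub_mem

theorem RestrictedBundle.comparable (x : RestrictedBundle Pp) : Comparable Pp x.P :=
  comparable_of_pairIndex_eq_zero hPp x.isStarProjection
    (by rw [← neg_sub]; exact Submodule.neg_mem _ x.sub_mem) x.index_eq_zero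

theorem RestrictedBundle.pairIndex_eq_zero (x : RestrictedBundle Pp) {Q : H →L[ℂ] H}
    (h : Comparable x.P Q) : pairIndex Pp Q = 0 :=
  pairIndex_eq_zero_of_comparable hPp ((x.comparable hPp).trans hPp.isIdempotentElem.eq
    (by rw [← neg_sub]; exact Submodule.neg_mem _ x.sub_mem) h)

theorem quotientDist_le_of_generator (x z : RestrictedBundle Pp)
    (Y : HilbertSchmidt H) (hY : star (toCLM H Y) = -toCLM H Y)
    (hPY : x.P * toCLM H Y + toCLM H Y * x.P = toCLM H Y)
    (h1 : cayleyProj x.P (toCLM H Y) 1 = z.P) {g : H} (hg : g + toCLM H Y g = z.f)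
    (hre : 0 ≤ (inner ℂ x.f g).re) :
    quotientDist hPp x z ≤
      ENNReal.ofReal (√2 * (‖Y‖ + 4 / ‖g‖ * (‖Y‖ + (1 + ‖Y‖) * ‖g - x.f‖))) :=
  quotientDist_le_of_cayleyProj hPp x z Y hY hPY h1 (fun t => x.pairIndex_eq_zero hPp
    (comparable_cayleyProj x.isStarProjection hY hPY Y.toCLM_mem t)) hg hre

/-- Two points are connected if their quotient distance is finite. -/
theorem quotientDist_ne_top_trans {x y z : RestrictedBundle Pp} (h : quotientDist hPp x y ≠ ∞)
    (h' : quotientDist hPp y z ≠ ∞) : quotientDist hPp x z ≠ ∞ :=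
  ne_top_of_le_ne_top (ENNReal.add_ne_top.2 ⟨h, h'⟩) (quotientDist_triangle hPp x y z)

theorem quotientDist_ne_top_of_re_inner_nonneg (x z : RestrictedBundle Pp) (hP : x.P = z.P)
    (hre : 0 ≤ (inner ℂ x.f z.f).re) : quotientDist hPp x z ≠ ∞ := by
  refine ne_top_of_le_ne_top ENNReal.ofReal_ne_top
    (quotientDist_le_of_generator hPp x z 0 (by simp) (by simp) ?_ (g := z.f) (by simp) hre)
  rw [map_zero, ← hP, cayleyProj, resolv, smul_zero, sub_zero, Ring.inverse_one, one_mul, two_mul]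
  abel

theorem quotientDist_ne_top_of_proj_eq (x z : RestrictedBundle Pp) (hP : x.P = z.P) :
    quotientDist hPp x z ≠ ∞ := by
  rcases le_total 0 (inner ℂ x.f z.f).re with h | h
  · exact quotientDist_ne_top_of_re_inner_nonneg hPp x z hP h
  · have hmul : ∀ (w : RestrictedBundle Pp) (c : ℂ), ‖c‖ = 1 →
        ∃ w' : RestrictedBundle Pp, w'.P = w.P ∧ w'.f = c • w.f := fun w c hc =>
      ⟨{ w with
          f := c • w.f
          apply_eq := by rw [map_smul, w.apply_eq]
          norm_eq_one := by rw [norm_smul, hc, w.norm_eq_one, one_mul] }, rfl, rfl⟩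
    have hff : ∀ w : RestrictedBundle Pp, inner ℂ w.f w.f = (1 : ℂ) := fun w => by
      rw [inner_self_eq_norm_sq_to_K, w.norm_eq_one]; simp
    -- When the real part is negative, pass through `i f` and `-f`: consecutive vectors then have
    -- nonnegative real inner product. Complex scalars make this work even if `R(P)` is a line.
    obtain ⟨x₁, hx₁, hf₁⟩ := hmul x Complex.I (by simp)
    obtain ⟨x₂, hx₂, hf₂⟩ := hmul x₁ Complex.I (by simp)
    have a1 := quotientDist_ne_top_of_re_inner_nonneg hPp x x₁ hx₁.symm
      (by rw [hf₁, inner_smul_right, hff]; simp)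
    have a2 := quotientDist_ne_top_of_re_inner_nonneg hPp x₁ x₂ hx₂.symm
      (by rw [hf₂, inner_smul_right, hff]; simp)
    have e : x₂.f = -x.f := by
      rw [hf₂, hf₁, smul_smul, Complex.I_mul_I, neg_one_smul]
    have a3 := quotientDist_ne_top_of_re_inner_nonneg hPp x₂ z (by rw [hx₂, hx₁, hP])
      (by rw [e, inner_neg_left, Complex.neg_re]; linarith)
    exact quotientDist_ne_top_trans hPp (quotientDist_ne_top_trans hPp a1 a2) a3

theorem quotientDist_ne_top_of_isUnit (x z : RestrictedBundle Pp)
    (hu : IsUnit (x.P + z.P - 1)) : quotientDist hPp x z ≠ ∞ := by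
  obtain ⟨Y, h1, h2, h3, -⟩ := exists_cayleyProj_eq x.isStarProjection z.isStarProjection
    (ofMem _ (RestrictedBundle.sub_mem' hPp x z)) rfl hu
  set y := toCLM H Y
  set v := x.f + y x.f with hv
  have hv0 : 0 < ‖v‖ := by
    have := norm_le_norm_add_smul_apply h1 1 x.f
    rw [one_smul, x.norm_eq_one] at this
    linarith
  have hzv : z.P v = v := by
    have := DFunLike.congr_fun (cayleyProj_mul x.isStarProjection h1 h2 1) x.f
    rw [h3, one_smul] at this
    change z.P (x.P x.f + y (x.P x.f)) = x.P x.f + y (x.P x.f) at this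
    rwa [x.apply_eq] at this
  -- First move the projection, taking the vector wherever `1 + y` sends it; then correct the vector
  -- inside the fixed range.
  let z' : RestrictedBundle Pp :=
    { z with
      f := (‖v‖⁻¹ : ℂ) • v
      apply_eq := by rw [map_smul, hzv]
      norm_eq_one := by
        rw [norm_smul, norm_inv, Complex.norm_real, norm_norm, inv_mul_cancel₀ hv0.ne'] }
  refine quotientDist_ne_top_trans hPp (y := z') (ne_top_of_le_ne_top ENNReal.ofReal_ne_top
    (quotientDist_le_of_generator hPp x z' Y h1 h2 h3 (g := (‖v‖⁻¹ : ℂ) • x.f) ?_ ?_))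
    (quotientDist_ne_top_of_proj_eq hPp z' z rfl)
  · change (‖v‖⁻¹ : ℂ) • x.f + y ((‖v‖⁻¹ : ℂ) • x.f) = (‖v‖⁻¹ : ℂ) • v
    rw [map_smul, hv, smul_add]
  · rw [inner_smul_right, inner_self_eq_norm_sq_to_K, x.norm_eq_one, ← Complex.ofReal_inv]
    simp

/-- Any two points of the restricted sphere bundle are joined by a piecewise smooth path. -/
theorem quotientDist_ne_top (x z : RestrictedBundle Pp) : quotientDist hPp x z ≠ ∞ := by
  obtain ⟨n, hn⟩ : ∃ n, Module.finrank ℂ ((x.P : H →ₗ[ℂ] H).range ⊓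
      (z.P : H →ₗ[ℂ] H).ker : Submodule ℂ H) = n := ⟨_, rfl⟩
  -- Induction on the dimension of `R(x.P) ∩ ker z.P`, with the target `z` fixed.
  induction n using Nat.strong_induction_on generalizing x with
  | _ n ih =>
  have hxz := RestrictedBundle.sub_mem' hPp x z
  have hzx := RestrictedBundle.sub_mem' hPp z x
  have hP := x.isStarProjection
  have hQ := z.isStarProjection
  have hPpx : Pp - x.P ∈ hilbertSchmidtSubmodule H := by
    rw [← neg_sub]; exact Submodule.neg_mem _ x.sub_mem
  have hcomp : Comparable x.P z.P :=
    ((x.comparable hPp).symm hPp.isIdempotentElem.eq hPpx).trans hP.isIdempotentElem.eq x.sub_mem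
      (z.comparable hPp)
  have hcomp' : Comparable z.P x.P := hcomp.symm hP.isIdempotentElem.eq hzx
  by_cases hex : ∃ e, e ≠ 0 ∧ x.P e = e ∧ z.P e = 0
  swap
  · refine quotientDist_ne_top_of_isUnit hPp x z (isUnit_of_disjoint hP hQ hxz ?_ ?_)
    · intro v h1 h2
      by_contra hv
      exact hex ⟨v, hv, h1, h2⟩
    · intro v h1 h2
      by_contra hv
      exact hex (hcomp'.exists_ne_zero hQ hP hv h1 h2)
  obtain ⟨e₀, he0, he1, he2⟩ := hex
  obtain ⟨h₀, hh0, hh1, hh2⟩ := hcomp.exists_ne_zero hP hQ he0 he1 he2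
  have hunit : ∀ v : H, v ≠ 0 → ‖(‖v‖⁻¹ : ℂ) • v‖ = 1 := fun v hv => by
    rw [norm_smul, norm_inv, Complex.norm_real, norm_norm,
      inv_mul_cancel₀ (norm_ne_zero_iff.2 hv)]
  obtain ⟨e, hen, hPe, hQe⟩ : ∃ e, ‖e‖ = 1 ∧ x.P e = e ∧ z.P e = 0 :=
    ⟨_, hunit e₀ he0, by rw [map_smul, he1], by rw [map_smul, he2, smul_zero]⟩
  obtain ⟨h, hhn, hQh, hPh⟩ : ∃ h, ‖h‖ = 1 ∧ z.P h = h ∧ x.P h = 0 :=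
    ⟨_, hunit h₀ hh0, by rw [map_smul, hh1], by rw [map_smul, hh2, smul_zero]⟩
  have heh : inner ℂ e h = (0 : ℂ) := by
    rw [← hPe, inner_apply_of_isStarProjection hP, hPh, inner_zero_right]
  have hhe : inner ℂ h e = (0 : ℂ) := inner_eq_zero_symm.1 heh
  have hee : inner ℂ e e = (1 : ℂ) := by rw [inner_self_eq_norm_sq_to_K, hen]; simp
  have hhh : inner ℂ h h = (1 : ℂ) := by rw [inner_self_eq_norm_sq_to_K, hhn]; simp
  have heh0 : e + h ≠ 0 := fun h0 => by
    have := congrArg (inner ℂ e) h0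
    rw [inner_add_right, hee, heh, add_zero, inner_zero_right] at this
    exact one_ne_zero this
  set c : ℂ := (‖e + h‖⁻¹ : ℂ) with hc
  have hc0 : c ≠ 0 := inv_ne_zero (by simpa using heh0)
  -- `e` and `h` are orthogonal, so exchanging them in one step would not be in general position;
  -- `k` is orthogonal to neither.
  set k := c • (e + h) with hk
  have hkn : ‖k‖ = 1 := hunit _ heh0
  set P₀ := x.P - InnerProductSpace.rankOne ℂ e e with hP₀def
  have hP₀v : ∀ v, P₀ v = x.P v - inner ℂ e v • e := fun v => rfl
  have hP₀ : IsStarProjection P₀ := isStarProjection_sub_rankOne hP hen hPe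
  have hP₀e : P₀ e = 0 := by rw [hP₀v, hPe, hee, one_smul, sub_self]
  have hP₀h : P₀ h = 0 := by rw [hP₀v, hPh, heh, zero_smul, sub_self]
  have hP₀k : P₀ k = 0 := by rw [hk, map_smul, map_add, hP₀e, hP₀h, add_zero, smul_zero]
  have hxP : P₀ + InnerProductSpace.rankOne ℂ e e = x.P := sub_add_cancel _ _
  have hnew : ∀ (w : RestrictedBundle Pp) (a b : H), ‖a‖ = 1 → ‖b‖ = 1 → P₀ a = 0 → P₀ b = 0 →
      inner ℂ b a ≠ (0 : ℂ) → w.P = P₀ + InnerProductSpace.rankOne ℂ a a →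
      ∃ w' : RestrictedBundle Pp, w'.P = P₀ + InnerProductSpace.rankOne ℂ b b ∧
        quotientDist hPp w w' ≠ ∞ := by
    intro w a b ha hb hPa hPb hab hw
    have hu := isUnit_add_rankOne_add_rankOne hP₀ ha hb hPa hPb hab
    rw [← hw] at hu
    have hPb' := isStarProjection_add_rankOne hP₀ hb hPb
    have hHS : P₀ + InnerProductSpace.rankOne ℂ b b - w.P ∈ hilbertSchmidtSubmodule H := by
      rw [hw, add_sub_add_left_eq_sub]
      exact Submodule.sub_mem _ (rankOne_mem_hilbertSchmidt _ _) (rankOne_mem_hilbertSchmidt _ _)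
    let w' : RestrictedBundle Pp :=
      { P := P₀ + InnerProductSpace.rankOne ℂ b b
        f := b
        isStarProjection := hPb'
        sub_mem := by
          rw [← sub_add_sub_cancel _ w.P]
          exact Submodule.add_mem _ hHS w.sub_mem
        index_eq_zero := w.pairIndex_eq_zero hPp
          (comparable_of_isUnit w.isStarProjection hPb' hHS hu)
        apply_eq := by
          change P₀ b + inner ℂ b b • b = b
          rw [hPb, inner_self_eq_norm_sq_to_K, hb]
          simp
        norm_eq_one := hb }
    exact ⟨w', rfl, quotientDist_ne_top_of_isUnit hPp w w' hu⟩
  obtain ⟨x₁, hx₁, hd₁⟩ := hnew x e k hen hkn hP₀e hP₀k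
    (by
      rw [hk, inner_smul_left, inner_add_left, hee, hhe, add_zero, mul_one]
      simpa using hc0) hxP.symm
  obtain ⟨x₂, hx₂, hd₂⟩ := hnew x₁ k h hkn hhn hP₀k hP₀h
    (by
      rw [hk, inner_smul_right, inner_add_right, hhe, hhh, zero_add, mul_one]
      exact hc0) hx₁
  have hx₂v : ∀ v, x₂.P v = x.P v - inner ℂ e v • e + inner ℂ h v • h := fun v => by
    rw [hx₂]; rfl
  -- A vector killed by `z.P` is orthogonal to `h`, so nothing new enters the intersection, while
  -- `e` has left it.
  have hlt : ((x₂.P : H →ₗ[ℂ] H).range ⊓ (z.P : H →ₗ[ℂ] H).ker : Submodule ℂ H) <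
      (x.P : H →ₗ[ℂ] H).range ⊓ (z.P : H →ₗ[ℂ] H).ker := by
    refine lt_of_le_of_ne ?_ fun heq => ?_
    · rintro _ ⟨⟨v, rfl⟩, hv⟩
      refine ⟨?_, hv⟩
      set u := x₂.P v with hu
      have hv' : z.P u = 0 := hv
      have h1 : x₂.P u = u := apply_apply_of_isStarProjection x₂.isStarProjection v
      have h2 : inner ℂ h u = (0 : ℂ) := by
        rw [← hQh, inner_apply_of_isStarProjection hQ, hv', inner_zero_right]
      rw [hx₂v, h2, zero_smul, add_zero] at h1
      refine ⟨u, ?_⟩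
      change x.P u = u
      have h3 := congrArg x.P h1
      rw [map_sub, map_smul, hPe, apply_apply_of_isStarProjection hP, h1] at h3
      exact h3.symm
    · have hmem : e ∈ ((x₂.P : H →ₗ[ℂ] H).range ⊓ (z.P : H →ₗ[ℂ] H).ker : Submodule ℂ H) := by
        rw [heq]
        exact ⟨⟨e, hPe⟩, hQe⟩
      obtain ⟨⟨v, hv⟩, -⟩ := hmem
      have hv' : x₂.P v = e := hv
      have h1 : x₂.P e = e := by
        rw [← hv', apply_apply_of_isStarProjection x₂.isStarProjection]
      rw [hx₂v, hPe, hee, hhe, one_smul, zero_smul, sub_self, add_zero] at h1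
      rw [← h1, norm_zero] at hen
      exact zero_ne_one hen
  have hfin := finiteDimensional_range_inf_ker hP hxz
  have hd₃ := ih _ (hn ▸ Submodule.finrank_lt_finrank_of_lt hlt) x₂ rfl
  exact quotientDist_ne_top_trans hPp (quotientDist_ne_top_trans hPp hd₁ hd₂) hd₃

end Connectedness

/-! ### Local comparison with the ambient norm, and the topology. -/

section Topology

variable {Pp : H →L[ℂ] H} (hPp : IsStarProjection Pp)

/-- With the reflection `e = 2P - 1`, `P + Q - 1 = e (1 + e (Q - P))`, a small perturbation of an
involution of norm at most one. -/
theorem isUnit_and_norm_inverse_le {P Q : H →L[ℂ] H} (hP : IsStarProjection P)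
    (h : ‖Q - P‖ ≤ 1 / 2) : IsUnit (P + Q - 1) ∧ ‖Ring.inverse (P + Q - 1)‖ ≤ 2 := by
  have hee := reflection_mul_self hP
  set e := 2 * P - 1 with he
  have hS : P + Q - 1 = e * (1 - -(e * (Q - P))) := by
    rw [sub_neg_eq_add, mul_add, ← mul_assoc, hee, mul_one, one_mul, he, two_mul]
    abel
  have hen : ‖e‖ ≤ 1 := norm_reflection_le hP
  have hu : IsUnit (P + Q - 1) := by
    rw [hS]
    refine (Units.isUnit ⟨e, e, hee, hee⟩).mul (isUnit_one_sub_of_norm_lt_one ?_)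
    rw [norm_neg]
    refine (norm_mul_le _ _).trans_lt ?_
    nlinarith [norm_nonneg (Q - P), norm_nonneg e]
  refine ⟨hu, ContinuousLinearMap.opNorm_le_bound _ zero_le_two fun v => ?_⟩
  set w := Ring.inverse (P + Q - 1) v
  have h1 : (P + Q - 1) w = v := DFunLike.congr_fun (Ring.mul_inverse_cancel _ hu) v
  have h2 : w = e v - e ((Q - P) w) := by
    have h3 : e ((P + Q - 1) w) = (e * (P + Q - 1)) w := rfl
    have h4 : e * (P + Q - 1) = 1 + e * (Q - P) := by
      rw [hS, ← mul_assoc, hee, one_mul, sub_neg_eq_add]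
    rw [← h1, h3, h4]
    change w = w + e ((Q - P) w) - e ((Q - P) w)
    abel
  have h5 : ∀ u, ‖e u‖ ≤ ‖u‖ := fun u => (e.le_opNorm u).trans
    (mul_le_of_le_one_left (norm_nonneg _) hen)
  have h6 : ‖(Q - P) w‖ ≤ 1 / 2 * ‖w‖ := ((Q - P).le_opNorm w).trans (by gcongr)
  have h7 : ‖w‖ ≤ ‖v‖ + 1 / 2 * ‖w‖ := by
    calc ‖w‖ = ‖e v - e ((Q - P) w)‖ := by rw [← h2]
      _ ≤ ‖e v‖ + ‖e ((Q - P) w)‖ := norm_sub_le _ _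
      _ ≤ ‖v‖ + 1 / 2 * ‖w‖ := add_le_add (h5 v) ((h5 _).trans h6)
  linarith

/-- Locally, the quotient distance is bounded by the distance in the ambient space. -/
theorem quotientDist_le_of_norm_le (x z : RestrictedBundle Pp)
    (h : ‖embed hPp z - embed hPp x‖ ≤ 1 / 6) :
    quotientDist hPp x z ≤ ENNReal.ofReal (132 * ‖embed hPp z - embed hPp x‖) := by
  set d := ‖embed hPp z - embed hPp x‖ with hd
  have hd0 : 0 ≤ d := norm_nonneg _
  set D : HilbertSchmidt H := (embed hPp z - embed hPp x).fst.1 with hD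
  have hDop : toCLM H D = z.P - x.P := by
    have e : toCLM H D = opCLM (embed hPp z - embed hPp x) := rfl
    rw [e, map_sub, opCLM_embed, opCLM_embed, sub_sub_sub_cancel_right]
  have hV := WithLp.prod_norm_sq_eq_of_L2 (embed hPp z - embed hPp x)
  have hDn : ‖D‖ ≤ d := by
    have e : ‖D‖ = ‖(embed hPp z - embed hPp x).fst‖ := rfl
    refine (sq_le_sq₀ (norm_nonneg _) hd0).1 ?_
    rw [hd, hV, e]
    linarith [sq_nonneg ‖(embed hPp z - embed hPp x).snd‖]
  have hfn : ‖z.f - x.f‖ ≤ d := by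
    have e : ‖z.f - x.f‖ = ‖(embed hPp z - embed hPp x).snd‖ := rfl
    refine (sq_le_sq₀ (norm_nonneg _) hd0).1 ?_
    rw [hd, hV, e]
    linarith [sq_nonneg ‖(embed hPp z - embed hPp x).fst‖]
  obtain ⟨hu, hinv⟩ := isUnit_and_norm_inverse_le (Q := z.P) x.isStarProjection
    (by rw [← hDop]; linarith [opNorm_le_norm D])
  obtain ⟨Y, h1, h2, h3, hYn⟩ := exists_cayleyProj_eq x.isStarProjection z.isStarProjection D hDop hu
  have hY2 : ‖Y‖ ≤ 2 * d := by nlinarith [norm_nonneg D]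
  set y := toCLM H Y
  set g := resolv y (-1) z.f with hgdef
  have hg : g + y g = z.f := by
    have := DFunLike.congr_fun (mul_resolv_neg h1 1) z.f
    rwa [one_smul] at this
  have hgx : g - x.f = resolv y (-1) (z.f - x.f - y x.f) := by
    have := DFunLike.congr_fun (resolv_neg_mul h1 1) x.f
    rw [one_smul] at this
    change resolv y (-1) (x.f + y x.f) = x.f at this
    rw [sub_sub, map_sub, this]
  have hgn : ‖g - x.f‖ ≤ 3 * d := by
    rw [hgx]
    refine ((resolv y (-1)).le_opNorm _).trans ?_
    refine (mul_le_of_le_one_left (norm_nonneg _) (norm_resolv_le h1 _)).trans ?_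
    refine (norm_sub_le _ _).trans ?_
    have : ‖y x.f‖ ≤ ‖Y‖ := norm_apply_le Y x.norm_eq_one
    linarith
  -- The radius `1 / 6` makes `3 d ≤ 1 / 2`; this bounds `‖g‖` below and keeps the real part of
  -- `⟪x.f, g⟫` positive.
  have hg2 : 1 / 2 ≤ ‖g‖ := by
    have := norm_sub_norm_le x.f g
    rw [x.norm_eq_one, norm_sub_rev] at this
    linarith
  have hre : 0 ≤ (inner ℂ x.f g).re := by
    have e : inner ℂ x.f g = (1 : ℂ) + inner ℂ x.f (g - x.f) := by
      rw [inner_sub_right, inner_self_eq_norm_sq_to_K, x.norm_eq_one]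
      simp
    have e2 : |(inner ℂ x.f (g - x.f)).re| ≤ 3 * d := by
      refine (Complex.abs_re_le_norm _).trans ((norm_inner_le_norm _ _).trans ?_)
      rwa [x.norm_eq_one, one_mul]
    rw [e, Complex.add_re, Complex.one_re]
    linarith [(abs_le.1 e2).1]
  refine (quotientDist_le_of_generator hPp x z Y h1 h2 h3 hg hre).trans
    (ENNReal.ofReal_le_ofReal ?_)
  have hs : √2 ≤ 2 := by
    rw [Real.sqrt_le_left zero_le_two]
    norm_num
  have h4 : 4 / ‖g‖ ≤ 8 := by
    rw [div_le_iff₀ (by linarith)]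
    linarith
  have h5 : (1 + ‖Y‖) * ‖g - x.f‖ ≤ 2 * (3 * d) := by
    gcongr
    linarith
  have h6 : 4 / ‖g‖ * (‖Y‖ + (1 + ‖Y‖) * ‖g - x.f‖) ≤ 8 * (2 * d + 2 * (3 * d)) := by
    gcongr
  calc √2 * (‖Y‖ + 4 / ‖g‖ * (‖Y‖ + (1 + ‖Y‖) * ‖g - x.f‖))
      ≤ 2 * (2 * d + 8 * (2 * d + 2 * (3 * d))) := by gcongr
    _ = 132 * d := by ring

theorem enorm_embed_sub_le_quotientDist (x z : RestrictedBundle Pp) :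
    ‖embed hPp z - embed hPp x‖ₑ ≤ ENNReal.ofReal √(3 / 2) * quotientDist hPp x z :=
  (enorm_embed_sub_le_ambientDist hPp x z).trans (ambientDist_le hPp x z)

theorem norm_embed_sub_le_quotientDist (x z : RestrictedBundle Pp) :
    ‖embed hPp z - embed hPp x‖ ≤ √(3 / 2) * (quotientDist hPp x z).toReal := by
  have h := ENNReal.toReal_mono (ENNReal.mul_ne_top ENNReal.ofReal_ne_top
    (quotientDist_ne_top hPp x z)) (enorm_embed_sub_le_quotientDist hPp x z)
  rwa [toReal_enorm, ENNReal.toReal_mul, ENNReal.toReal_ofReal (Real.sqrt_nonneg _)] at h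

theorem embed_injective : Function.Injective (embed (H := H) hPp) := fun x z h => by
  refine RestrictedBundle.ext ?_ (congrArg WithLp.snd h)
  have := congrArg opCLM h
  rwa [opCLM_embed, opCLM_embed, sub_left_inj] at this

/-- The metric of the quotient distance. -/
@[reducible] def quotientMetric : MetricSpace (RestrictedBundle Pp) where
  dist x z := (quotientDist hPp x z).toReal
  dist_self x := by rw [quotientDist_self, ENNReal.toReal_zero]
  dist_comm x z := by rw [quotientDist_comm]
  dist_triangle x y z := by
    rw [← ENNReal.toReal_add (quotientDist_ne_top hPp _ _) (quotientDist_ne_top hPp _ _)]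
    exact ENNReal.toReal_mono (ENNReal.add_ne_top.2
      ⟨quotientDist_ne_top hPp _ _, quotientDist_ne_top hPp _ _⟩) (quotientDist_triangle hPp x y z)
  eq_of_dist_eq_zero {x z} h := by
    have h1 := norm_embed_sub_le_quotientDist hPp x z
    rw [h, mul_zero, norm_le_zero_iff, sub_eq_zero] at h1
    exact (embed_injective hPp h1).symm

theorem quotientMetric_topology :
    (quotientMetric hPp).toUniformSpace.toTopologicalSpace =
      TopologicalSpace.induced (embed hPp) inferInstance := by
  refine TopologicalSpace.ext_nhds fun x => ?_
  rw [nhds_induced]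
  refine (@Metric.nhds_basis_ball _ (quotientMetric hPp).toPseudoMetricSpace x).ext
    (Metric.nhds_basis_ball.comap _) (fun ε hε => ?_) fun ε hε => ?_
  -- Only this inclusion needs the local estimate, hence the cap `1 / 6`; the reverse one uses the
  -- global bound of chords by paths.
  · refine ⟨min (1 / 6) (ε / 132), by positivity, fun z hz => ?_⟩
    have hz' : ‖embed hPp z - embed hPp x‖ < min (1 / 6) (ε / 132) := by
      rw [← dist_eq_norm]
      exact hz
    have h1 := quotientDist_le_of_norm_le hPp x z (hz'.le.trans (min_le_left _ _))
    have h2 := hz'.trans_le (min_le_right _ _)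
    change (quotientDist hPp z x).toReal < ε
    rw [quotientDist_comm]
    refine (ENNReal.toReal_le_of_le_ofReal (by positivity) h1).trans_lt ?_
    rw [lt_div_iff₀ (by norm_num)] at h2
    linarith
  · refine ⟨ε / 2, by positivity, fun z hz => ?_⟩
    replace hz : (quotientDist hPp z x).toReal < ε / 2 := hz
    rw [quotientDist_comm] at hz
    change dist (embed hPp z) (embed hPp x) < ε
    rw [dist_eq_norm]
    refine (norm_embed_sub_le_quotientDist hPp x z).trans_lt ?_
    have hs : √(3 / 2) ≤ 2 := by
      rw [Real.sqrt_le_left zero_le_two]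
      norm_num
    nlinarith [ENNReal.toReal_nonneg (a := quotientDist hPp x z)]

end Topology

end RestrictedSphere

end

theorem mainTheorem11 {H : Type*} [NormedAddCommGroup H] [InnerProductSpace ℂ H] [CompleteSpace H]
    (Pp : H →L[ℂ] H) (hPp : IsStarProjection Pp) :
    (∀ x y : RestrictedSphere.RestrictedBundle Pp,
      RestrictedSphere.quotientDist hPp x y ≠ ∞ ∧
      RestrictedSphere.ambientDist hPp x y ≠ ∞ ∧
      ENNReal.ofReal (1 / √2) * RestrictedSphere.quotientDist hPp x y ≤
        RestrictedSphere.ambientDist hPp x y ∧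
      RestrictedSphere.ambientDist hPp x y ≤
        ENNReal.ofReal √(3 / 2) * RestrictedSphere.quotientDist hPp x y) ∧
    ∃ m : MetricSpace (RestrictedSphere.RestrictedBundle Pp),
      (∀ x y, ENNReal.ofReal (m.dist x y) = RestrictedSphere.quotientDist hPp x y) ∧
      m.toUniformSpace.toTopologicalSpace =
        TopologicalSpace.induced (RestrictedSphere.embed hPp) inferInstance := by
  have hne := RestrictedSphere.quotientDist_ne_top hPp
  refine ⟨fun x y => ⟨hne x y, ne_top_of_le_ne_top (ENNReal.mul_ne_top ENNReal.ofReal_ne_top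
    (hne x y)) (RestrictedSphere.ambientDist_le hPp x y), ?_,
    RestrictedSphere.ambientDist_le hPp x y⟩, RestrictedSphere.quotientMetric hPp,
    fun x y => ENNReal.ofReal_toReal (hne x y), RestrictedSphere.quotientMetric_topology hPp⟩
  calc ENNReal.ofReal (1 / √2) * RestrictedSphere.quotientDist hPp x y
      ≤ ENNReal.ofReal (1 / √2) * (ENNReal.ofReal √2 * RestrictedSphere.ambientDist hPp x y) :=
        mul_le_mul_right (RestrictedSphere.quotientDist_le hPp x y) _
    _ = RestrictedSphere.ambientDist hPp x y := by
        rw [← mul_assoc, ← ENNReal.ofReal_mul (by positivity),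
          one_div_mul_cancel (by positivity), ENNReal.ofReal_one, one_mul]
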